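/- Let $N$ be a finite set of bidders and let $\mathcal I\subseteq 2^N$ be a downward-closed set system, i.e. $\varnothing\in\mathcal I$, and $S'\subseteq S\in\mathcal I$ implies $S'\in\mathcal I$. Consider the single-parameter auction with feasible allocations $\mathcal X=\mathrm{conv}\{\mathbf 1_S : S\in\mathcal I\}\subseteq[0,1]^N$, in which bidder $i$ has value $v_i\in[0,1]$, drawn independently from a distribution $D_i$, and utility $v_ix_i-p_i$. For a product value distribution $D=\prod_i D_i$: * $\mathrm{Opt}(D)$ is the supremum of the expected revenue under $D$ over all truthful auctions, i.e. measurable allocation and payment rules with feasible allocations and nonnegative payments, in which truthful bidders have nonnegative utility and bidding one's value maximizes one's utility whatever the other bids. * For one distribution $D_i$ let $q(v)=\Pr_{u\sim D_i}[u>v]$ and $v(q)=\inf\{v\ge 0: q(v)\le q\}$. The revenue curve $R(q)$, $q\in[0,1]$, equals $q\,v(q)$ if $D_i$ has no atom at $v(q)$. If it has one, $R(q)$ interpolates linearly between $q^-w(q^-)$ at $q^-=\Pr[u>v(q)]$ and $q^+w(q^+)$ at $q^+=\Pr[u\ge v(q)]$, where $w(q)=\sup\{v\ge 0:\Pr[u\ge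 v]\ge q\}$ (and $0\cdot w(0)=0$). The ironed revenue curve $\bar R$ is the upper boundary of the convex hull of the graph of $R$ over $[0,1]$, and the ironed virtual value $\bar\varphi_i(v)$ is the right derivative of $\bar R$ at $q(v)$ if $q(v)<1$, and $-\infty$ if $q(v)=1$. * Myerson's optimal auction $M_D$ chooses, measurably and as a function of the ironed virtual values $(\bar\varphi_i(v_i))_i$ only, some $x(v)\in\mathcal X$ maximizing $\sum_i x_i\bar\varphi_i(v_i)$ (with $0\cdot(-\infty)=0$), and charges $p_i(v)=v_ix_i(v)-\int_0^{v_i}x_i(t,v_{-i})\,dt$. Ties between maximizers may be broken arbitrarily. Write $M(D)$ for the expected revenue of $M$ under $D$, and $D\succeq\tilde D$ if $\Pr_{u\sim D_i}[u\le v]\le\Pr_{u\sim\tilde D_i}[u\le v]$ for all $i$ and all $v\ge0$. The auction satisfies *strong revenue monotonicity* if $M_{\tilde D}(D)\ge\mathrm{Opt}(\tilde D)$ for all product value distributions $D\succeq\tilde D$ and every choice of $M_{\tilde D}$. **Theorem.** The auction satisfies strong revenue monotonicity if and only if $\mathcal I$ is a matroid, i.e. for all $S,S'\in\mathcal I$ with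 $|S'|<|S|$ there is $i\in S\setminus S'$ with $S'\cup\{i\}\in\mathcal I$. The equivalence does not depend on tie-breaking: it also holds if strong revenue monotonicity is only required, for each $\tilde D$, of some choice of $M_{\tilde D}$ (the same for all $D\succeq\tilde D$). -/

import Mathlib

open MeasureTheory Set

noncomputable section

namespace Auction

/-! ### Value distributions, quantiles and revenue curves -/

/-- A value distribution: a Borel probability measure on the real line carried by `[0, 1]`. -/
structure IsValueDist (μ : Measure ℝ) : Prop where
  isProb : IsProbabilityMeasure μ
  mem_unit : ∀ᵐ u ∂μ, u ∈ Icc (0 : ℝ) 1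

/-- (First-order) stochastic dominance `μ ⪰ ν`: the CDF of `μ` is pointwise at most that of `ν`. -/
def Dominates (μ ν : Measure ℝ) : Prop :=
  ∀ v : ℝ, 0 ≤ v → μ.real (Iic v) ≤ ν.real (Iic v)

/-- The quantile `q_D(v) = Pr[u > v]` of a value `v`. -/
def quantile (μ : Measure ℝ) (v : ℝ) : ℝ := μ.real (Ioi v)

/-- The value `v_D(q) = inf {v ≥ 0 : q_D(v) ≤ q}` at a quantile `q`. -/
def valueAt (μ : Measure ℝ) (q : ℝ) : ℝ := sInf {v : ℝ | 0 ≤ v ∧ quantile μ v ≤ q}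

/-- The highest price that is accepted with probability at least `q`,
`sup {v ≥ 0 : Pr[u ≥ v] ≥ q}`; for `0 < q ≤ 1` this is the left limit of `v_D` at `q`.
(It is only used multiplied by `q`, so its value at `q = 0` is irrelevant.) -/
def priceAt (μ : Measure ℝ) (q : ℝ) : ℝ := sSup {v : ℝ | 0 ≤ v ∧ q ≤ μ.real (Ici v)}

open Classical in
/-- The revenue curve in quantile space: `q * v_D(q)` where there is no point mass at `v_D(q)`, and
linear interpolation over the quantile interval `[q⁻, q⁺]` of a point mass, where
`q⁺ = Pr[u ≥ v_D(q)]` and `q⁻ = Pr[u > v_D(q)]`. -/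
def revenueCurve (μ : Measure ℝ) (q : ℝ) : ℝ :=
  let v := valueAt μ q
  let qp := μ.real (Ici v)
  let qm := μ.real (Ioi v)
  if μ {v} = 0 then q * v
  else (q - qm) / (qp - qm) * (qp * priceAt μ qp) + (qp - q) / (qp - qm) * (qm * priceAt μ qm)

/-- The ironed revenue curve: the upper boundary of the convex hull of the graph of the revenue
curve over `[0, 1]`, that is, the largest mean of the revenue curve over distributions on `[0, 1]`
with mean `q`. -/
def ironedRevenueCurve (μ : Measure ℝ) (q : ℝ) : ℝ :=
  sSup {y : ℝ | (q, y) ∈ convexHull ℝ ((fun t : ℝ => (t, revenueCurve μ t)) '' Icc (0 : ℝ) 1)}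

open Classical in
/-- The ironed virtual value of `v`: the right derivative of the ironed revenue curve at `q_D(v)`,
with value `-∞` at quantile `1` (values below the support). -/
def ironedVirtualValue (μ : Measure ℝ) (v : ℝ) : EReal :=
  if quantile μ v < 1 then
    ((derivWithin (ironedRevenueCurve μ) (Ioi (quantile μ v)) (quantile μ v) : ℝ) : EReal)
  else ⊥

/-! ### Single-parameter auctions -/

variable {ι : Type*}

/-- A product value distribution, given by its marginals. -/
def IsProductValueDist (D : ι → Measure ℝ) : Prop := ∀ i, IsValueDist (D i)

/-- A (direct) mechanism: an allocation rule and a payment rule, as functions of the bids. -/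
structure Mechanism (ι : Type*) where
  alloc : (ι → ℝ) → ι → ℝ
  pay : (ι → ℝ) → ι → ℝ

/-- The expected revenue of a mechanism under a product distribution. -/
def revenue [Fintype ι] (M : Mechanism ι) (D : ι → Measure ℝ) : ℝ :=
  ∫ v, ∑ i, M.pay v i ∂(Measure.pi D)

/-- Truthful auctions with set of feasible allocations `X`, for values in `[0, 1]`: allocations are
feasible, payments are nonnegative, a truthful bidder has nonnegative utility, and bidding one's
value maximizes one's utility whatever the other bids are. -/
structure IsTruthful [DecidableEq ι] (X : Set (ι → ℝ)) (A : Mechanism ι) : Prop where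
  measurable_alloc : Measurable A.alloc
  measurable_pay : Measurable A.pay
  feasible : ∀ v ∈ Icc (0 : ι → ℝ) 1, A.alloc v ∈ X
  pay_nonneg : ∀ v ∈ Icc (0 : ι → ℝ) 1, ∀ i, 0 ≤ A.pay v i
  utility_nonneg : ∀ v ∈ Icc (0 : ι → ℝ) 1, ∀ i, 0 ≤ v i * A.alloc v i - A.pay v i
  incentive : ∀ v ∈ Icc (0 : ι → ℝ) 1, ∀ i, ∀ b ∈ Icc (0 : ℝ) 1,
    v i * A.alloc (Function.update v i b) i - A.pay (Function.update v i b) i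
      ≤ v i * A.alloc v i - A.pay v i

/-- The optimal expected revenue among truthful auctions. -/
def opt [Fintype ι] [DecidableEq ι] (X : Set (ι → ℝ)) (D : ι → Measure ℝ) : ℝ :=
  sSup {r : ℝ | ∃ A : Mechanism ι, IsTruthful X A ∧ r = revenue A D}

/-- The ironed virtual welfare w.r.t. `D` of the allocation `x` at the value profile `v`
(an unallocated bidder contributes `0`, even if its ironed virtual value is `-∞`). -/
def virtualWelfare [Fintype ι] (D : ι → Measure ℝ) (v x : ι → ℝ) : EReal :=
  ∑ i, (x i : EReal) * ironedVirtualValue (D i) (v i)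

/-- `M` is Myerson's optimal auction w.r.t. `D`: its allocation is a function of the ironed virtual
values w.r.t. `D`, always feasible and maximizing the ironed virtual welfare (ties being broken in
any measurable way), and payments are given by Myerson's formula. -/
structure IsMyerson [Fintype ι] [DecidableEq ι] (X : Set (ι → ℝ)) (D : ι → Measure ℝ)
    (M : Mechanism ι) : Prop where
  measurable_alloc : Measurable M.alloc
  feasible : ∀ v, M.alloc v ∈ X
  maximizes : ∀ v, ∀ y ∈ X, virtualWelfare D v y ≤ virtualWelfare D v (M.alloc v)
  depends_on_virtual : ∀ v v' : ι → ℝ,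
    (∀ i, ironedVirtualValue (D i) (v i) = ironedVirtualValue (D i) (v' i)) →
      M.alloc v = M.alloc v'
  payment : ∀ v i, M.pay v i =
    v i * M.alloc v i - ∫ t in (0 : ℝ)..(v i), M.alloc (Function.update v i t) i

/-- Strong revenue monotonicity of the auctions with feasible allocations `X`: running Myerson's
optimal auction w.r.t. `D'` (with any tie-breaking) on a dominating `D` gets at least the optimal
revenue from `D'`. -/
def StrongRevenueMonotone [Fintype ι] [DecidableEq ι] (X : Set (ι → ℝ)) : Prop :=
  ∀ D' : ι → Measure ℝ, IsProductValueDist D' → ∀ M : Mechanism ι, IsMyerson X D' M →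
    ∀ D : ι → Measure ℝ, IsProductValueDist D → (∀ i, Dominates (D i) (D' i)) →
      opt X D' ≤ revenue M D

/-- The variant in which, for each `D'`, the property is only required of Myerson's optimal auction
w.r.t. `D'` with some suitable tie-breaking. -/
def StrongRevenueMonotoneForSomeTieBreaking [Fintype ι] [DecidableEq ι] (X : Set (ι → ℝ)) : Prop :=
  ∀ D' : ι → Measure ℝ, IsProductValueDist D' → ∃ M : Mechanism ι, IsMyerson X D' M ∧
    ∀ D : ι → Measure ℝ, IsProductValueDist D → (∀ i, Dominates (D i) (D' i)) →
      opt X D' ≤ revenue M D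

/-! ### Set systems and matroids -/

/-- A downward-closed set system. -/
structure IsDownwardClosed (I : Set (Finset ι)) : Prop where
  empty_mem : ∅ ∈ I
  subset_mem : ∀ S ∈ I, ∀ S' ⊆ S, S' ∈ I

/-- A matroid, given by its independent sets: a downward-closed set system with the exchange
property. -/
structure IsMatroid [DecidableEq ι] (I : Set (Finset ι)) : Prop extends IsDownwardClosed I where
  exchange : ∀ S ∈ I, ∀ S' ∈ I, S'.card < S.card → ∃ i ∈ S \ S', insert i S' ∈ I

/-- The feasible allocations of a set system: convex combinations of the indicator vectors of its
members. -/
def feasibleAllocations [DecidableEq ι] (I : Set (Finset ι)) : Set (ι → ℝ) :=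
  convexHull ℝ ((fun (S : Finset ι) (i : ι) => if i ∈ S then (1 : ℝ) else 0) '' I)

end Auction

end

noncomputable section

namespace Auction

open Filter Topology

/-! ### Quantiles -/

section Quantile

variable {μ ν : Measure ℝ}

/-! Write `φ` for the positive part of the ironed virtual value with respect to `D'` (`posVirtual`),
and let `W` be the expectation under `D'` of the maximum of `∑ i ∈ S, φ i` over `S ∈ I`.

Matroids are monotone. Myerson's bound `opt_le_integral_maxWeight` gives `opt ≤ W`, so it remains to
see that the auction for `D'` earns at least `W` from a dominating `D`. Couple both distributions by
drawing uniform quantiles; then the value `v i` from `D` is at least the value `v' i` from `D'`.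
With the other bids fixed, bidder `i` faces a threshold `T i` on its virtual value, and its
allocation is a mixture of the two posted prices at the infima of `{φ̄ ≥ T i}` and `{φ̄ > T i}`. On
such a level set the revenue of the price from `D'` is at least the ironed virtual surplus, because
level sets do not cut ironed intervals (`IsLevelSet.integral_le`). The quantiles that win only
thanks to dominance pay the price too, and it is at least `T i` since virtual values never exceed
values. Hence the expected payment is at least that of `x i * max (T i) (φ (v' i))`
(`IsMyerson.integral_alloc_le_integral_pay`).

What remains is a pointwise combinatorial inequality, `IsMatroid.maxWeight_le_sum_max`: if `B` has
maximum weight for `φ (v)`, then `∑ i ∈ B, max (T i) (φ (v' i))` is at least the maximum weight for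
`φ (v')`. Only this step uses the exchange property, in the form "local optima are global".

Non-matroids are not monotone. A downward-closed system that is not a matroid contains `K ∪ {a}` and
`K ∪ {b, c}` but neither `K ∪ {a, b}` nor `K ∪ {a, c}` (`IsDownwardClosed.isMatroid_of_local`). Give
`K` the value `1`, `a` the value `3/5`, and let `b`, `c` have value `1` or, mostly, `1/4`. Selling
to `K ∪ {a}` earns `|K| + 3/5`. If `b` and `c` both have value `1`, each alone would suffice to beat
`a`, so each would still win with value `1/4` and pays at most that: the revenue is at most `|K| +
1/2`. The two bidders free-ride on one another. No tie occurs in this argument, so it covers every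
choice of tie-breaking. -/

theorem IsValueDist.measure_Iio_zero (h : IsValueDist μ) : μ (Iio 0) = 0 := by
  refine measure_mono_null ?_ (ae_iff.1 h.mem_unit)
  intro x hx hx'
  exact absurd hx'.1 (not_le.2 hx)

theorem IsValueDist.measure_Ioi_one (h : IsValueDist μ) : μ (Ioi 1) = 0 := by
  refine measure_mono_null ?_ (ae_iff.1 h.mem_unit)
  intro x hx hx'
  exact absurd hx'.2 (not_le.2 hx)

theorem quantile_nonneg (v : ℝ) : 0 ≤ quantile μ v := measureReal_nonneg

theorem IsValueDist.quantile_eq_zero (h : IsValueDist μ) {v : ℝ} (hv : 1 ≤ v) :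
    quantile μ v = 0 := by
  have : μ (Ioi v) = 0 := measure_mono_null (Ioi_subset_Ioi hv) h.measure_Ioi_one
  simp [quantile, Measure.real, this]

theorem IsValueDist.quantile_antitone (h : IsValueDist μ) : Antitone (quantile μ) := by
  have := h.isProb
  exact fun a b hab => measureReal_mono (Ioi_subset_Ioi hab)

theorem IsValueDist.quantile_le_one (h : IsValueDist μ) (v : ℝ) : quantile μ v ≤ 1 := by
  have := h.isProb
  exact measureReal_le_one

theorem IsValueDist.quantile_eq_one_sub_cdf (h : IsValueDist μ) (v : ℝ) :
    quantile μ v = 1 - ProbabilityTheory.cdf μ v := by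
  have := h.isProb
  rw [ProbabilityTheory.cdf_eq_real, quantile, ← compl_Iic,
    probReal_compl_eq_one_sub measurableSet_Iic]

theorem IsValueDist.quantile_of_neg (h : IsValueDist μ) {v : ℝ} (hv : v < 0) :
    quantile μ v = 1 := by
  have := h.isProb
  have h0 : μ (Iic v) = 0 := measure_mono_null (fun x hx => lt_of_le_of_lt hx hv) h.measure_Iio_zero
  rw [quantile, ← compl_Iic, probReal_compl_eq_one_sub measurableSet_Iic]
  simp [Measure.real, h0]

/-- The infimum defining `valueAt` is attained, by right continuity of the CDF. -/
theorem IsValueDist.quantile_valueAt_le (h : IsValueDist μ) {s : ℝ} (hs : 0 ≤ s) :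
    quantile μ (valueAt μ s) ≤ s := by
  have hne : {v : ℝ | 0 ≤ v ∧ quantile μ v ≤ s}.Nonempty :=
    ⟨1, zero_le_one, by rw [h.quantile_eq_zero le_rfl]; exact hs⟩
  have hbd : BddBelow {v : ℝ | 0 ≤ v ∧ quantile μ v ≤ s} := ⟨0, fun v hv => hv.1⟩
  have hrc : Tendsto (quantile μ) (𝓝[>] (valueAt μ s)) (𝓝 (quantile μ (valueAt μ s))) := by
    have := ((ProbabilityTheory.cdf μ).right_continuous (valueAt μ s)).tendsto
    have h2 := (tendsto_const_nhds (x := (1 : ℝ))).sub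
      (this.mono_left (nhdsWithin_mono _ Ioi_subset_Ici_self))
    rw [← h.quantile_eq_one_sub_cdf] at h2
    exact h2.congr fun v => (h.quantile_eq_one_sub_cdf v).symm
  refine le_of_tendsto hrc ?_
  filter_upwards [self_mem_nhdsWithin] with v hv
  obtain ⟨w, hw, hwv⟩ := exists_lt_of_csInf_lt hne hv
  exact (h.quantile_antitone hwv.le).trans hw.2

theorem valueAt_nonneg (s : ℝ) : 0 ≤ valueAt μ s := Real.sInf_nonneg fun _ hv => hv.1

theorem valueAt_le_of_quantile_le {v s : ℝ} (hv : 0 ≤ v) (hq : quantile μ v ≤ s) :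
    valueAt μ s ≤ v := csInf_le ⟨0, fun _ hv => hv.1⟩ ⟨hv, hq⟩

theorem IsValueDist.valueAt_le_iff (h : IsValueDist μ) {v s : ℝ} (hv : 0 ≤ v) (hs : 0 ≤ s) :
    valueAt μ s ≤ v ↔ quantile μ v ≤ s :=
  ⟨fun hle => (h.quantile_antitone hle).trans (h.quantile_valueAt_le hs),
    valueAt_le_of_quantile_le hv⟩

theorem IsValueDist.valueAt_le_one (h : IsValueDist μ) {s : ℝ} (hs : 0 ≤ s) : valueAt μ s ≤ 1 :=
  valueAt_le_of_quantile_le zero_le_one (by rw [h.quantile_eq_zero le_rfl]; exact hs)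

/-- The defining set is empty and the infimum takes its default value, so `valueAt` stays in `[0,
1]` at every real argument. -/
theorem valueAt_of_neg {s : ℝ} (hs : s < 0) : valueAt μ s = 0 := by
  have : {v : ℝ | 0 ≤ v ∧ quantile μ v ≤ s} = ∅ := by
    ext v
    simp only [mem_ofPred_eq, mem_empty_iff_false, iff_false, not_and, not_le]
    exact fun _ => hs.trans_le (quantile_nonneg v)
  rw [valueAt, this, Real.sInf_empty]

theorem IsValueDist.valueAt_mem (h : IsValueDist μ) (s : ℝ) : valueAt μ s ∈ Icc (0 : ℝ) 1 := by
  refine ⟨valueAt_nonneg s, ?_⟩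
  rcases lt_or_ge s 0 with hs | hs
  · rw [valueAt_of_neg hs]; exact zero_le_one
  · exact h.valueAt_le_one hs

theorem IsValueDist.measurable_valueAt (h : IsValueDist μ) : Measurable (valueAt μ) := by
  refine measurable_of_Iic fun v => ?_
  rcases lt_or_ge v 0 with hv | hv
  · convert MeasurableSet.empty
    ext s
    simp only [mem_preimage, mem_Iic, mem_empty_iff_false, iff_false, not_le]
    exact hv.trans_le (valueAt_nonneg s)
  · have : valueAt μ ⁻¹' Iic v = Iio 0 ∪ Ici (quantile μ v) := by
      ext s
      simp only [mem_preimage, mem_Iic, mem_union, mem_Iio, mem_Ici]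
      rcases lt_or_ge s 0 with hs | hs
      · simp [hs, valueAt_of_neg hs, hv]
      · rw [h.valueAt_le_iff hv hs]; simp [not_lt.2 hs]
    rw [this]
    exact measurableSet_Iio.union measurableSet_Ici

/-- The uniform distribution of quantiles. -/
def unif : Measure ℝ := volume.restrict (Ioo 0 1)

instance : IsProbabilityMeasure unif := ⟨by simp [unif]⟩

theorem ae_unif_mem : ∀ᵐ s ∂unif, s ∈ Ioo (0 : ℝ) 1 := ae_restrict_mem measurableSet_Ioo

theorem unif_real_Iio {q : ℝ} (h0 : 0 ≤ q) (h1 : q ≤ 1) : unif.real (Iio q) = q := by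
  rw [unif, measureReal_restrict_apply measurableSet_Iio]
  have : Iio q ∩ Ioo 0 1 = Ioo 0 q := by
    ext x; simp only [mem_inter_iff, mem_Iio, mem_Ioo]
    constructor
    · rintro ⟨a, b, c⟩; exact ⟨b, a⟩
    · rintro ⟨a, b⟩; exact ⟨b, a, b.trans_le h1⟩
  rw [this]; simp [h0]

theorem unif_real_Ici {q : ℝ} (h0 : 0 ≤ q) (h1 : q ≤ 1) : unif.real (Ici q) = 1 - q := by
  rw [← compl_Iio, probReal_compl_eq_one_sub measurableSet_Iio, unif_real_Iio h0 h1]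

/-- A value distribution is the law of the value at a uniformly distributed quantile. -/
theorem IsValueDist.map_valueAt (h : IsValueDist μ) : unif.map (valueAt μ) = μ := by
  have := h.isProb
  have : IsProbabilityMeasure (unif.map (valueAt μ)) :=
    Measure.isProbabilityMeasure_map h.measurable_valueAt.aemeasurable
  refine Measure.ext_of_Iic _ _ fun v => ?_
  rw [Measure.map_apply h.measurable_valueAt measurableSet_Iic]
  rcases lt_or_ge v 0 with hv | hv
  · have h1 : valueAt μ ⁻¹' Iic v = ∅ := by
      ext s
      simp only [mem_preimage, mem_Iic, mem_empty_iff_false, iff_false, not_le]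
      exact hv.trans_le (valueAt_nonneg s)
    rw [h1, measure_empty]
    exact (measure_mono_null (fun x hx => lt_of_le_of_lt hx hv) h.measure_Iio_zero).symm
  · have h1 : unif (valueAt μ ⁻¹' Iic v) = unif (Ici (quantile μ v)) := by
      refine measure_congr ?_
      filter_upwards [ae_unif_mem] with s hs
      exact propext (h.valueAt_le_iff hv hs.1.le)
    rw [h1, ← ENNReal.toReal_eq_toReal_iff' (measure_ne_top _ _) (measure_ne_top _ _)]
    change unif.real _ = μ.real _
    rw [unif_real_Ici (quantile_nonneg v) (h.quantile_le_one v), quantile, ← compl_Iic,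
      probReal_compl_eq_one_sub measurableSet_Iic]
    ring

theorem IsValueDist.integral_eq (h : IsValueDist μ) {F : ℝ → ℝ} (hF : Measurable F) :
    ∫ v, F v ∂μ = ∫ s, F (valueAt μ s) ∂unif := by
  conv_lhs => rw [← h.map_valueAt]
  exact integral_map h.measurable_valueAt.aemeasurable hF.aestronglyMeasurable

theorem Dominates.valueAt_le (hd : Dominates μ ν) (hμ : IsValueDist μ) (hν : IsValueDist ν)
    {s : ℝ} (hs : 0 ≤ s) : valueAt ν s ≤ valueAt μ s := by
  refine valueAt_le_of_quantile_le (valueAt_nonneg s) ?_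
  refine le_trans ?_ (hμ.quantile_valueAt_le hs)
  have := hμ.isProb
  have := hν.isProb
  rw [hμ.quantile_eq_one_sub_cdf, hν.quantile_eq_one_sub_cdf, ProbabilityTheory.cdf_eq_real,
    ProbabilityTheory.cdf_eq_real]
  linarith [hd (valueAt μ s) (valueAt_nonneg s)]

/-! Selling probabilities of posted prices. -/

/-- The probability that a posted price is accepted. -/
def sellProb (μ : Measure ℝ) (p : ℝ) : ℝ := μ.real (Ici p)

theorem sellProb_nonneg (p : ℝ) : 0 ≤ sellProb μ p := measureReal_nonneg

theorem IsValueDist.sellProb_le_one (h : IsValueDist μ) (p : ℝ) : sellProb μ p ≤ 1 := by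
  have := h.isProb
  exact measureReal_le_one

theorem IsValueDist.sellProb_zero (h : IsValueDist μ) : sellProb μ 0 = 1 := by
  have := h.isProb
  rw [sellProb, ← compl_Iio, probReal_compl_eq_one_sub measurableSet_Iio]
  simp [Measure.real, h.measure_Iio_zero]

theorem IsValueDist.sellProb_antitone (h : IsValueDist μ) : Antitone (sellProb μ) := by
  have := h.isProb
  exact fun a b hab => measureReal_mono (Ici_subset_Ici.2 hab)

theorem IsValueDist.quantile_le_sellProb (h : IsValueDist μ) (v : ℝ) :
    quantile μ v ≤ sellProb μ v := by
  have := h.isProb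
  exact measureReal_mono Ioi_subset_Ici_self

theorem IsValueDist.sellProb_le_quantile (h : IsValueDist μ) {v w : ℝ} (hvw : v < w) :
    sellProb μ w ≤ quantile μ v := by
  have := h.isProb
  exact measureReal_mono (Ici_subset_Ioi.2 hvw)

theorem IsValueDist.sellProb_eq_zero (h : IsValueDist μ) {p : ℝ} (hp : 1 < p) :
    sellProb μ p = 0 :=
  le_antisymm ((h.sellProb_le_quantile hp).trans_eq (h.quantile_eq_zero le_rfl)) (sellProb_nonneg p)

/-- The map `Pr[u ≥ ·]` is left continuous. -/
theorem IsValueDist.le_sellProb_of_forall_lt (h : IsValueDist μ) {p t : ℝ}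
    (ht : ∀ v < p, t ≤ quantile μ v) : t ≤ sellProb μ p := by
  have := h.isProb
  have hlim : Tendsto (fun v => ProbabilityTheory.cdf μ v) (𝓝[<] p)
      (𝓝 (Function.leftLim (ProbabilityTheory.cdf μ) p)) :=
    (ProbabilityTheory.cdf μ).mono.tendsto_leftLim p
  have hle : Function.leftLim (ProbabilityTheory.cdf μ) p ≤ 1 - t := by
    refine le_of_tendsto hlim ?_
    filter_upwards [self_mem_nhdsWithin] with v hv
    have := ht v hv
    rw [h.quantile_eq_one_sub_cdf] at this
    linarith
  have h1 : μ (Iio p) = ENNReal.ofReal (Function.leftLim (ProbabilityTheory.cdf μ) p) := by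
    conv_lhs => rw [← ProbabilityTheory.measure_cdf μ]
    rw [StieltjesFunction.measure_Iio _ (ProbabilityTheory.tendsto_cdf_atBot μ), sub_zero]
  have h2 : μ.real (Iio p) ≤ max (1 - t) 0 := by
    rw [Measure.real, h1, ENNReal.toReal_ofReal']
    exact max_le_max_right _ hle
  have h3 : sellProb μ p = 1 - μ.real (Iio p) := by
    rw [sellProb, ← compl_Iio, probReal_compl_eq_one_sub measurableSet_Iio]
  -- This removes the truncation at `0` that `ENNReal.ofReal` introduced.
  have h4 : t ≤ 1 := (ht (p - 1) (by linarith)).trans (h.quantile_le_one _)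
  rw [max_eq_left (by linarith)] at h2
  linarith

theorem IsValueDist.le_sellProb_valueAt (h : IsValueDist μ) {t : ℝ} (h1 : t ≤ 1) :
    t ≤ sellProb μ (valueAt μ t) := by
  refine h.le_sellProb_of_forall_lt fun v hv => ?_
  rcases lt_or_ge v 0 with hv0 | hv0
  · rw [h.quantile_of_neg hv0]; exact h1
  · by_contra hlt
    exact absurd (valueAt_le_of_quantile_le hv0 (not_le.1 hlt).le) (not_le.2 hv)

end Quantile

/-! ### The ironed revenue curve -/

section Curve

variable {μ : Measure ℝ}

theorem IsValueDist.quantile_lt_sellProb (h : IsValueDist μ) {v : ℝ} (hv : μ {v} ≠ 0) :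
    quantile μ v < sellProb μ v := by
  have := h.isProb
  have h1 : sellProb μ v = quantile μ v + μ.real {v} := by
    rw [sellProb, quantile, ← Ioi_union_left, measureReal_union (by simp)
      (measurableSet_singleton v)]
  have : 0 < μ.real {v} := ENNReal.toReal_pos hv (measure_ne_top _ _)
  linarith

/-- The point `(q, q * p)` lies on the segment from the origin to `(r, r * p)`, and an affine
function above both ends lies above the segment. -/
theorem mul_le_affine_of_le {A B p q r : ℝ} (hA : 0 ≤ A) (hp : p * r ≤ A + B * r) (hq : 0 ≤ q)
    (hqr : q ≤ r) : q * p ≤ A + B * q := by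
  rcases hq.eq_or_lt with rfl | hq
  · simpa using hA
  · have hr : 0 < r := hq.trans_le hqr
    have h1 : p - B ≤ A / r := by rw [le_div_iff₀ hr]; linarith
    have h2 : (p - B) * q ≤ A / r * q := mul_le_mul_of_nonneg_right h1 hq.le
    have h3 : A / r * q ≤ A := by
      rw [div_mul_eq_mul_div, div_le_iff₀ hr]
      exact mul_le_mul_of_nonneg_left hqr hA
    linarith

theorem IsValueDist.mul_priceAt_le (h : IsValueDist μ) {A B q : ℝ} (hA : 0 ≤ A)
    (hM : ∀ p, 0 ≤ p → p * sellProb μ p ≤ A + B * sellProb μ p) (hq : 0 ≤ q) (hq1 : q ≤ 1) :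
    q * priceAt μ q ≤ A + B * q := by
  rcases hq.eq_or_lt with rfl | hq
  · simpa using hA
  · rw [mul_comm, ← le_div_iff₀ hq]
    refine csSup_le ⟨0, le_rfl, hq1.trans_eq h.sellProb_zero.symm⟩ fun p hp => ?_
    rw [le_div_iff₀ hq, mul_comm]
    exact mul_le_affine_of_le hA (hM p hp.1) hq.le hp.2

theorem IsValueDist.mul_le_mul_priceAt (h : IsValueDist μ) {p q : ℝ} (hp : 0 ≤ p) (hq : 0 ≤ q)
    (hqp : q ≤ sellProb μ p) : q * p ≤ q * priceAt μ q := by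
  rcases hq.eq_or_lt with rfl | hq
  · simp
  · refine mul_le_mul_of_nonneg_left (le_csSup ⟨1, fun v hv => ?_⟩ ⟨hp, hqp⟩) hq.le
    by_contra hlt
    have := h.sellProb_eq_zero (not_le.1 hlt)
    exact absurd (hv.2.trans_eq this) (not_le.2 hq)

/-- Away from atoms this is the segment argument for the price `valueAt μ t`. Over an atom the curve
interpolates between two points that obey the affine bound, and affine bounds pass to
interpolations. -/
theorem IsValueDist.revenueCurve_le (h : IsValueDist μ) {A B t : ℝ} (hA : 0 ≤ A)
    (hM : ∀ p, 0 ≤ p → p * sellProb μ p ≤ A + B * sellProb μ p) (ht : t ∈ Icc (0 : ℝ) 1) :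
    revenueCurve μ t ≤ A + B * t := by
  have h1 := h.le_sellProb_valueAt ht.2
  have h2 := h.quantile_valueAt_le ht.1
  unfold revenueCurve
  simp only
  split_ifs with hat
  · exact mul_le_affine_of_le hA (hM _ (valueAt_nonneg t)) ht.1 h1
  · have hlt := h.quantile_lt_sellProb hat
    change (t - quantile μ (valueAt μ t)) / (sellProb μ (valueAt μ t) - quantile μ (valueAt μ t)) *
      (sellProb μ (valueAt μ t) * priceAt μ (sellProb μ (valueAt μ t))) +
      (sellProb μ (valueAt μ t) - t) / (sellProb μ (valueAt μ t) - quantile μ (valueAt μ t)) *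
      (quantile μ (valueAt μ t) * priceAt μ (quantile μ (valueAt μ t))) ≤ _
    have e1 := h.mul_priceAt_le hA hM (sellProb_nonneg (valueAt μ t))
      (h.sellProb_le_one (valueAt μ t))
    have e2 := h.mul_priceAt_le hA hM (quantile_nonneg (valueAt μ t))
      (h.quantile_le_one (valueAt μ t))
    set a := quantile μ (valueAt μ t)
    set b := sellProb μ (valueAt μ t)
    have hba : 0 < b - a := by linarith
    have f1 := mul_le_mul_of_nonneg_left e1 (div_nonneg (sub_nonneg.2 h2) hba.le)
    have f2 := mul_le_mul_of_nonneg_left e2 (div_nonneg (sub_nonneg.2 h1) hba.le)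
    have : (t - a) / (b - a) * (A + B * b) + (b - t) / (b - a) * (A + B * a) = A + B * t := by
      field_simp; ring
    linarith

/-- Over an atom `v`, both ends of the interpolation lie on or above the line of slope `v` through
the origin: `priceAt` there is at least `v` (unless the quantile is `0`). -/
theorem IsValueDist.mul_valueAt_le_revenueCurve (h : IsValueDist μ) {t : ℝ}
    (ht : t ∈ Icc (0 : ℝ) 1) : t * valueAt μ t ≤ revenueCurve μ t := by
  have h1 := h.le_sellProb_valueAt ht.2
  have h2 := h.quantile_valueAt_le ht.1
  unfold revenueCurve
  simp only
  split_ifs with hat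
  · exact le_rfl
  · have hlt := h.quantile_lt_sellProb hat
    change _ ≤ (t - quantile μ (valueAt μ t)) /
      (sellProb μ (valueAt μ t) - quantile μ (valueAt μ t)) *
      (sellProb μ (valueAt μ t) * priceAt μ (sellProb μ (valueAt μ t))) +
      (sellProb μ (valueAt μ t) - t) / (sellProb μ (valueAt μ t) - quantile μ (valueAt μ t)) *
      (quantile μ (valueAt μ t) * priceAt μ (quantile μ (valueAt μ t)))
    have e1 := h.mul_le_mul_priceAt (valueAt_nonneg t) (sellProb_nonneg (valueAt μ t)) le_rfl
    have e2 := h.mul_le_mul_priceAt (valueAt_nonneg t) (quantile_nonneg (valueAt μ t)) hlt.le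
    set a := quantile μ (valueAt μ t)
    set b := sellProb μ (valueAt μ t)
    have hba : 0 < b - a := by linarith
    have f1 := mul_le_mul_of_nonneg_left e1 (div_nonneg (sub_nonneg.2 h2) hba.le)
    have f2 := mul_le_mul_of_nonneg_left e2 (div_nonneg (sub_nonneg.2 h1) hba.le)
    have : (t - a) / (b - a) * (b * valueAt μ t) + (b - t) / (b - a) * (a * valueAt μ t)
        = t * valueAt μ t := by
      field_simp; ring
    linarith

/-- The section of the convex hull of the revenue curve above a quantile. -/
def hullSection (μ : Measure ℝ) (q : ℝ) : Set ℝ :=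
  {y : ℝ | (q, y) ∈ convexHull ℝ ((fun t : ℝ => (t, revenueCurve μ t)) '' Icc (0 : ℝ) 1)}

theorem IsValueDist.hullSection_le (h : IsValueDist μ) {A B q y : ℝ} (hA : 0 ≤ A)
    (hM : ∀ p, 0 ≤ p → p * sellProb μ p ≤ A + B * sellProb μ p) (hy : y ∈ hullSection μ q) :
    y ≤ A + B * q := by
  have hconv : Convex ℝ {z : ℝ × ℝ | z.2 - B * z.1 ≤ A} := by
    refine convex_halfSpace_le (f := fun z : ℝ × ℝ => z.2 - B * z.1)
      ⟨fun a b => ?_, fun c a => ?_⟩ A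
    · simp; ring
    · simp; ring
  have hsub : (fun t : ℝ => (t, revenueCurve μ t)) '' Icc (0 : ℝ) 1 ⊆
      {z : ℝ × ℝ | z.2 - B * z.1 ≤ A} := by
    rintro _ ⟨t, ht, rfl⟩
    have := h.revenueCurve_le hA hM ht
    simp only [mem_ofPred_eq]
    linarith
  have : (q, y) ∈ {z : ℝ × ℝ | z.2 - B * z.1 ≤ A} := convexHull_min hsub hconv hy
  simp only [mem_ofPred_eq] at this
  linarith

/-- Values are at most `1`. The shape `0 + 1 * _` fits the majorant hypothesis of `hullSection_le`
with `A = 0` and `B = 1`. -/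
theorem IsValueDist.mul_sellProb_le (h : IsValueDist μ) (p : ℝ) :
    p * sellProb μ p ≤ 0 + 1 * sellProb μ p := by
  rcases le_or_gt p 1 with hp | hp
  · nlinarith [sellProb_nonneg (μ := μ) p]
  · simp [h.sellProb_eq_zero hp]

theorem IsValueDist.bddAbove_hullSection (h : IsValueDist μ) (q : ℝ) :
    BddAbove (hullSection μ q) :=
  ⟨0 + 1 * q, fun _ hy => h.hullSection_le le_rfl (fun p _ => h.mul_sellProb_le p) hy⟩

theorem revenueCurve_mem_hullSection {q : ℝ} (hq : q ∈ Icc (0 : ℝ) 1) :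
    revenueCurve μ q ∈ hullSection μ q := subset_convexHull _ _ ⟨q, hq, rfl⟩

theorem IsValueDist.revenueCurve_le_ironed (h : IsValueDist μ) {q : ℝ} (hq : q ∈ Icc (0 : ℝ) 1) :
    revenueCurve μ q ≤ ironedRevenueCurve μ q :=
  le_csSup (h.bddAbove_hullSection q) (revenueCurve_mem_hullSection hq)

/-- The ironed revenue curve lies below every affine function that is nonnegative at `0` and
majorizes the revenues of all posted prices. -/
theorem IsValueDist.ironed_le (h : IsValueDist μ) {A B q : ℝ} (hA : 0 ≤ A)
    (hM : ∀ p, 0 ≤ p → p * sellProb μ p ≤ A + B * sellProb μ p) (hq : q ∈ Icc (0 : ℝ) 1) :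
    ironedRevenueCurve μ q ≤ A + B * q :=
  csSup_le ⟨_, revenueCurve_mem_hullSection hq⟩ fun _ hy => h.hullSection_le hA hM hy

theorem IsValueDist.ironed_le_self (h : IsValueDist μ) {q : ℝ} (hq : q ∈ Icc (0 : ℝ) 1) :
    ironedRevenueCurve μ q ≤ q := by
  simpa using h.ironed_le le_rfl (fun p _ => h.mul_sellProb_le p) hq

theorem IsValueDist.mul_valueAt_le_ironed (h : IsValueDist μ) {t : ℝ} (ht : t ∈ Icc (0 : ℝ) 1) :
    t * valueAt μ t ≤ ironedRevenueCurve μ t :=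
  (h.mul_valueAt_le_revenueCurve ht).trans (h.revenueCurve_le_ironed ht)

theorem IsValueDist.ironed_nonneg (h : IsValueDist μ) {t : ℝ} (ht : t ∈ Icc (0 : ℝ) 1) :
    0 ≤ ironedRevenueCurve μ t :=
  (mul_nonneg ht.1 (valueAt_nonneg t)).trans (h.mul_valueAt_le_ironed ht)

theorem IsValueDist.ironed_zero (h : IsValueDist μ) : ironedRevenueCurve μ 0 = 0 :=
  le_antisymm (h.ironed_le_self (by simp)) (h.ironed_nonneg (by simp))

theorem IsValueDist.concaveOn_ironed (h : IsValueDist μ) :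
    ConcaveOn ℝ (Icc 0 1) (ironedRevenueCurve μ) := by
  refine ⟨convex_Icc 0 1, fun x hx y hy a b ha hb hab => ?_⟩
  have key : ∀ s ∈ hullSection μ x, ∀ t ∈ hullSection μ y,
      a * s + b * t ≤ ironedRevenueCurve μ (a • x + b • y) := fun s hs t ht => by
    refine le_csSup (h.bddAbove_hullSection _) ?_
    have := convex_convexHull ℝ ((fun t : ℝ => (t, revenueCurve μ t)) '' Icc (0 : ℝ) 1)
      hs ht ha hb hab
    simpa using this
  have hlim : ∀ ε > 0, a * ironedRevenueCurve μ x + b * ironedRevenueCurve μ y ≤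
      ironedRevenueCurve μ (a • x + b • y) + ε := fun ε hε => by
    obtain ⟨s, hs, hs'⟩ := exists_lt_of_lt_csSup ⟨_, revenueCurve_mem_hullSection hx⟩
      (show ironedRevenueCurve μ x - ε < sSup (hullSection μ x) from sub_lt_self _ hε)
    obtain ⟨t, ht, ht'⟩ := exists_lt_of_lt_csSup ⟨_, revenueCurve_mem_hullSection hy⟩
      (show ironedRevenueCurve μ y - ε < sSup (hullSection μ y) from sub_lt_self _ hε)
    have := key s hs t ht
    have e1 := mul_le_mul_of_nonneg_left hs'.le ha
    have e2 := mul_le_mul_of_nonneg_left ht'.le hb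
    have e3 : a * ε + b * ε = ε := by rw [← add_mul, hab, one_mul]
    linarith
  exact le_of_forall_pos_le_add hlim

theorem IsValueDist.continuousOn_ironed_Ioo (h : IsValueDist μ) :
    ContinuousOn (ironedRevenueCurve μ) (Ioo 0 1) :=
  (h.concaveOn_ironed.subset Ioo_subset_Icc_self (convex_Ioo 0 1)).continuousOn isOpen_Ioo

/-- Concavity alone gives continuity only in the interior; at `0` the curve is squeezed between `0`
and the identity. The endpoint `1` is left out for good reason: `valueAt μ 1 = 0`, so the curve
drops to `0` there when the support stays away from `0`. This is why later arguments approach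
quantile `1` by limits. -/
theorem IsValueDist.continuousOn_ironed (h : IsValueDist μ) :
    ContinuousOn (ironedRevenueCurve μ) (Ico 0 1) := by
  intro q hq
  rcases hq.1.eq_or_lt with rfl | h0
  · have : Tendsto (ironedRevenueCurve μ) (𝓝[Ico 0 1] 0) (𝓝 0) := by
      refine tendsto_of_tendsto_of_tendsto_of_le_of_le' tendsto_const_nhds
        (tendsto_id.mono_left nhdsWithin_le_nhds) ?_ ?_
      · filter_upwards [self_mem_nhdsWithin] with x hx
        exact h.ironed_nonneg (Ico_subset_Icc_self hx)
      · filter_upwards [self_mem_nhdsWithin] with x hx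
        exact h.ironed_le_self (Ico_subset_Icc_self hx)
    rw [ContinuousWithinAt, h.ironed_zero]
    exact this
  · exact (h.continuousOn_ironed_Ioo.continuousAt (Ioo_mem_nhds h0 hq.2)).continuousWithinAt

/-- The ironed revenue curve majorizes the revenue of a posted price, sold with any probability
at most its selling probability. -/
theorem IsValueDist.mul_le_ironed (h : IsValueDist μ) {p q : ℝ} (hq : q ∈ Ico (0 : ℝ) 1)
    (hqp : q ≤ sellProb μ p) : q * p ≤ ironedRevenueCurve μ q := by
  rcases hq.1.eq_or_lt with rfl | h0
  · simp [h.ironed_zero]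
  -- For `t < q` the value at `t` is at least `p`. At `q` itself it may be smaller than `p`, hence
  -- the left limit below.
  have hlow : ∀ t ∈ Ioo 0 q, t * p ≤ ironedRevenueCurve μ t := fun t ht => by
    have ht1 : t ∈ Icc (0 : ℝ) 1 := ⟨ht.1.le, (ht.2.trans hq.2).le⟩
    refine le_trans (mul_le_mul_of_nonneg_left ?_ ht.1.le) (h.mul_valueAt_le_ironed ht1)
    by_contra hlt
    have e1 := h.sellProb_le_quantile (not_le.1 hlt)
    have e2 := h.quantile_valueAt_le ht.1.le
    linarith [ht.2]
  have hc : ContinuousAt (ironedRevenueCurve μ) q :=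
    h.continuousOn_ironed_Ioo.continuousAt (Ioo_mem_nhds h0 hq.2)
  refine le_of_tendsto_of_tendsto (b := 𝓝[<] q) (f := fun t => t * p)
    ((continuous_id.mul continuous_const).continuousAt.tendsto.mono_left nhdsWithin_le_nhds)
    (hc.tendsto.mono_left nhdsWithin_le_nhds) ?_
  filter_upwards [Ioo_mem_nhdsLT h0] with t ht using hlow t ht

end Curve

/-! ### Right derivative of the ironed revenue curve -/

section Slope

variable {μ : Measure ℝ}

/-- The right derivative of the ironed revenue curve. -/
def ironedSlope (μ : Measure ℝ) (q : ℝ) : ℝ := derivWithin (ironedRevenueCurve μ) (Ioi q) q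

/-- Inside the interval this is a general fact on convex functions. At the endpoint `0` the chord
slopes are monotone and, since the curve lies below the identity, bounded, so they converge. -/
theorem IsValueDist.hasDerivWithinAt_ironed (h : IsValueDist μ) {q : ℝ} (hq : q ∈ Ico (0 : ℝ) 1) :
    HasDerivWithinAt (ironedRevenueCurve μ) (ironedSlope μ q) (Ioi q) q := by
  refine DifferentiableWithinAt.hasDerivWithinAt ?_
  have hcx := h.concaveOn_ironed.neg
  rcases hq.1.eq_or_lt with rfl | h0
  · have hanti : MonotoneOn (slope (-ironedRevenueCurve μ) 0) (Ioo 0 1) :=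
      (hcx.slope_mono (by simp)).mono fun y hy => ⟨Ioo_subset_Icc_self hy, hy.1.ne'⟩
    have hlim := hanti.tendsto_nhdsWithin_Ioo_right (by simp) ⟨-1, by
      rintro _ ⟨y, hy, rfl⟩
      have := h.ironed_le_self (Ioo_subset_Icc_self hy)
      rw [slope_def_field, le_div_iff₀ (by simpa using hy.1)]
      simp only [Pi.neg_apply, h.ironed_zero]
      linarith⟩
    have := ((hasDerivWithinAt_iff_tendsto_slope'
      self_notMem_Ioi).2 hlim).differentiableWithinAt.neg
    simpa using this
  · have := (hcx.differentiableWithinAt_Ioi_of_mem_interior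
      (by rw [interior_Icc]; exact ⟨h0, hq.2⟩)).neg
    simpa using this

theorem three_point_of_concaveOn {s : Set ℝ} {f : ℝ → ℝ} (hf : ConcaveOn ℝ s f) {x y z : ℝ}
    (hx : x ∈ s) (hz : z ∈ s) (hxy : x < y) (hyz : y < z) :
    (z - y) * f x + (y - x) * f z ≤ (z - x) * f y := by
  have := hf.slope_anti_adjacent hx hz hxy hyz
  rw [div_le_div_iff₀ (by linarith) (by linarith)] at this
  linarith

theorem IsValueDist.ironed_le_tangent (h : IsValueDist μ) {q y : ℝ} (hq : q ∈ Ico (0 : ℝ) 1)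
    (hy : y ∈ Icc (0 : ℝ) 1) :
    ironedRevenueCurve μ y ≤ ironedRevenueCurve μ q + ironedSlope μ q * (y - q) := by
  have hd := h.hasDerivWithinAt_ironed hq
  rcases lt_trichotomy y q with hlt | rfl | hlt
  · have hle : ironedSlope μ q ≤ (ironedRevenueCurve μ q - ironedRevenueCurve μ y) / (q - y) := by
      refine le_of_tendsto ((hasDerivWithinAt_iff_tendsto_slope' self_notMem_Ioi).1 hd) ?_
      filter_upwards [Ioo_mem_nhdsGT hq.2] with z hz
      rw [slope_def_field]
      exact h.concaveOn_ironed.slope_anti_adjacent hy ⟨hq.1.trans hz.1.le, hz.2.le⟩ hlt hz.1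
    rw [le_div_iff₀ (by linarith)] at hle
    linarith
  · simp
  · have := h.concaveOn_ironed.slope_le_rightDeriv (Ico_subset_Icc_self hq) hy hlt
      hd.differentiableWithinAt
    rw [slope_def_field, div_le_iff₀ (by linarith)] at this
    unfold ironedSlope
    linarith

theorem IsValueDist.antitoneOn_ironedSlope (h : IsValueDist μ) :
    AntitoneOn (ironedSlope μ) (Ico 0 1) := by
  intro x hx y hy hxy
  rcases hxy.eq_or_lt with rfl | hlt
  · exact le_rfl
  · have e1 := h.ironed_le_tangent hx (Ico_subset_Icc_self hy)
    have e2 := h.ironed_le_tangent hy (Ico_subset_Icc_self hx)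
    have : ironedSlope μ y * (y - x) ≤ ironedSlope μ x * (y - x) := by linarith
    exact le_of_mul_le_mul_right this (by linarith)

theorem IsValueDist.ironedSlope_le_one (h : IsValueDist μ) {q : ℝ} (hq : q ∈ Ico (0 : ℝ) 1) :
    ironedSlope μ q ≤ 1 := by
  refine (h.antitoneOn_ironedSlope (by simp) hq hq.1).trans ?_
  refine le_of_tendsto ((hasDerivWithinAt_iff_tendsto_slope' self_notMem_Ioi).1
    (h.hasDerivWithinAt_ironed (q := 0) (by simp))) ?_
  filter_upwards [Ioo_mem_nhdsGT (zero_lt_one' ℝ)] with z hz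
  rw [slope_def_field, h.ironed_zero, div_le_one (by simpa using hz.1)]
  simpa using h.ironed_le_self (Ioo_subset_Icc_self hz)

theorem IsValueDist.intervalIntegrable_ironedSlope (h : IsValueDist μ) {a b : ℝ} (ha : 0 ≤ a)
    (hab : a ≤ b) (hb : b < 1) : IntervalIntegrable (ironedSlope μ) volume a b := by
  refine AntitoneOn.intervalIntegrable (h.antitoneOn_ironedSlope.mono ?_)
  rw [uIcc_of_le hab]
  exact fun x hx => ⟨ha.trans hx.1, hx.2.trans_lt hb⟩

theorem IsValueDist.integral_ironedSlope (h : IsValueDist μ) {q : ℝ} (hq : q ∈ Ico (0 : ℝ) 1) :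
    ∫ s in (0 : ℝ)..q, ironedSlope μ s = ironedRevenueCurve μ q := by
  rw [intervalIntegral.integral_eq_sub_of_hasDeriv_right_of_le hq.1
    (h.continuousOn_ironed.mono fun x hx => ⟨hx.1, hx.2.trans_lt hq.2⟩)
    (fun x hx => h.hasDerivWithinAt_ironed ⟨hx.1.le, hx.2.trans hq.2⟩)
    (h.intervalIntegrable_ironedSlope le_rfl hq.1 hq.2), h.ironed_zero, sub_zero]

/-- If the revenues of the posted prices with selling probability in `(a, b)` lie below the chord
of the ironed revenue curve over `[a, b]`, then the curve is affine there, so its slope is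
constant. -/
theorem IsValueDist.ironedSlope_eq_of_chord (h : IsValueDist μ) {a b A B : ℝ} (ha : 0 ≤ a)
    (hab : a < b) (hb : b < 1) (hLa : ironedRevenueCurve μ a = A + B * a)
    (hLb : ironedRevenueCurve μ b = A + B * b)
    (hp : ∀ p, 0 ≤ p → sellProb μ p ∈ Ioo a b → p * sellProb μ p ≤ A + B * sellProb μ p)
    {s : ℝ} (hs : s ∈ Ico a b) : ironedSlope μ s = B := by
  -- Outside a chord, a concave function lies below the line that extends the chord.
  have hout : ∀ t ∈ Icc (0 : ℝ) 1, t ∉ Ioo a b → ironedRevenueCurve μ t ≤ A + B * t := by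
    intro t ht hnt
    have hba : 0 < b - a := by linarith
    rcases lt_trichotomy t a with hta | rfl | hta
    · have := three_point_of_concaveOn h.concaveOn_ironed ht ⟨ha.trans hab.le, hb.le⟩ hta hab
      rw [hLa, hLb] at this
      refine le_of_mul_le_mul_left (a := b - a) ?_ hba
      linarith
    · exact hLa.le
    · have hbt : b ≤ t := by
        by_contra hlt
        exact hnt ⟨hta, not_le.1 hlt⟩
      rcases hbt.eq_or_lt with rfl | hbt
      · exact hLb.le
      · have := three_point_of_concaveOn h.concaveOn_ironed ⟨ha, hab.le.trans hb.le⟩ ht hab hbt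
        rw [hLa, hLb] at this
        refine le_of_mul_le_mul_left (a := b - a) ?_ hba
        linarith
  have hA : 0 ≤ A := by
    have := hout 0 (by simp) (by simp [ha])
    rw [h.ironed_zero] at this
    linarith
  have hmaj : ∀ p, 0 ≤ p → p * sellProb μ p ≤ A + B * sellProb μ p := by
    intro p hp0
    by_cases hin : sellProb μ p ∈ Ioo a b
    · exact hp p hp0 hin
    rcases (h.sellProb_le_one p).eq_or_lt with h1 | h1
    · rw [h1]
      -- A price that always sells has selling probability `1`, where the curve may jump down; the
      -- bound is obtained for selling with probability `t < 1` and passes to the limit.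
      have hlim : ∀ t ∈ Ioo b 1, t * p ≤ A + B * t := fun t ht => by
        have ht' : t ∈ Ico (0 : ℝ) 1 := ⟨(ha.trans hab.le).trans ht.1.le, ht.2⟩
        exact (h.mul_le_ironed ht' (ht.2.le.trans_eq h1.symm)).trans
          (hout t (Ico_subset_Icc_self ht') fun hh => absurd hh.2 (not_lt.2 ht.1.le))
      have : (1 : ℝ) * p ≤ A + B * 1 := by
        refine le_of_tendsto_of_tendsto (b := 𝓝[<] (1 : ℝ)) (f := fun t => t * p)
          (g := fun t => A + B * t) (Continuous.tendsto' (by fun_prop) _ _ rfl |>.mono_left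
            nhdsWithin_le_nhds) (Continuous.tendsto' (by fun_prop) _ _ rfl |>.mono_left
            nhdsWithin_le_nhds) ?_
        filter_upwards [Ioo_mem_nhdsLT hb] with t ht using hlim t ht
      linarith
    · have hr : sellProb μ p ∈ Ico (0 : ℝ) 1 := ⟨sellProb_nonneg p, h1⟩
      rw [mul_comm]
      exact (h.mul_le_ironed hr le_rfl).trans (hout _ (Ico_subset_Icc_self hr) hin)
  -- The line majorizes all posted prices, hence the curve; concavity gives the reverse inequality
  -- over the chord.
  have heq : ∀ t ∈ Icc a b, ironedRevenueCurve μ t = A + B * t := by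
    intro t ht
    refine le_antisymm (h.ironed_le hA hmaj ⟨ha.trans ht.1, ht.2.trans hb.le⟩) ?_
    rcases ht.1.eq_or_lt with rfl | h1
    · exact hLa.ge
    rcases ht.2.eq_or_lt with rfl | h2
    · exact hLb.ge
    have := three_point_of_concaveOn h.concaveOn_ironed (x := a) (z := b)
      ⟨ha, hab.le.trans hb.le⟩ ⟨ha.trans hab.le, hb.le⟩ h1 h2
    rw [hLa, hLb] at this
    refine le_of_mul_le_mul_left (a := b - a) ?_ (by linarith)
    linarith
  refine HasDerivWithinAt.derivWithin ?_ (uniqueDiffWithinAt_Ioi s)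
  have hline : HasDerivWithinAt (fun t => A + B * t) B (Ioi s) s := by
    simpa using (((hasDerivAt_id s).const_mul B).const_add A).hasDerivWithinAt (s := Ioi s)
  refine hline.congr_of_eventuallyEq ?_ (heq s (Ico_subset_Icc_self hs))
  filter_upwards [Ioo_mem_nhdsGT hs.2] with t ht
  exact heq t ⟨hs.1.trans ht.1.le, ht.2.le⟩

/-- The smaller of the two end heights is below the whole chord, so the chord criterion applies. -/
theorem IsValueDist.ironedSlope_eq_of_min (h : IsValueDist μ) {a b : ℝ} (ha : 0 ≤ a)
    (hab : a < b) (hb : b < 1)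
    (hp : ∀ p, 0 ≤ p → sellProb μ p ∈ Ioo a b →
      p * sellProb μ p ≤ min (ironedRevenueCurve μ a) (ironedRevenueCurve μ b))
    {s t : ℝ} (hs : s ∈ Ico a b) (ht : t ∈ Ico a b) : ironedSlope μ s = ironedSlope μ t := by
  set B := (ironedRevenueCurve μ b - ironedRevenueCurve μ a) / (b - a) with hB
  have hba : 0 < b - a := by linarith
  have hBe : B * (b - a) = ironedRevenueCurve μ b - ironedRevenueCurve μ a := by
    rw [hB]; field_simp
  have key : ∀ p, 0 ≤ p → sellProb μ p ∈ Ioo a b →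
      p * sellProb μ p ≤ (ironedRevenueCurve μ a - B * a) + B * sellProb μ p := by
    intro p hp0 hin
    have e1 := (hp p hp0 hin).trans (min_le_left _ _)
    have e2 := (hp p hp0 hin).trans (min_le_right _ _)
    rcases le_total 0 B with h0 | h0
    · nlinarith [mul_nonneg h0 (sub_nonneg.2 hin.1.le)]
    · nlinarith [mul_nonneg (neg_nonneg.2 h0) (sub_nonneg.2 hin.2.le)]
  have hLb : ironedRevenueCurve μ b = (ironedRevenueCurve μ a - B * a) + B * b := by linarith
  rw [h.ironedSlope_eq_of_chord ha hab hb (by ring) hLb key hs,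
    h.ironedSlope_eq_of_chord ha hab hb (by ring) hLb key ht]

theorem IsValueDist.ironedSlope_eq_of_gap (h : IsValueDist μ) {a b : ℝ} (ha : 0 ≤ a)
    (hb : b < 1) (hp : ∀ p, 0 ≤ p → sellProb μ p ∉ Ioo a b)
    {s t : ℝ} (hs : s ∈ Ico a b) (ht : t ∈ Ico a b) : ironedSlope μ s = ironedSlope μ t :=
  h.ironedSlope_eq_of_min ha (hs.1.trans_lt hs.2) hb (fun p hp0 hin => absurd hin (hp p hp0)) hs ht

/-- Rounding a quantile down to the quantile of its value does not change the slope, up to the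
right end of an atom. -/
theorem IsValueDist.ironedSlope_quantile_valueAt_le (h : IsValueDist μ) {s t : ℝ} (ht : 0 ≤ t)
    (hts : t < s) (hs : s < 1) :
    ironedSlope μ (quantile μ (valueAt μ s)) ≤ ironedSlope μ t := by
  have hs0 : 0 ≤ s := ht.trans hts.le
  have hq := h.quantile_valueAt_le hs0
  rcases le_or_gt t (quantile μ (valueAt μ s)) with hle | hlt
  · exact h.antitoneOn_ironedSlope ⟨ht, hts.trans hs⟩ ⟨quantile_nonneg _, hq.trans_lt hs⟩ hle
  · refine (h.ironedSlope_eq_of_gap (quantile_nonneg _) hs (fun p hp0 hin => ?_)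
      ⟨le_rfl, hlt.trans hts⟩ ⟨hlt.le, hts⟩).le
    rcases le_or_gt p (valueAt μ s) with hp | hp
    · exact absurd (h.sellProb_antitone hp)
        (not_le.2 (hin.2.trans_le (h.le_sellProb_valueAt hs.le)))
    · exact absurd (h.sellProb_le_quantile hp) (not_le.2 hin.1)

end Slope

/-! ### Ironed virtual values -/

section VirtualValue

variable {μ : Measure ℝ}

theorem ironedVirtualValue_of_lt {v : ℝ} (hv : quantile μ v < 1) :
    ironedVirtualValue μ v = (ironedSlope μ (quantile μ v) : EReal) := by
  simp [ironedVirtualValue, hv, ironedSlope]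

theorem ironedVirtualValue_of_ge {v : ℝ} (hv : 1 ≤ quantile μ v) :
    ironedVirtualValue μ v = ⊥ := by
  simp [ironedVirtualValue, not_lt.2 hv]

theorem quantile_lt_one_of_ne_bot {v : ℝ} (hv : ironedVirtualValue μ v ≠ ⊥) :
    quantile μ v < 1 := by
  by_contra hlt
  exact hv (ironedVirtualValue_of_ge (not_lt.1 hlt))

theorem IsValueDist.monotone_ironedVirtualValue (h : IsValueDist μ) :
    Monotone (ironedVirtualValue μ) := by
  intro v w hvw
  rcases lt_or_ge (quantile μ v) 1 with hv | hv
  · have hqw := h.quantile_antitone hvw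
    rw [ironedVirtualValue_of_lt hv, ironedVirtualValue_of_lt (hqw.trans_lt hv)]
    exact EReal.coe_le_coe_iff.2 (h.antitoneOn_ironedSlope
      ⟨quantile_nonneg _, hqw.trans_lt hv⟩ ⟨quantile_nonneg _, hv⟩ hqw)
  · rw [ironedVirtualValue_of_ge hv]
    exact bot_le

theorem IsValueDist.ironedVirtualValue_of_neg (h : IsValueDist μ) {v : ℝ} (hv : v < 0) :
    ironedVirtualValue μ v = ⊥ := ironedVirtualValue_of_ge (h.quantile_of_neg hv).ge

/-- Ironed virtual values are at most the values. -/
theorem IsValueDist.ironedSlope_quantile_le (h : IsValueDist μ) {v : ℝ}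
    (hq : quantile μ v < 1) : ironedSlope μ (quantile μ v) ≤ v := by
  by_contra hlt
  rw [not_le] at hlt
  set q := quantile μ v with hqd
  have hqm : q ∈ Ico (0 : ℝ) 1 := ⟨quantile_nonneg _, hq⟩
  have hG : q * v ≤ ironedRevenueCurve μ q := h.mul_le_ironed hqm (h.quantile_le_sellProb v)
  have hleft : ∀ t ∈ Icc (0 : ℝ) 1, t ≤ q →
      ironedRevenueCurve μ t ≤ (ironedRevenueCurve μ q - v * q) + v * t := by
    intro t ht htq
    have := h.ironed_le_tangent hqm ht
    nlinarith [mul_nonneg (sub_nonneg.2 hlt.le) (sub_nonneg.2 htq)]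
  -- Were the slope at `q` larger than `v`, the line of slope `v` through the point of the curve at
  -- `q` would still majorize all posted prices: left of `q` because the tangent is steeper, right
  -- of `q` because prices selling there are at most `v`. Then the slope is at most `v` after all.
  have hmaj : ∀ p, 0 ≤ p →
      p * sellProb μ p ≤ (ironedRevenueCurve μ q - v * q) + v * sellProb μ p := by
    intro p hp
    rcases le_or_gt (sellProb μ p) q with hr | hr
    · have hr' : sellProb μ p ∈ Ico (0 : ℝ) 1 := ⟨sellProb_nonneg p, hr.trans_lt hq⟩
      rw [mul_comm]
      exact (h.mul_le_ironed hr' le_rfl).trans (hleft _ (Ico_subset_Icc_self hr') hr)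
    · have hpv : p ≤ v := by
        by_contra hh
        exact absurd (h.sellProb_le_quantile (not_le.1 hh)) (not_le.2 hr)
      nlinarith [mul_le_mul_of_nonneg_right hpv (sellProb_nonneg (μ := μ) p)]
  have hle : ironedSlope μ q ≤ v := by
    refine le_of_tendsto ((hasDerivWithinAt_iff_tendsto_slope' self_notMem_Ioi).1
      (h.hasDerivWithinAt_ironed hqm)) ?_
    filter_upwards [Ioo_mem_nhdsGT hq] with z hz
    have := h.ironed_le (by linarith) hmaj (q := z) ⟨hqm.1.trans hz.1.le, hz.2.le⟩
    rw [slope_def_field, div_le_iff₀ (by linarith [hz.1])]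
    linarith
  linarith

theorem IsValueDist.ironedVirtualValue_le (h : IsValueDist μ) (v : ℝ) :
    ironedVirtualValue μ v ≤ (v : EReal) := by
  rcases lt_or_ge (quantile μ v) 1 with hq | hq
  · rw [ironedVirtualValue_of_lt hq]
    exact EReal.coe_le_coe_iff.2 (h.ironedSlope_quantile_le hq)
  · rw [ironedVirtualValue_of_ge hq]; exact bot_le

/-- The positive part of the ironed virtual value, as a real number. -/
def posVirtual (μ : Measure ℝ) (v : ℝ) : ℝ := (max (ironedVirtualValue μ v) 0).toReal

theorem posVirtual_of_lt {v : ℝ} (hv : quantile μ v < 1) :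
    posVirtual μ v = max (ironedSlope μ (quantile μ v)) 0 := by
  rw [posVirtual, ironedVirtualValue_of_lt hv, ← EReal.coe_zero,
    ← EReal.coe_strictMono.monotone.map_max, EReal.toReal_coe]

theorem posVirtual_of_ge {v : ℝ} (hv : 1 ≤ quantile μ v) : posVirtual μ v = 0 := by
  rw [posVirtual, ironedVirtualValue_of_ge hv]; simp

theorem posVirtual_nonneg (v : ℝ) : 0 ≤ posVirtual μ v :=
  EReal.toReal_nonneg (le_max_right _ _)

theorem coe_posVirtual (v : ℝ) :
    ((posVirtual μ v : ℝ) : EReal) = max (ironedVirtualValue μ v) 0 := by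
  rcases lt_or_ge (quantile μ v) 1 with hq | hq
  · rw [posVirtual_of_lt hq, ironedVirtualValue_of_lt hq, EReal.coe_strictMono.monotone.map_max,
      EReal.coe_zero]
  · rw [posVirtual_of_ge hq, ironedVirtualValue_of_ge hq]; simp

theorem IsValueDist.posVirtual_le_one (h : IsValueDist μ) (v : ℝ) : posVirtual μ v ≤ 1 := by
  rcases lt_or_ge (quantile μ v) 1 with hq | hq
  · rw [posVirtual_of_lt hq]
    exact max_le (h.ironedSlope_le_one ⟨quantile_nonneg _, hq⟩) zero_le_one
  · rw [posVirtual_of_ge hq]; exact zero_le_one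

theorem IsValueDist.monotone_posVirtual (h : IsValueDist μ) : Monotone (posVirtual μ) := by
  intro v w hvw
  rw [← EReal.coe_le_coe_iff, coe_posVirtual, coe_posVirtual]
  exact max_le_max_right _ (h.monotone_ironedVirtualValue hvw)

theorem IsValueDist.measurable_posVirtual (h : IsValueDist μ) : Measurable (posVirtual μ) :=
  h.monotone_posVirtual.measurable

end VirtualValue

/-! ### Revenue from a single bidder -/

section SingleBidder

variable {μ ν : Measure ℝ} {U : Set ℝ}

/-- Together with `valueAt_notMem_of_gt`: in quantile space an upper set of values is an initial
interval of length `μ.real U`, up to its right end. Upper sets rather than prices are used so that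
both closed and open half-lines are covered. -/
theorem IsValueDist.valueAt_mem_of_lt (h : IsValueDist μ) (hU : IsUpperSet U) {s : ℝ}
    (hs : 0 ≤ s) (hlt : s < μ.real U) : valueAt μ s ∈ U := by
  have := h.isProb
  by_contra hn
  have hsub : U ⊆ Ioi (valueAt μ s) := fun u hu => by
    by_contra hle
    exact hn (hU (not_lt.1 hle) hu)
  have h1 : μ.real U ≤ quantile μ (valueAt μ s) := measureReal_mono hsub
  linarith [h.quantile_valueAt_le hs]

theorem IsValueDist.valueAt_notMem_of_gt (h : IsValueDist μ) (hU : IsUpperSet U) {s : ℝ}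
    (hs : s ≤ 1) (hlt : μ.real U < s) : valueAt μ s ∉ U := by
  have := h.isProb
  intro hn
  have h1 : sellProb μ (valueAt μ s) ≤ μ.real U := measureReal_mono fun u hu => hU hu hn
  linarith [h.le_sellProb_valueAt hs]

theorem IsValueDist.integral_indicator_valueAt (h : IsValueDist μ) (hU : IsUpperSet U)
    (H : ℝ → ℝ) :
    ∫ s, U.indicator 1 (valueAt μ s) * H s ∂unif = ∫ s in (0 : ℝ)..(μ.real U), H s := by
  have := h.isProb
  rw [intervalIntegral.integral_of_le measureReal_nonneg, integral_Ioc_eq_integral_Ioo,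
    ← integral_indicator measurableSet_Ioo, unif, ← integral_indicator measurableSet_Ioo]
  refine integral_congr_ae ?_
  have hne : ∀ᵐ s : ℝ, s ≠ μ.real U := by simp [ae_iff]
  filter_upwards [hne] with s hs
  by_cases h1 : s ∈ Ioo (0 : ℝ) 1
  · rw [indicator_of_mem h1]
    rcases hs.lt_or_gt with hlt | hlt
    · rw [indicator_of_mem (h.valueAt_mem_of_lt hU h1.1.le hlt), indicator_of_mem
        (show s ∈ Ioo 0 (μ.real U) from ⟨h1.1, hlt⟩)]
      simp
    · rw [indicator_of_notMem (h.valueAt_notMem_of_gt hU h1.2.le hlt), indicator_of_notMem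
        (fun hh : s ∈ Ioo 0 (μ.real U) => absurd hh.2 hlt.not_gt), zero_mul]
  · rw [indicator_of_notMem h1, indicator_of_notMem]
    exact fun hh => h1 ⟨hh.1, hh.2.trans_le measureReal_le_one⟩

theorem IsValueDist.intervalIntegrable_posVirtual (h : IsValueDist μ) (a b : ℝ) :
    IntervalIntegrable (fun s => posVirtual μ (valueAt μ s)) volume a b := by
  rw [intervalIntegrable_iff]
  refine Measure.integrableOn_of_bounded (M := 1) measure_Ioc_lt_top.ne
    (h.measurable_posVirtual.comp h.measurable_valueAt).aestronglyMeasurable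
    (Eventually.of_forall fun s => ?_)
  rw [Real.norm_of_nonneg (posVirtual_nonneg _)]
  exact h.posVirtual_le_one _

/-- The revenue of a posted price is at most the positive ironed virtual surplus. -/
theorem IsValueDist.mul_le_integral_posVirtual (h : IsValueDist μ) {a : ℝ}
    (ha : ∀ u ∈ U, a ≤ u) :
    a * μ.real U ≤ ∫ s in (0 : ℝ)..(μ.real U), posVirtual μ (valueAt μ s) := by
  have := h.isProb
  set Q := μ.real U with hQ
  have hQ0 : 0 ≤ Q := measureReal_nonneg
  have hQ1 : Q ≤ 1 := measureReal_le_one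
  rcases hQ0.eq_or_lt with h0 | h0
  · simp [← h0]
  have hra : Q ≤ sellProb μ a := measureReal_mono fun u hu => ha u hu
  -- The slope integrates to the curve only below quantile `1`, and `Q` may equal `1`, so the bound
  -- is proved for `q < Q` first.
  have key : ∀ q ∈ Ioo 0 Q, a * q ≤ ∫ s in (0 : ℝ)..Q, posVirtual μ (valueAt μ s) := by
    intro q hq
    have hqm : q ∈ Ico (0 : ℝ) 1 := ⟨hq.1.le, hq.2.trans_le hQ1⟩
    have e1 : a * q ≤ ironedRevenueCurve μ q := by
      rw [mul_comm]; exact h.mul_le_ironed hqm (hq.2.le.trans hra)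
    rw [← h.integral_ironedSlope hqm] at e1
    refine e1.trans ?_
    refine (intervalIntegral.integral_mono_on hq.1.le
      (h.intervalIntegrable_ironedSlope le_rfl hq.1.le hqm.2)
      (h.intervalIntegrable_posVirtual 0 q) fun s hs => ?_).trans ?_
    · have hs1 : s < 1 := hs.2.trans_lt hqm.2
      have hqs := h.quantile_valueAt_le hs.1
      rw [posVirtual_of_lt (hqs.trans_lt hs1)]
      exact (h.antitoneOn_ironedSlope ⟨quantile_nonneg _, hqs.trans_lt hs1⟩ ⟨hs.1, hs1⟩ hqs).trans
        (le_max_left _ _)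
    · rw [← intervalIntegral.integral_add_adjacent_intervals
        (h.intervalIntegrable_posVirtual 0 q) (h.intervalIntegrable_posVirtual q Q)]
      have := intervalIntegral.integral_nonneg (μ := volume) hq.2.le
        (fun s _ => posVirtual_nonneg (μ := μ) (valueAt μ s))
      linarith
  refine le_of_tendsto (x := 𝓝[<] Q) (f := fun q => a * q)
    (Continuous.tendsto' (by fun_prop) _ _ rfl |>.mono_left nhdsWithin_le_nhds) ?_
  filter_upwards [Ioo_mem_nhdsLT h0] with q hq using key q hq

/-- A level set of the ironed virtual value function: an upper set of values with nonnegative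
ironed virtual value, membership in which is determined by the ironed virtual value. -/
structure IsLevelSet (μ : Measure ℝ) (U : Set ℝ) : Prop where
  upper : IsUpperSet U
  nonneg : ∀ v ∈ U, 0 ≤ ironedVirtualValue μ v
  congr : ∀ v w, ironedVirtualValue μ v = ironedVirtualValue μ w → v ∈ U → w ∈ U

theorem IsLevelSet.quantile_lt_one (hU : IsLevelSet μ U) {v : ℝ} (hv : v ∈ U) :
    quantile μ v < 1 := by
  refine quantile_lt_one_of_ne_bot fun hb => ?_
  have := hU.nonneg v hv
  rw [hb] at this
  simp at this

theorem IsLevelSet.slope_nonneg (hU : IsLevelSet μ U) {v : ℝ} (hv : v ∈ U) :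
    0 ≤ ironedSlope μ (quantile μ v) := by
  have := hU.nonneg v hv
  rw [ironedVirtualValue_of_lt (hU.quantile_lt_one hv)] at this
  exact_mod_cast this

theorem IsLevelSet.nonneg_of_mem (hU : IsLevelSet μ U) (h : IsValueDist μ) {v : ℝ} (hv : v ∈ U) :
    0 ≤ v := by
  by_contra hlt
  have := hU.nonneg v hv
  rw [h.ironedVirtualValue_of_neg (not_le.1 hlt)] at this
  simp at this

/-- Slopes are nonnegative at quantiles of members of `U`. A quantile `s` strictly between `y` and
`μ.real U` carries this over to `y` itself, since rounding `s` down to the quantile of its value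
does not raise the slope above that at `y`. -/
theorem IsLevelSet.ironed_mono (hU : IsLevelSet μ U) (h : IsValueDist μ) {x y : ℝ} (hx : 0 ≤ x)
    (hxy : x ≤ y) (hy : y < μ.real U) : ironedRevenueCurve μ x ≤ ironedRevenueCurve μ y := by
  have := h.isProb
  have hQ1 : μ.real U ≤ 1 := measureReal_le_one
  obtain ⟨s, hys, hsQ⟩ := exists_between hy
  have hy0 := hx.trans hxy
  have hs := h.valueAt_mem_of_lt hU.upper (hy0.trans hys.le) hsQ
  have e1 := h.ironedSlope_quantile_valueAt_le hy0 hys (hsQ.trans_le hQ1)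
  have e2 := hU.slope_nonneg hs
  have e3 := h.ironed_le_tangent (q := y) ⟨hy0, hy.trans_le hQ1⟩ (y := x)
    ⟨hx, (hxy.trans hy.le).trans hQ1⟩
  nlinarith [mul_nonneg (e2.trans e1) (sub_nonneg.2 hxy)]

/-- If the bound failed, the curve at `Q = μ.real U` would lie strictly above the revenue of some
price `w ∈ U`. Near `Q` no posted price then reaches the curve, so `Q` is interior to, or the left
end of, an ironed interval with constant slope. Values just inside and just outside `U` would share
their virtual value, which a level set forbids. -/
theorem IsLevelSet.ironed_le_of_lt_one (hU : IsLevelSet μ U) (h : IsValueDist μ)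
    (hne : U.Nonempty) (hQ1 : μ.real U < 1) {q : ℝ} (hq0 : 0 ≤ q) (hq : q < μ.real U) :
    ironedRevenueCurve μ q ≤ sInf U * μ.real U := by
  have := h.isProb
  set Q := μ.real U with hQ
  have hQ0 : 0 < Q := hq0.trans_lt hq
  have hcont : ContinuousAt (ironedRevenueCurve μ) Q :=
    h.continuousOn_ironed_Ioo.continuousAt (Ioo_mem_nhds hQ0 hQ1)
  by_contra hlt
  rw [not_le] at hlt
  have hGQ : ironedRevenueCurve μ q ≤ ironedRevenueCurve μ Q := by
    refine ge_of_tendsto (hcont.tendsto.mono_left (nhdsWithin_le_nhds (s := Iio Q))) ?_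
    filter_upwards [Ioo_mem_nhdsLT hq] with y hy
    exact hU.ironed_mono h hq0 hy.1.le hy.2
  obtain ⟨c, hac, hcG⟩ := exists_between (hlt.trans_le hGQ)
  obtain ⟨w, hw, hwc⟩ := exists_lt_of_csInf_lt hne ((lt_div_iff₀ hQ0).2 hac)
  rw [lt_div_iff₀ hQ0] at hwc
  have hw0 := hU.nonneg_of_mem h hw
  have hev : ∀ᶠ t in 𝓝 Q, c < ironedRevenueCurve μ t ∧ w * t < c ∧ t ∈ Ioo 0 1 := by
    refine (hcont.eventually (lt_mem_nhds hcG)).and (Eventually.and ?_ (Ioo_mem_nhds hQ0 hQ1))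
    exact (Continuous.continuousAt (f := fun t => w * t) (by fun_prop)).eventually
      (gt_mem_nhds hwc)
  obtain ⟨η, hη, hball⟩ := Metric.eventually_nhds_iff_ball.1 hev
  have hin : ∀ t, Q - η < t → t < Q + η →
      c < ironedRevenueCurve μ t ∧ w * t < c ∧ t ∈ Ioo (0 : ℝ) 1 := fun t h1 h2 =>
    hball t (by rw [Real.ball_eq_Ioo]; exact ⟨h1, h2⟩)
  -- Staying right of `quantile μ w` ensures that every price sold with probability above `α` is at
  -- most `w`.
  set α := max (quantile μ w) (Q - η / 2) with hα
  set β := Q + η / 2 with hβ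
  have hqw : quantile μ w ≤ Q := measureReal_mono fun u hu => hU.upper (le_of_lt hu) hw
  have hαQ : α ≤ Q := max_le hqw (by linarith)
  have hαη : Q - η < α := lt_of_lt_of_le (by linarith) (le_max_right _ _)
  obtain ⟨a1, -, a3⟩ := hin α hαη (by linarith)
  obtain ⟨b1, b2, b3⟩ := hin β (by linarith) (by linarith)
  have hchord : ∀ {s t : ℝ}, s ∈ Ico α β → t ∈ Ico α β → ironedSlope μ s = ironedSlope μ t := by
    refine h.ironedSlope_eq_of_min a3.1.le (by linarith) b3.2 fun p hp0 hpin => ?_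
    have hpw : p ≤ w := by
      by_contra hh
      exact absurd ((h.sellProb_le_quantile (not_le.1 hh)).trans (le_max_left _ (Q - η / 2)))
        (not_le.2 hpin.1)
    have : p * sellProb μ p ≤ w * β :=
      mul_le_mul hpw hpin.2.le (sellProb_nonneg p) hw0
    exact le_min (by linarith) (by linarith)
  -- A member of `U` on the ironed interval: `w` itself if `α = Q`, and otherwise the value at a
  -- quantile between `α` and `Q`.
  obtain ⟨v, hv, hvα⟩ : ∃ v ∈ U, ironedSlope μ (quantile μ v) = ironedSlope μ α := by
    rcases hαQ.eq_or_lt with heq | hlt'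
    · refine ⟨w, hw, ?_⟩
      have : quantile μ w = α := by
        rcases max_choice (quantile μ w) (Q - η / 2) with hm | hm
        · exact hm.symm
        · rw [← hα] at hm; linarith
      rw [this]
    · obtain ⟨s, hs1, hs2⟩ := exists_between hlt'
      refine ⟨valueAt μ s, h.valueAt_mem_of_lt hU.upper (a3.1.le.trans hs1.le) hs2, ?_⟩
      have hs01 : s < 1 := hs2.trans hQ1
      have hqs := h.quantile_valueAt_le (a3.1.le.trans hs1.le)
      refine le_antisymm (h.ironedSlope_quantile_valueAt_le a3.1.le hs1 hs01) ?_
      rw [hchord (s := α) (t := s) ⟨le_rfl, by linarith⟩ ⟨hs1.le, by linarith⟩]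
      exact h.antitoneOn_ironedSlope ⟨quantile_nonneg _, hqs.trans_lt hs01⟩
        ⟨a3.1.le.trans hs1.le, hs01⟩ hqs
  -- A quantile slightly beyond `Q` has its value outside `U`, but on the same ironed interval.
  obtain ⟨s, hs1, hs2⟩ := exists_between (show Q < β by linarith)
  have hnot := h.valueAt_notMem_of_gt hU.upper (hs2.trans b3.2).le hs1
  have hQs : Q ≤ quantile μ (valueAt μ s) := measureReal_mono fun u hu => by
    by_contra hle
    exact hnot (hU.upper (not_lt.1 hle) hu)
  have hqs := h.quantile_valueAt_le (hQ0.le.trans hs1.le)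
  refine hnot (hU.congr v _ ?_ hv)
  rw [ironedVirtualValue_of_lt (hU.quantile_lt_one hv),
    ironedVirtualValue_of_lt (hqs.trans_lt (hs2.trans b3.2)), hvα,
    hchord (s := α) ⟨le_rfl, by linarith⟩ ⟨hαQ.trans hQs, hqs.trans_lt hs2⟩]

/-- Continuity at `Q = 1` is not available. Instead, if some `w ∈ U` were below the curve, a line
descending from the curve at `α` to a height `c > w` at quantile `1` would majorize all posted
prices. The curve would then decrease strictly after `α`, against its monotonicity on a level set.
-/
theorem IsLevelSet.ironed_le_of_eq_one (hU : IsLevelSet μ U) (h : IsValueDist μ)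
    (hne : U.Nonempty) (hQ1 : μ.real U = 1) {q : ℝ} (hq0 : 0 ≤ q) (hq : q < 1) :
    ironedRevenueCurve μ q ≤ sInf U := by
  by_contra hlt
  rw [not_le] at hlt
  obtain ⟨w, hw, hwG⟩ := exists_lt_of_csInf_lt hne hlt
  have hqw := hU.quantile_lt_one hw
  obtain ⟨c, hwc, hcG⟩ := exists_between hwG
  set α := max q (quantile μ w) with hα
  have hα1 : α < 1 := max_lt hq hqw
  have hα0 : 0 ≤ α := hq0.trans (le_max_left _ _)
  have hGα : ironedRevenueCurve μ q ≤ ironedRevenueCurve μ α :=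
    hU.ironed_mono h hq0 (le_max_left _ _) (by rwa [hQ1])
  set B := (c - ironedRevenueCurve μ α) / (1 - α) with hB
  have hBe : B * (1 - α) = c - ironedRevenueCurve μ α := by
    rw [hB]; field_simp [show (1 - α) ≠ 0 by linarith]
  have hBneg : B < 0 := div_neg_of_neg_of_pos (by linarith) (by linarith)
  have hw0 := hU.nonneg_of_mem h hw
  have hmaj : ∀ p, 0 ≤ p →
      p * sellProb μ p ≤ (ironedRevenueCurve μ α - B * α) + B * sellProb μ p := by
    intro p hp
    rcases le_or_gt (sellProb μ p) α with hr | hr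
    · have e1 := h.mul_le_ironed (q := sellProb μ p) ⟨sellProb_nonneg p, hr.trans_lt hα1⟩ le_rfl
      have e2 := hU.ironed_mono h (sellProb_nonneg p) hr (by rwa [hQ1])
      nlinarith [mul_nonneg (neg_nonneg.2 hBneg.le) (sub_nonneg.2 hr)]
    · have hpw : p ≤ w := by
        by_contra hh
        exact absurd ((h.sellProb_le_quantile (not_le.1 hh)).trans (le_max_right q _))
          (not_le.2 hr)
      have e1 : p * sellProb μ p ≤ w * 1 :=
        mul_le_mul hpw (h.sellProb_le_one p) (sellProb_nonneg p) hw0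
      nlinarith [mul_nonneg (neg_nonneg.2 hBneg.le) (sub_nonneg.2 (h.sellProb_le_one p))]
  obtain ⟨t, ht1, ht2⟩ := exists_between hα1
  have e1 := h.ironed_le (by nlinarith [h.ironed_nonneg (t := α) ⟨hα0, hα1.le⟩]) hmaj (q := t)
    ⟨hα0.trans ht1.le, ht2.le⟩
  have e2 := hU.ironed_mono h hα0 ht1.le (by rwa [hQ1])
  nlinarith [mul_pos (neg_pos.2 hBneg) (sub_pos.2 ht1)]

theorem IsLevelSet.ironed_le (hU : IsLevelSet μ U) (h : IsValueDist μ)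
    (hne : U.Nonempty) {q : ℝ} (hq0 : 0 ≤ q) (hq : q < μ.real U) :
    ironedRevenueCurve μ q ≤ sInf U * μ.real U := by
  have := h.isProb
  rcases (show μ.real U ≤ 1 from measureReal_le_one).eq_or_lt with h1 | h1
  · rw [h1] at hq
    rw [h1, mul_one]
    exact hU.ironed_le_of_eq_one h hne h1 hq0 hq
  · exact hU.ironed_le_of_lt_one h hne h1 hq0 hq

/-- On a level set, the ironed virtual surplus is at most the revenue of the corresponding
posted price. -/
theorem IsLevelSet.integral_le (hU : IsLevelSet μ U) (h : IsValueDist μ) (hne : U.Nonempty) :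
    ∫ s in (0 : ℝ)..(μ.real U), posVirtual μ (valueAt μ s) ≤ sInf U * μ.real U := by
  have := h.isProb
  set Q := μ.real U with hQ
  have hQ1 : Q ≤ 1 := measureReal_le_one
  rcases (show 0 ≤ Q from measureReal_nonneg).eq_or_lt with h0 | h0
  · simp [← h0]
  -- Shifting quantiles by `ε` provides the strict inequality needed to compare the slope at a
  -- rounded quantile with the slope at `s - ε`, and keeps the integral of the slope below quantile
  -- `1`. The cut-off piece costs at most `ε`.
  have key : ∀ ε ∈ Ioo 0 Q, ∫ s in (0 : ℝ)..Q, posVirtual μ (valueAt μ s) ≤ sInf U * Q + ε := by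
    intro ε hε
    rw [← intervalIntegral.integral_add_adjacent_intervals
      (h.intervalIntegrable_posVirtual 0 ε) (h.intervalIntegrable_posVirtual ε Q)]
    have e1 : ∫ s in (0 : ℝ)..ε, posVirtual μ (valueAt μ s) ≤ ε := by
      have := intervalIntegral.integral_mono_on hε.1.le (h.intervalIntegrable_posVirtual 0 ε)
        (intervalIntegrable_const (c := (1 : ℝ))) fun s _ => h.posVirtual_le_one (valueAt μ s)
      simpa using this
    have hInt : IntervalIntegrable (fun s => ironedSlope μ (s - ε)) volume ε Q := by
      have := (h.intervalIntegrable_ironedSlope le_rfl (sub_nonneg.2 hε.2.le)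
        (by linarith [hε.1] : Q - ε < 1)).comp_sub_right ε
      simpa using this
    have e2 : ∫ s in ε..Q, posVirtual μ (valueAt μ s) ≤ ∫ s in ε..Q, ironedSlope μ (s - ε) := by
      refine intervalIntegral.integral_mono_on_of_le_Ioo hε.2.le
        (h.intervalIntegrable_posVirtual ε Q) hInt fun s hs => ?_
      have hs0 : 0 ≤ s := hε.1.le.trans hs.1.le
      have hmem := h.valueAt_mem_of_lt hU.upper hs0 hs.2
      rw [posVirtual_of_lt (hU.quantile_lt_one hmem), max_eq_left (hU.slope_nonneg hmem)]
      exact h.ironedSlope_quantile_valueAt_le (by linarith [hs.1]) (by linarith [hε.1])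
        (hs.2.trans_le hQ1)
    have e3 : ∫ s in ε..Q, ironedSlope μ (s - ε) = ironedRevenueCurve μ (Q - ε) := by
      rw [intervalIntegral.integral_comp_sub_right (fun s => ironedSlope μ s), sub_self]
      exact h.integral_ironedSlope ⟨by linarith [hε.2], by linarith [hε.1]⟩
    have e4 := hU.ironed_le h hne (q := Q - ε) (by linarith [hε.2]) (by linarith [hε.1])
    linarith
  refine ge_of_tendsto (b := ∫ s in (0 : ℝ)..Q, posVirtual μ (valueAt μ s)) (x := 𝓝[>] (0 : ℝ))
    (f := fun ε => sInf U * Q + ε)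
    (Continuous.tendsto' (by fun_prop) _ _ (by simp) |>.mono_left nhdsWithin_le_nhds) ?_
  filter_upwards [Ioo_mem_nhdsGT h0] with ε hε using key ε hε

theorem Dominates.measureReal_le (hd : Dominates ν μ) (hν : IsValueDist ν) (hμ : IsValueDist μ)
    (hU : IsUpperSet U) : μ.real U ≤ ν.real U := by
  have := hμ.isProb
  by_contra hlt
  obtain ⟨s, hs1, hs2⟩ := exists_between (not_le.1 hlt)
  have hs0 : 0 ≤ s := measureReal_nonneg.trans hs1.le
  exact hν.valueAt_notMem_of_gt hU (hs2.le.trans measureReal_le_one) hs1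
    (hU (hd.valueAt_le hν hμ hs0) (hμ.valueAt_mem_of_lt hU hs0 hs2))

/-- Revenue of the price of a level set from a dominating distribution, compared with the ironed
virtual values of the dominated one under the quantile coupling. -/
theorem IsLevelSet.integral_max_le (hU : IsLevelSet μ U) (hμ : IsValueDist μ)
    (hν : IsValueDist ν) (hd : Dominates ν μ) (hne : U.Nonempty) {T : ℝ}
    (hT : ∀ v ∈ U, (T : EReal) ≤ ironedVirtualValue μ v)
    (hT' : ∀ v ∉ U, posVirtual μ v ≤ T) :
    ∫ s, U.indicator 1 (valueAt ν s) * max T (posVirtual μ (valueAt μ s)) ∂unif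
      ≤ sInf U * ν.real U := by
  have := hμ.isProb
  have := hν.isProb
  rw [hν.integral_indicator_valueAt hU.upper]
  have hle := hd.measureReal_le hν hμ hU.upper
  have hInt : ∀ a b, IntervalIntegrable
      (fun s => max T (posVirtual μ (valueAt μ s))) volume a b := fun a b => by
    rw [intervalIntegrable_iff]
    refine Measure.integrableOn_of_bounded (M := max |T| 1) measure_Ioc_lt_top.ne
      (measurable_const.max (hμ.measurable_posVirtual.comp
        hμ.measurable_valueAt)).aestronglyMeasurable (Eventually.of_forall fun s => ?_)
    rw [Real.norm_eq_abs]
    refine abs_max_le_max_abs_abs.trans (max_le_max_left _ ?_)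
    rw [abs_of_nonneg (posVirtual_nonneg _)]
    exact hμ.posVirtual_le_one _
  -- Up to `μ.real U` the dominated value is in `U` too and the maximum is its virtual value.
  -- Between `μ.real U` and `ν.real U` only the dominating value wins, and the maximum is `T`, at
  -- most the price `sInf U`.
  rw [← intervalIntegral.integral_add_adjacent_intervals (hInt 0 (μ.real U))
    (hInt (μ.real U) (ν.real U))]
  have e1 : ∫ s in (0 : ℝ)..(μ.real U), max T (posVirtual μ (valueAt μ s)) ≤
      ∫ s in (0 : ℝ)..(μ.real U), posVirtual μ (valueAt μ s) := by
    refine intervalIntegral.integral_mono_on_of_le_Ioo measureReal_nonneg (hInt _ _)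
      (hμ.intervalIntegrable_posVirtual _ _) fun s hs => ?_
    refine max_le ?_ le_rfl
    rw [← EReal.coe_le_coe_iff, coe_posVirtual]
    exact (hT _ (hμ.valueAt_mem_of_lt hU.upper hs.1.le hs.2)).trans (le_max_left _ _)
  have e2 : ∫ s in (μ.real U)..(ν.real U), max T (posVirtual μ (valueAt μ s)) ≤
      T * (ν.real U - μ.real U) := by
    have := intervalIntegral.integral_mono_on_of_le_Ioo hle (hInt _ _)
      (intervalIntegrable_const (c := T)) fun s hs =>
        max_le le_rfl (hT' _ (hμ.valueAt_notMem_of_gt hU.upper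
          (hs.2.le.trans measureReal_le_one) hs.1))
    rwa [intervalIntegral.integral_const, smul_eq_mul, mul_comm] at this
  have e3 : T ≤ sInf U := le_csInf hne fun u hu => by
    have := (hT u hu).trans (hμ.ironedVirtualValue_le u)
    exact_mod_cast this
  have e4 := hU.integral_le hμ hne
  nlinarith [mul_le_mul_of_nonneg_right e3 (sub_nonneg.2 hle)]

/-- Myerson's payment for a threshold allocation is the threshold. -/
theorem payment_indicator (hU : IsUpperSet U) (hpos : ∀ u ∈ U, 0 ≤ u) {t : ℝ}
    (ht : 0 ≤ t) :
    t * U.indicator 1 t - ∫ s in (0 : ℝ)..t, U.indicator (1 : ℝ → ℝ) s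
      = sInf U * U.indicator 1 t := by
  by_cases htU : t ∈ U
  · have hbd : BddBelow U := ⟨0, hpos⟩
    have hat : sInf U ≤ t := csInf_le hbd htU
    have ha0 : 0 ≤ sInf U := le_csInf ⟨t, htU⟩ hpos
    have hmeas : Measurable (U.indicator (1 : ℝ → ℝ)) :=
      measurable_one.indicator hU.ordConnected.measurableSet
    have hInt : ∀ a b, IntervalIntegrable (U.indicator (1 : ℝ → ℝ)) volume a b := fun a b => by
      rw [intervalIntegrable_iff]
      refine Measure.integrableOn_of_bounded (M := 1) measure_Ioc_lt_top.ne
        hmeas.aestronglyMeasurable (Eventually.of_forall fun s => ?_)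
      by_cases hs : s ∈ U <;> simp [hs]
    rw [← intervalIntegral.integral_add_adjacent_intervals (hInt 0 (sInf U)) (hInt (sInf U) t)]
    have e1 : ∫ s in (0 : ℝ)..(sInf U), U.indicator (1 : ℝ → ℝ) s = 0 := by
      rw [intervalIntegral.integral_of_le ha0, integral_Ioc_eq_integral_Ioo]
      exact setIntegral_eq_zero_of_forall_eq_zero fun s hs =>
        indicator_of_notMem (fun hsU => absurd (csInf_le hbd hsU) (not_le.2 hs.2)) _
    have e2 : ∫ s in (sInf U)..t, U.indicator (1 : ℝ → ℝ) s = t - sInf U := by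
      rw [intervalIntegral.integral_of_le hat, setIntegral_congr_fun measurableSet_Ioc
        (g := fun _ => (1 : ℝ)) fun s hs => ?_]
      · simp [hat]
      · obtain ⟨u, hu, hus⟩ := exists_lt_of_csInf_lt ⟨t, htU⟩ hs.1
        simp [hU hus.le hu]
    rw [e1, e2, indicator_of_mem htU]
    simp
  · have e1 : ∫ s in (0 : ℝ)..t, U.indicator (1 : ℝ → ℝ) s = 0 := by
      rw [intervalIntegral.integral_of_le ht]
      exact setIntegral_eq_zero_of_forall_eq_zero fun s hs =>
        indicator_of_notMem (fun hsU => htU (hU hs.2 hsU)) _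
    rw [e1, indicator_of_notMem htU]
    simp

end SingleBidder

/-! ### Upper bound for truthful single-bidder mechanisms -/

section Truthful

variable {μ : Measure ℝ}

/-- One half of the envelope formula, by Riemann sums: on each cell incentives bound the lower sum
by the increase of `u`, and the gap between upper and lower sums telescopes. No differentiability of
`u` is needed. -/
theorem integral_le_of_incentive {x u : ℝ → ℝ} {t : ℝ} (ht : 0 ≤ t) (h0 : 0 ≤ u 0)
    (hmono : MonotoneOn x (Icc 0 t))
    (hinc : ∀ a ∈ Icc 0 t, ∀ b ∈ Icc 0 t, (b - a) * x a ≤ u b - u a) :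
    ∫ s in (0 : ℝ)..t, x s ≤ u t := by
  have key : ∀ n : ℕ, ∫ s in (0 : ℝ)..t, x s ≤ u t + t * (x t - x 0) / (n + 1 : ℕ) := by
    intro n
    have hn : (0 : ℝ) < (n + 1 : ℕ) := by positivity
    set a : ℕ → ℝ := fun k => k * (t / (n + 1 : ℕ)) with ha
    have hstep : 0 ≤ t / (n + 1 : ℕ) := by positivity
    have ha0 : a 0 = 0 := by simp [ha]
    have han : a (n + 1) = t := by simp only [ha]; field_simp
    have hsub : ∀ k, a (k + 1) - a k = t / (n + 1 : ℕ) := fun k => by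
      simp only [ha]; push_cast; ring
    have hle : ∀ k, a k ≤ a (k + 1) := fun k => by linarith [hsub k]
    have hmem : ∀ k ≤ n + 1, a k ∈ Icc 0 t := fun k hk => by
      refine ⟨by simp only [ha]; positivity, ?_⟩
      rw [← han]
      exact monotone_nat_of_le_succ hle hk
    have hInt : ∀ k < n + 1, IntervalIntegrable x volume (a k) (a (k + 1)) := fun k hk => by
      refine MonotoneOn.intervalIntegrable (hmono.mono ?_)
      rw [uIcc_of_le (hle k)]
      exact Icc_subset_Icc (hmem k hk.le).1 (hmem (k + 1) hk).2
    have e1 := intervalIntegral.sum_integral_adjacent_intervals hInt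
    rw [ha0, han] at e1
    rw [← e1]
    have e2 : ∀ k ∈ Finset.range (n + 1), ∫ s in (a k)..(a (k + 1)), x s ≤
        (u (a (k + 1)) - u (a k)) + t / (n + 1 : ℕ) * (x (a (k + 1)) - x (a k)) := by
      intro k hk
      rw [Finset.mem_range] at hk
      have h1 := intervalIntegral.integral_mono_on (hle k) (hInt k hk)
        (intervalIntegrable_const (c := x (a (k + 1)))) fun s hs =>
          hmono ⟨(hmem k hk.le).1.trans hs.1, hs.2.trans (hmem (k + 1) hk).2⟩ (hmem (k + 1) hk) hs.2
      rw [intervalIntegral.integral_const, smul_eq_mul, hsub] at h1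
      have h2 := hinc _ (hmem k hk.le) _ (hmem (k + 1) hk)
      rw [hsub] at h2
      linarith
    refine (Finset.sum_le_sum e2).trans ?_
    rw [Finset.sum_add_distrib, ← Finset.mul_sum, Finset.sum_range_sub (fun k => u (a k)),
      Finset.sum_range_sub (fun k => x (a k)), ha0, han, mul_div_right_comm]
    linarith
  have hlim : Tendsto (fun n : ℕ => u t + t * (x t - x 0) / (n + 1 : ℕ)) atTop (𝓝 (u t + 0)) := by
    refine tendsto_const_nhds.add ?_
    exact (tendsto_const_div_atTop_nhds_zero_nat _).comp (tendsto_add_atTop_nat 1)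
  rw [add_zero] at hlim
  exact ge_of_tendsto' hlim key

theorem sum_ite_le_card {n : ℕ} {y : ℝ} (h0 : 0 ≤ y) (hn : y ≤ n) :
    (∑ k ∈ Finset.Icc 1 n, if (k : ℝ) ≤ y then (1 : ℝ) else 0) = ⌊y⌋₊ := by
  rw [Finset.sum_ite, Finset.sum_const_zero, add_zero, Finset.sum_const, nsmul_eq_mul, mul_one]
  have : Finset.filter (fun k : ℕ => (k : ℝ) ≤ y) (Finset.Icc 1 n) = Finset.Icc 1 ⌊y⌋₊ := by
    ext k
    simp only [Finset.mem_filter, Finset.mem_Icc, Nat.le_floor_iff h0]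
    constructor
    · rintro ⟨⟨a, b⟩, c⟩; exact ⟨a, c⟩
    · rintro ⟨a, c⟩; exact ⟨⟨a, by exact_mod_cast c.trans hn⟩, c⟩
  rw [this, Nat.card_Icc, Nat.add_sub_cancel]

theorem IsValueDist.mul_le_integral_indicator (h : IsValueDist μ) {U : Set ℝ} (hU : IsUpperSet U)
    {a : ℝ} (ha : ∀ u ∈ U, a ≤ u) :
    a * μ.real U ≤ ∫ v, U.indicator 1 v * posVirtual μ v ∂μ := by
  have hm : Measurable fun v => U.indicator (1 : ℝ → ℝ) v * posVirtual μ v :=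
    (measurable_one.indicator hU.ordConnected.measurableSet).mul h.measurable_posVirtual
  rw [h.integral_eq hm, h.integral_indicator_valueAt hU fun s => posVirtual μ (valueAt μ s)]
  exact h.mul_le_integral_posVirtual ha

theorem integrable_of_ae_mem_unit {α : Type*} [MeasurableSpace α] {P : Measure α}
    [IsFiniteMeasure P] {F : α → ℝ} (hF : AEStronglyMeasurable F P)
    (hb : ∀ᵐ a ∂P, F a ∈ Icc (0 : ℝ) 1) : Integrable F P := by
  refine Integrable.of_bound hF 1 ?_
  filter_upwards [hb] with a ha
  rw [Real.norm_of_nonneg ha.1]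
  exact ha.2

/-- The expected payment in a truthful single-bidder mechanism is at most the expected positive
ironed virtual surplus. -/
theorem IsValueDist.integral_pay_le (h : IsValueDist μ) {x p : ℝ → ℝ} (hxm : Measurable x)
    (hpm : Measurable p) (hx : ∀ t ∈ Icc (0 : ℝ) 1, x t ∈ Icc (0 : ℝ) 1)
    (hp : ∀ t ∈ Icc (0 : ℝ) 1, 0 ≤ p t) (hu : ∀ t ∈ Icc (0 : ℝ) 1, 0 ≤ t * x t - p t)
    (hinc : ∀ t ∈ Icc (0 : ℝ) 1, ∀ b ∈ Icc (0 : ℝ) 1, t * x b - p b ≤ t * x t - p t) :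
    ∫ v, p v ∂μ ≤ ∫ v, x v * posVirtual μ v ∂μ := by
  have := h.isProb
  have hmono : MonotoneOn x (Icc 0 1) := by
    intro a ha b hb hab
    rcases hab.eq_or_lt with rfl | hlt
    · exact le_rfl
    · have e1 := hinc a ha b hb
      have e2 := hinc b hb a ha
      have : x a * (b - a) ≤ x b * (b - a) := by linarith
      exact le_of_mul_le_mul_right this (by linarith)
  have henv : ∀ t ∈ Icc (0 : ℝ) 1, p t ≤ t * x t - ∫ s in (0 : ℝ)..t, x s := by
    intro t ht
    have hsub : Icc 0 t ⊆ Icc (0 : ℝ) 1 := Icc_subset_Icc_right ht.2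
    have := integral_le_of_incentive (x := x) (u := fun s => s * x s - p s) ht.1
      (hu 0 (by simp)) (hmono.mono hsub) fun a ha b hb => by
        have := hinc b (hsub hb) a (hsub ha)
        linarith
    linarith
  -- Clamping the bid makes the allocation monotone on the whole line, so that its superlevel sets
  -- among nonnegative bids are upper sets.
  set xc : ℝ → ℝ := fun t => x (max 0 (min t 1)) with hxc
  have hclamp : ∀ t : ℝ, max 0 (min t 1) ∈ Icc (0 : ℝ) 1 := fun t =>
    ⟨le_max_left _ _, max_le zero_le_one (min_le_right _ _)⟩
  have hxcm : Monotone xc := fun a b hab => hmono (hclamp a) (hclamp b)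
    (max_le_max_left _ (min_le_min_right _ hab))
  have hxceq : ∀ t ∈ Icc (0 : ℝ) 1, xc t = x t := fun t ht => by
    simp only [hxc]
    rw [min_eq_left ht.2, max_eq_right ht.1]
  have hpint : Integrable p μ := by
    refine integrable_of_ae_mem_unit hpm.aestronglyMeasurable ?_
    filter_upwards [h.mem_unit] with t ht
    refine ⟨hp t ht, ?_⟩
    nlinarith [hu t ht, (hx t ht).2, (hx t ht).1, ht.1, ht.2]
  have hxgint : Integrable (fun v => x v * posVirtual μ v) μ := by
    refine integrable_of_ae_mem_unit
      (hxm.mul h.measurable_posVirtual).aestronglyMeasurable ?_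
    filter_upwards [h.mem_unit] with t ht
    exact ⟨mul_nonneg (hx t ht).1 (posVirtual_nonneg t),
      mul_le_one₀ (hx t ht).2 (posVirtual_nonneg t) (h.posVirtual_le_one t)⟩
  have key : ∀ n : ℕ, ∫ v, p v ∂μ ≤ ∫ v, x v * posVirtual μ v ∂μ + 1 / ((n : ℝ) + 1) := by
    intro m
    obtain ⟨n, hn⟩ : ∃ n : ℕ, n = m + 1 := ⟨_, rfl⟩
    have hn0 : (0 : ℝ) < n := by rw [hn]; positivity
    have hnm : (m : ℝ) + 1 = n := by rw [hn]; push_cast; ring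
    rw [hnm]
    -- Layer-cake decomposition: `n * x` is, up to an error of `1`, a sum of `n` threshold
    -- allocations, each a posted price to which `mul_le_integral_indicator` applies. Division by
    -- `n` makes the error vanish in the limit.
    set U : ℕ → Set ℝ := fun k => {t | 0 ≤ t ∧ (k : ℝ) ≤ n * xc t} with hUdef
    have hU : ∀ k, IsUpperSet (U k) := fun k a b hab ha =>
      ⟨ha.1.trans hab, ha.2.trans (mul_le_mul_of_nonneg_left (hxcm hab) hn0.le)⟩
    have hU0 : ∀ k, ∀ u ∈ U k, 0 ≤ u := fun k u hu => hu.1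
    have hUm : ∀ k, Measurable ((U k).indicator (1 : ℝ → ℝ)) := fun k =>
      measurable_one.indicator (hU k).ordConnected.measurableSet
    have hsum : ∀ t ∈ Icc (0 : ℝ) 1,
        ∑ k ∈ Finset.Icc 1 n, (U k).indicator (1 : ℝ → ℝ) t = ⌊n * x t⌋₊ := by
      intro t ht
      have hxt := hx t ht
      rw [← sum_ite_le_card (n := n) (mul_nonneg hn0.le hxt.1)
        (by nlinarith [hxt.2])]
      refine Finset.sum_congr rfl fun k _ => ?_
      simp only [indicator, hUdef, mem_ofPred_eq, hxceq t ht, ht.1, true_and, Pi.one_apply]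
    have hlow : ∀ t ∈ Icc (0 : ℝ) 1,
        ∑ k ∈ Finset.Icc 1 n, (U k).indicator (1 : ℝ → ℝ) t ≤ n * x t := fun t ht => by
      rw [hsum t ht]; exact Nat.floor_le (mul_nonneg hn0.le (hx t ht).1)
    have hup : ∀ t ∈ Icc (0 : ℝ) 1,
        n * x t ≤ ∑ k ∈ Finset.Icc 1 n, (U k).indicator (1 : ℝ → ℝ) t + 1 := fun t ht => by
      rw [hsum t ht]; exact (Nat.lt_floor_add_one _).le
    have hUint : ∀ k a b, IntervalIntegrable ((U k).indicator (1 : ℝ → ℝ)) volume a b :=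
      fun k a b => by
        rw [intervalIntegrable_iff]
        refine Measure.integrableOn_of_bounded (M := 1) measure_Ioc_lt_top.ne
          (hUm k).aestronglyMeasurable (Eventually.of_forall fun s => ?_)
        by_cases hs : s ∈ U k <;> simp [hs]
    have hpt : ∀ t ∈ Icc (0 : ℝ) 1, n * p t ≤
        ∑ k ∈ Finset.Icc 1 n, sInf (U k) * (U k).indicator 1 t + 1 := by
      intro t ht
      have e1 : ∫ s in (0 : ℝ)..t, ∑ k ∈ Finset.Icc 1 n, (U k).indicator (1 : ℝ → ℝ) s ≤
          ∫ s in (0 : ℝ)..t, n * x s := by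
        refine intervalIntegral.integral_mono_on ht.1
          (by simpa only [Finset.sum_fn] using IntervalIntegrable.sum _ fun k _ => hUint k 0 t) ?_
          fun s hs =>
            hlow s ⟨hs.1, hs.2.trans ht.2⟩
        refine (MonotoneOn.intervalIntegrable (hmono.mono ?_)).const_mul _
        rw [uIcc_of_le ht.1]
        exact Icc_subset_Icc_right ht.2
      rw [intervalIntegral.integral_finsetSum fun k _ => hUint k 0 t,
        intervalIntegral.integral_const_mul] at e1
      have e2 : ∑ k ∈ Finset.Icc 1 n, sInf (U k) * (U k).indicator 1 t =
          t * ∑ k ∈ Finset.Icc 1 n, (U k).indicator (1 : ℝ → ℝ) t -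
          ∑ k ∈ Finset.Icc 1 n, ∫ s in (0 : ℝ)..t, (U k).indicator (1 : ℝ → ℝ) s := by
        rw [Finset.mul_sum, ← Finset.sum_sub_distrib]
        exact Finset.sum_congr rfl fun k _ => (payment_indicator (hU k) (hU0 k) ht.1).symm
      rw [e2]
      have e3 := mul_le_mul_of_nonneg_left (henv t ht) hn0.le
      have e4 := mul_le_mul_of_nonneg_left (hup t ht) ht.1
      nlinarith [ht.2]
    have hIint : ∀ k, Integrable ((U k).indicator (1 : ℝ → ℝ)) μ := fun k =>
      (integrable_const (1 : ℝ)).indicator (hU k).ordConnected.measurableSet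
    have hIg : ∀ k, Integrable (fun v => (U k).indicator (1 : ℝ → ℝ) v * posVirtual μ v) μ := by
      intro k
      refine integrable_of_ae_mem_unit
        ((hUm k).mul h.measurable_posVirtual).aestronglyMeasurable
        (Eventually.of_forall fun v => ?_)
      by_cases hv : v ∈ U k
      · simp [hv, posVirtual_nonneg, h.posVirtual_le_one]
      · simp [hv]
    have e1 : ∫ v, n * p v ∂μ ≤
        ∫ v, (∑ k ∈ Finset.Icc 1 n, sInf (U k) * (U k).indicator 1 v + 1) ∂μ := by
      refine integral_mono_ae (hpint.const_mul _)
        ((integrable_finsetSum _ fun k _ => (hIint k).const_mul _).add (integrable_const _)) ?_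
      filter_upwards [h.mem_unit] with t ht using hpt t ht
    rw [integral_const_mul, integral_add (integrable_finsetSum _ fun k _ => (hIint k).const_mul _)
      (integrable_const _), integral_finsetSum _ fun k _ => (hIint k).const_mul _] at e1
    have e2 : ∀ k ∈ Finset.Icc 1 n, ∫ v, sInf (U k) * (U k).indicator 1 v ∂μ ≤
        ∫ v, (U k).indicator 1 v * posVirtual μ v ∂μ := by
      intro k _
      rw [integral_const_mul, integral_indicator_one (hU k).ordConnected.measurableSet]
      exact h.mul_le_integral_indicator (hU k) fun u hu => csInf_le ⟨0, hU0 k⟩ hu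
    have e3 : ∑ k ∈ Finset.Icc 1 n, ∫ v, (U k).indicator 1 v * posVirtual μ v ∂μ ≤
        ∫ v, n * (x v * posVirtual μ v) ∂μ := by
      rw [← integral_finsetSum _ fun k _ => hIg k]
      refine integral_mono_ae (integrable_finsetSum _ fun k _ => hIg k) (hxgint.const_mul _) ?_
      filter_upwards [h.mem_unit] with t ht
      rw [← Finset.sum_mul, ← mul_assoc]
      exact mul_le_mul_of_nonneg_right (hlow t ht) (posVirtual_nonneg t)
    rw [integral_const_mul] at e3
    have e4 := Finset.sum_le_sum e2
    simp only [integral_const, probReal_univ, smul_eq_mul, mul_one] at e1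
    have e5 : n * ∫ v, p v ∂μ ≤ n * (∫ v, x v * posVirtual μ v ∂μ + 1 / n) := by
      rw [mul_add, mul_one_div_cancel hn0.ne']
      linarith
    exact le_of_mul_le_mul_left e5 hn0
  have hlim : Tendsto (fun n : ℕ => ∫ v, x v * posVirtual μ v ∂μ + 1 / ((n : ℝ) + 1)) atTop
      (𝓝 (∫ v, x v * posVirtual μ v ∂μ + 0)) :=
    tendsto_const_nhds.add tendsto_one_div_add_atTop_nhds_zero_nat
  rw [add_zero] at hlim
  exact ge_of_tendsto' hlim key

end Truthful

/-! ### Resampling one coordinate of a product measure -/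

section Resample

variable {ι : Type*}

theorem measurable_update_prod [DecidableEq ι] (i : ι) :
    Measurable fun z : (ι → ℝ) × ℝ => Function.update z.1 i z.2 := by
  refine measurable_pi_lambda _ fun j => ?_
  by_cases hj : j = i
  · subst hj; simpa using measurable_snd
  · simp only [Function.update_of_ne hj]
    exact (measurable_pi_apply j).comp measurable_fst

variable [Fintype ι] (P : ι → Measure ℝ) [∀ i, IsProbabilityMeasure (P i)]

theorem map_update_pi [DecidableEq ι] (i : ι) :
    ((Measure.pi P).prod (P i)).map (fun z => Function.update z.1 i z.2) = Measure.pi P := by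
  refine (Measure.pi_eq fun s hs => ?_).symm
  rw [Measure.map_apply (measurable_update_prod i) (MeasurableSet.univ_pi hs)]
  have hpre : (fun z : (ι → ℝ) × ℝ => Function.update z.1 i z.2) ⁻¹' Set.pi univ s =
      (Set.pi univ (Function.update s i univ)) ×ˢ s i := by
    ext ⟨z, t⟩
    simp only [mem_preimage, Set.mem_pi, mem_univ, forall_true_left, mem_prod]
    constructor
    · intro hz
      refine ⟨fun j => ?_, by simpa using hz i⟩
      by_cases hj : j = i
      · subst hj; simp
      · simpa [hj] using hz j
    · rintro ⟨h1, h2⟩ j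
      by_cases hj : j = i
      · subst hj; simpa using h2
      · simpa [hj] using h1 j
  rw [hpre, Measure.prod_prod, Measure.pi_pi, ← Finset.mul_prod_erase _ _ (Finset.mem_univ i),
    ← Finset.mul_prod_erase (s := Finset.univ) (f := fun j => P j (s j)) (h := Finset.mem_univ i)]
  simp only [Function.update_self, measure_univ, one_mul]
  rw [mul_comm]
  congr 1
  refine Finset.prod_congr rfl fun j hj => ?_
  rw [Function.update_of_ne (Finset.ne_of_mem_erase hj)]

/-- Redrawing coordinate `i` independently preserves the product measure, so an inequality may be
averaged over that coordinate with the others fixed. -/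
theorem integral_pi_le_of_resample [DecidableEq ι] (i : ι) {F H : (ι → ℝ) → ℝ}
    (hF : Integrable F (Measure.pi P))
    (hH : Integrable H (Measure.pi P))
    (hle : ∀ᵐ s ∂(Measure.pi P), ∫ t, F (Function.update s i t) ∂(P i) ≤
      ∫ t, H (Function.update s i t) ∂(P i)) :
    ∫ s, F s ∂(Measure.pi P) ≤ ∫ s, H s ∂(Measure.pi P) := by
  have hm := (measurable_update_prod (ι := ι) i).aemeasurable (μ := (Measure.pi P).prod (P i))
  have hF' := hF
  have hH' := hH
  rw [← map_update_pi P i] at hF' hH'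
  have hFi : Integrable (fun z : (ι → ℝ) × ℝ => F (Function.update z.1 i z.2))
      ((Measure.pi P).prod (P i)) := hF'.comp_aemeasurable hm
  have hHi : Integrable (fun z : (ι → ℝ) × ℝ => H (Function.update z.1 i z.2))
      ((Measure.pi P).prod (P i)) := hH'.comp_aemeasurable hm
  conv_lhs => rw [← map_update_pi P i]
  conv_rhs => rw [← map_update_pi P i]
  rw [integral_map hm hF'.aestronglyMeasurable, integral_map hm hH'.aestronglyMeasurable,
    integral_prod _ hFi, integral_prod _ hHi]
  exact integral_mono_ae hFi.integral_prod_left hHi.integral_prod_left hle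

theorem ae_pi_of_ae {p : ι → ℝ → Prop} (hp : ∀ i, ∀ᵐ t ∂(P i), p i t) :
    ∀ᵐ s ∂(Measure.pi P), ∀ i, p i (s i) :=
  ae_all_iff.2 fun i => (measurePreserving_eval P i).quasiMeasurePreserving.ae (hp i)

end Resample

/-! ### Maximum weights of set systems -/

section MaxWeight

variable {ι : Type*}

/-- The maximum weight of a member of a set system. -/
def maxWeight (J : Set (Finset ι)) (w : ι → ℝ) : ℝ := ⨆ S : J, ∑ i ∈ (S : Finset ι), w i

variable [Fintype ι]

theorem sum_le_maxWeight {J : Set (Finset ι)} (w : ι → ℝ) {S : Finset ι} (hS : S ∈ J) :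
    ∑ i ∈ S, w i ≤ maxWeight J w := by
  classical
  exact le_ciSup (f := fun S : J => ∑ i ∈ (S : Finset ι), w i)
    (Set.finite_range _).bddAbove ⟨S, hS⟩

theorem exists_sum_eq_maxWeight {J : Set (Finset ι)} (hJ : J.Nonempty) (w : ι → ℝ) :
    ∃ S ∈ J, ∑ i ∈ S, w i = maxWeight J w := by
  classical
  have : Nonempty J := hJ.to_subtype
  obtain ⟨S, hS⟩ := exists_eq_ciSup_of_finite (f := fun S : J => ∑ i ∈ (S : Finset ι), w i)
  exact ⟨S, S.2, hS⟩

theorem maxWeight_le {J : Set (Finset ι)} (hJ : J.Nonempty) {w : ι → ℝ} {b : ℝ}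
    (h : ∀ S ∈ J, ∑ i ∈ S, w i ≤ b) : maxWeight J w ≤ b := by
  obtain ⟨S, hS, he⟩ := exists_sum_eq_maxWeight hJ w
  exact he ▸ h S hS

theorem measurable_maxWeight {α : Type*} [MeasurableSpace α] (J : Set (Finset ι))
    {w : α → ι → ℝ} (hw : ∀ i, Measurable fun a => w a i) :
    Measurable fun a => maxWeight J (w a) := by
  classical
  exact Measurable.iSup fun S : J => Finset.measurable_fun_sum _ fun i _ => hw i

theorem maxWeight_nonneg {I : Set (Finset ι)} (h0 : ∅ ∈ I) (w : ι → ℝ) : 0 ≤ maxWeight I w := by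
  simpa using sum_le_maxWeight w h0

variable [DecidableEq ι]

/-- The least weight with which `i` belongs to a maximum weight member of `I`, the weights of the
other elements being given by `w`. -/
def threshold (I : Set (Finset ι)) (w : ι → ℝ) (i : ι) : ℝ :=
  maxWeight {S | S ∈ I ∧ i ∉ S} w - maxWeight {S | S ∈ I ∧ i ∈ S} (Function.update w i 0)

omit [Fintype ι] in
-- Neither maximum sees the weight of `i`: it is absent from the first and overwritten in the
-- second. Hence a bidder cannot influence its own threshold.
theorem threshold_update (I : Set (Finset ι)) (w : ι → ℝ) (i : ι) (c : ℝ) :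
    threshold I (Function.update w i c) i = threshold I w i := by
  unfold threshold
  rw [Function.update_idem]
  congr 1
  unfold maxWeight
  congr 1
  funext S
  refine Finset.sum_congr rfl fun j hj => ?_
  rw [Function.update_of_ne]
  rintro rfl
  exact S.2.2 hj

theorem measurable_threshold {α : Type*} [MeasurableSpace α] (I : Set (Finset ι))
    {w : α → ι → ℝ} (hw : ∀ i, Measurable fun a => w a i) (i : ι) :
    Measurable fun a => threshold I (w a) i := by
  refine (measurable_maxWeight _ hw).sub (measurable_maxWeight _ fun j => ?_)
  by_cases hj : j = i
  · subst hj; simp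
  · simpa [hj] using hw j

omit [Fintype ι] in
theorem sum_update_zero (w : ι → ℝ) {S : Finset ι} {i : ι} (hi : i ∈ S) :
    ∑ j ∈ S, Function.update w i 0 j = ∑ j ∈ S, w j - w i := by
  rw [← Finset.add_sum_erase _ _ hi, ← Finset.add_sum_erase (a := i) _ w hi]
  have : ∑ j ∈ S.erase i, Function.update w i 0 j = ∑ j ∈ S.erase i, w j :=
    Finset.sum_congr rfl fun j hj => Function.update_of_ne (Finset.ne_of_mem_erase hj) _ _
  rw [this]; simp

theorem threshold_nonneg {I : Set (Finset ι)} (hI : IsDownwardClosed I) (w : ι → ℝ) {i : ι}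
    (hi : {i} ∈ I) : 0 ≤ threshold I w i := by
  refine sub_nonneg.2 (maxWeight_le (J := {S | S ∈ I ∧ i ∈ S}) ⟨{i}, hi, by simp⟩ fun S hS => ?_)
  rw [sum_update_zero w hS.2, ← Finset.add_sum_erase _ _ hS.2, add_sub_cancel_left]
  exact sum_le_maxWeight (J := {S | S ∈ I ∧ i ∉ S}) w
    ⟨hI.subset_mem S hS.1 _ (Finset.erase_subset i S), by simp⟩

theorem threshold_le_card {I : Set (Finset ι)} (h0 : ∅ ∈ I) {w : ι → ℝ}
    (hw : ∀ j, w j ≤ 1) {i : ι} (hi : {i} ∈ I) : threshold I w i ≤ Fintype.card ι := by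
  have h1 : maxWeight {S | S ∈ I ∧ i ∉ S} w ≤ Fintype.card ι := by
    refine maxWeight_le (J := {S | S ∈ I ∧ i ∉ S}) ⟨∅, h0, by simp⟩ fun S _ => ?_
    refine (Finset.sum_le_sum fun j _ => hw j).trans ?_
    rw [Finset.sum_const, nsmul_eq_mul, mul_one]
    exact_mod_cast Finset.card_le_univ S
  have h2 : 0 ≤ maxWeight {S | S ∈ I ∧ i ∈ S} (Function.update w i 0) := by
    have := sum_le_maxWeight (J := {S | S ∈ I ∧ i ∈ S}) (Function.update w i 0)
      (S := {i}) ⟨hi, by simp⟩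
    simpa using this
  unfold threshold
  linarith

/-! Feasible allocations. -/

/-- The indicator vector of a set of bidders. -/
def indVec (S : Finset ι) : ι → ℝ := fun i => if i ∈ S then 1 else 0

theorem sum_indVec_mul (S : Finset ι) (c : ι → ℝ) : ∑ i, indVec S i * c i = ∑ i ∈ S, c i := by
  simp [indVec]

omit [Fintype ι] in
theorem indVec_mem {I : Set (Finset ι)} {S : Finset ι} (hS : S ∈ I) :
    indVec S ∈ feasibleAllocations I := subset_convexHull _ _ ⟨S, hS, rfl⟩

theorem feasible_sum_le {I : Set (Finset ι)} {c : ι → ℝ} {b : ℝ}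
    (h : ∀ S ∈ I, ∑ i ∈ S, c i ≤ b) {x : ι → ℝ} (hx : x ∈ feasibleAllocations I) :
    ∑ i, x i * c i ≤ b := by
  have hconv : Convex ℝ {x : ι → ℝ | ∑ i, x i * c i ≤ b} := by
    refine convex_halfSpace_le (f := fun x : ι → ℝ => ∑ i, x i * c i)
      ⟨fun x y => ?_, fun a x => ?_⟩ b
    · simp [add_mul, Finset.sum_add_distrib]
    · simp [mul_assoc, Finset.mul_sum]
  refine convexHull_min ?_ hconv hx
  rintro _ ⟨S, hS, rfl⟩
  exact (sum_indVec_mul S c).le.trans (h S hS)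

theorem feasible_mem_unit {I : Set (Finset ι)} {x : ι → ℝ} (hx : x ∈ feasibleAllocations I)
    (i : ι) : x i ∈ Icc (0 : ℝ) 1 := by
  constructor
  · have := feasible_sum_le (I := I) (c := fun j => if j = i then -1 else 0) (b := 0)
      (fun S _ => Finset.sum_nonpos fun j _ => by split_ifs <;> norm_num) hx
    simpa using this
  · have := feasible_sum_le (I := I) (c := fun j => if j = i then 1 else 0) (b := 1)
      (fun S _ => by rw [Finset.sum_ite_eq']; split_ifs <;> norm_num) hx
    simpa using this

theorem feasible_eq_zero {I : Set (Finset ι)} (hI : IsDownwardClosed I) {x : ι → ℝ}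
    (hx : x ∈ feasibleAllocations I) {i : ι} (hi : {i} ∉ I) : x i = 0 := by
  refine le_antisymm ?_ (feasible_mem_unit hx i).1
  have := feasible_sum_le (I := I) (c := fun j => if j = i then 1 else 0) (b := 0)
    (fun S hS => by
      rw [Finset.sum_ite_eq', if_neg]
      exact fun hiS => hi (hI.subset_mem S hS _ (by simpa using hiS))) hx
  simpa using this

theorem exists_weights_of_feasible {I : Set (Finset ι)} {x : ι → ℝ}
    (hx : x ∈ feasibleAllocations I) :
    ∃ l : Finset ι → ℝ, (∀ S, 0 ≤ l S) ∧ (∀ S ∉ I, l S = 0) ∧ ∑ S, l S = 1 ∧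
      ∀ i, x i = ∑ S, l S * indVec S i := by
  have hconv : Convex ℝ {x : ι → ℝ | ∃ l : Finset ι → ℝ, (∀ S, 0 ≤ l S) ∧ (∀ S ∉ I, l S = 0) ∧
      ∑ S, l S = 1 ∧ ∀ i, x i = ∑ S, l S * indVec S i} := by
    rintro x ⟨l, l0, lI, l1, hl⟩ y ⟨m, m0, mI, m1, hm⟩ a b ha hb hab
    refine ⟨fun S => a * l S + b * m S, fun S => ?_, fun S hS => ?_, ?_, fun i => ?_⟩
    · exact add_nonneg (mul_nonneg ha (l0 S)) (mul_nonneg hb (m0 S))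
    · simp [lI S hS, mI S hS]
    · rw [Finset.sum_add_distrib, ← Finset.mul_sum, ← Finset.mul_sum, l1, m1]; linarith
    · simp only [Pi.add_apply, Pi.smul_apply, smul_eq_mul, hl i, hm i, add_mul,
        Finset.sum_add_distrib, Finset.mul_sum, mul_assoc]
  refine convexHull_min ?_ hconv hx
  rintro _ ⟨S, hS, rfl⟩
  refine ⟨fun S' => if S' = S then 1 else 0, fun S' => ?_, fun S' hS' => ?_, by simp, fun i => ?_⟩
  · simp only; split_ifs <;> norm_num
  · exact if_neg fun h : S' = S => hS' (h ▸ hS)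
  · simp only [ite_mul, one_mul, zero_mul, Finset.sum_ite_eq', Finset.mem_univ, if_true]
    rfl

/-- An optimal feasible allocation is a mixture of maximum weight members, so it inherits linear
inequalities from them. -/
theorem le_sum_of_optimal {I : Set (Finset ι)} {w c x : ι → ℝ} {b : ℝ}
    (hx : x ∈ feasibleAllocations I) (hopt : maxWeight I w ≤ ∑ i, x i * w i)
    (h : ∀ S ∈ I, ∑ i ∈ S, w i = maxWeight I w → b ≤ ∑ i ∈ S, c i) :
    b ≤ ∑ i, x i * c i := by
  obtain ⟨l, l0, lI, l1, hl⟩ := exists_weights_of_feasible hx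
  have hexp : ∀ c : ι → ℝ, ∑ i, x i * c i = ∑ S, l S * ∑ i ∈ S, c i := fun c => by
    simp_rw [hl, Finset.sum_mul]
    rw [Finset.sum_comm]
    refine Finset.sum_congr rfl fun S _ => ?_
    rw [← sum_indVec_mul S, Finset.mul_sum]
    exact Finset.sum_congr rfl fun i _ => mul_assoc _ _ _
  have hterm : ∀ S, 0 ≤ l S * (maxWeight I w - ∑ i ∈ S, w i) := fun S => by
    by_cases hS : S ∈ I
    · exact mul_nonneg (l0 S) (sub_nonneg.2 (sum_le_maxWeight w hS))
    · simp [lI S hS]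
  have hsum : ∑ S, l S * (maxWeight I w - ∑ i ∈ S, w i) = 0 := by
    refine le_antisymm ?_ (Finset.sum_nonneg fun S _ => hterm S)
    simp_rw [mul_sub]
    rw [Finset.sum_sub_distrib, ← hexp, ← Finset.sum_mul, l1]
    linarith
  have hzero := (Finset.sum_eq_zero_iff_of_nonneg fun S _ => hterm S).1 hsum
  rw [hexp]
  have : b = ∑ S, l S * b := by rw [← Finset.sum_mul, l1, one_mul]
  rw [this]
  refine Finset.sum_le_sum fun S _ => ?_
  rcases (l0 S).eq_or_lt with h0 | h0
  · simp [← h0]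
  · have hS : S ∈ I := by
      by_contra hS
      exact h0.ne' (lI S hS)
    have := hzero S (Finset.mem_univ S)
    rw [mul_eq_zero, or_iff_right h0.ne', sub_eq_zero] at this
    exact mul_le_mul_of_nonneg_left (h S hS this.symm) h0.le

/-- With its weight replaced by the threshold, `i` gives no advantage: sets containing it weigh at
most as much as the best set avoiding it. The correction term restores the actual weight. -/
theorem sum_mul_le_threshold {I : Set (Finset ι)} {w x : ι → ℝ} {i : ι}
    (hx : x ∈ feasibleAllocations I) :
    ∑ j, x j * w j ≤ maxWeight {S | S ∈ I ∧ i ∉ S} w + x i * (w i - threshold I w i) := by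
  have := feasible_sum_le (I := I)
    (c := fun j => w j - if j = i then w i - threshold I w i else 0)
    (b := maxWeight {S | S ∈ I ∧ i ∉ S} w) (fun S hS => by
      rw [Finset.sum_sub_distrib, Finset.sum_ite_eq']
      split_ifs with hi
      · have := sum_le_maxWeight (J := {S | S ∈ I ∧ i ∈ S}) (Function.update w i 0) ⟨hS, hi⟩
        rw [sum_update_zero w hi] at this
        unfold threshold
        linarith
      · rw [sub_zero]
        exact sum_le_maxWeight (J := {S | S ∈ I ∧ i ∉ S}) w ⟨hS, hi⟩) hx
  simp only [mul_sub, mul_ite, mul_zero, Finset.sum_sub_distrib, Finset.sum_ite_eq',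
    Finset.mem_univ, if_true] at this
  linarith

theorem eq_one_of_threshold_lt {I : Set (Finset ι)} {w x : ι → ℝ} {i : ι} (hi : {i} ∈ I)
    (hx : x ∈ feasibleAllocations I) (hopt : maxWeight I w ≤ ∑ j, x j * w j)
    (hlt : threshold I w i < w i) : x i = 1 := by
  refine le_antisymm (feasible_mem_unit hx i).2 ?_
  obtain ⟨S, hS, hSe⟩ := exists_sum_eq_maxWeight (J := {S | S ∈ I ∧ i ∈ S}) ⟨{i}, hi, by simp⟩
    (Function.update w i 0)
  have h1 := sum_le_maxWeight w hS.1
  rw [sum_update_zero w hS.2] at hSe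
  have h2 := sum_mul_le_threshold (w := w) (i := i) hx
  have h3 : maxWeight {S | S ∈ I ∧ i ∉ S} w = threshold I w i + (∑ j ∈ S, w j - w i) := by
    rw [hSe, threshold]; ring
  have : 1 * (w i - threshold I w i) ≤ x i * (w i - threshold I w i) := by linarith
  exact le_of_mul_le_mul_right this (by linarith)

theorem eq_zero_of_lt_threshold {I : Set (Finset ι)} (h0 : ∅ ∈ I) {w x : ι → ℝ} {i : ι}
    (hx : x ∈ feasibleAllocations I) (hopt : maxWeight I w ≤ ∑ j, x j * w j)
    (hlt : w i < threshold I w i) : x i = 0 := by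
  refine le_antisymm ?_ (feasible_mem_unit hx i).1
  have h1 : maxWeight {S | S ∈ I ∧ i ∉ S} w ≤ maxWeight I w :=
    maxWeight_le (J := {S | S ∈ I ∧ i ∉ S}) ⟨∅, h0, by simp⟩ fun S hS => sum_le_maxWeight w hS.1
  have h2 := sum_mul_le_threshold (w := w) (i := i) hx
  by_contra hpos
  nlinarith [mul_pos (not_le.1 hpos) (sub_pos.2 hlt)]

/-! Matroids. -/

omit [Fintype ι] in
theorem IsMatroid.exists_augment {I : Set (Finset ι)} (hI : IsMatroid I) {A B : Finset ι}
    (hB : B ∈ I) (hA : A ∈ I) (hAB : A.card ≤ B.card) :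
    ∃ C ∈ I, A ⊆ C ∧ C ⊆ A ∪ B ∧ C.card = B.card := by
  obtain ⟨n, hn⟩ : ∃ n, B.card = A.card + n := Nat.exists_eq_add_of_le hAB
  induction n generalizing A with
  | zero => exact ⟨A, hA, subset_rfl, Finset.subset_union_left, by omega⟩
  | succ n ih =>
    obtain ⟨i, hi, hiI⟩ := hI.exchange B hB A hA (by omega)
    rw [Finset.mem_sdiff] at hi
    have hc : (insert i A).card = A.card + 1 := Finset.card_insert_of_notMem hi.2
    obtain ⟨C, hC, h1, h2, h3⟩ := ih hiI (by omega) (by omega)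
    refine ⟨C, hC, (Finset.subset_insert i A).trans h1, h2.trans ?_, h3⟩
    intro j hj
    simp only [Finset.mem_union, Finset.mem_insert] at hj ⊢
    rcases hj with (rfl | hj) | hj
    · exact Or.inr hi.1
    · exact Or.inl hj
    · exact Or.inr hj

omit [Fintype ι] in
-- Match a heaviest element of `S` with an element of `B` at least as heavy and delete both. The
-- counts still compare: below the deleted weight both drop by one, and above it nothing of `S` is
-- left.
theorem sum_le_sum_of_card_filter_le (w : ι → ℝ) (S B : Finset ι) (hw : ∀ i ∈ B, 0 ≤ w i)
    (h : ∀ t : ℝ, 0 < t → (S.filter (t ≤ w ·)).card ≤ (B.filter (t ≤ w ·)).card) :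
    ∑ i ∈ S, w i ≤ ∑ i ∈ B, w i := by
  induction hn : S.card generalizing S B with
  | zero =>
    rw [Finset.card_eq_zero] at hn
    subst hn
    simpa using Finset.sum_nonneg hw
  | succ n ih =>
    have hne : S.Nonempty := Finset.card_pos.1 (by omega)
    obtain ⟨j, hj, hmax⟩ := S.exists_max_image w hne
    rcases le_or_gt (w j) 0 with hwj | hwj
    · exact (Finset.sum_nonpos fun i hi => (hmax i hi).trans hwj).trans (Finset.sum_nonneg hw)
    · have h1 := h (w j) hwj
      have h2 : 0 < (S.filter (w j ≤ w ·)).card :=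
        Finset.card_pos.2 ⟨j, Finset.mem_filter.2 ⟨hj, le_rfl⟩⟩
      obtain ⟨i, hi⟩ := Finset.card_pos.1 (h2.trans_le h1)
      rw [Finset.mem_filter] at hi
      rw [← Finset.add_sum_erase _ _ hj, ← Finset.add_sum_erase _ _ hi.1]
      refine add_le_add hi.2 (ih (S.erase j) (B.erase i)
        (fun k hk => hw k (Finset.mem_of_mem_erase hk)) (fun t ht => ?_)
        (by rw [Finset.card_erase_of_mem hj]; omega))
      rcases le_or_gt t (w j) with htj | htj
      · rw [Finset.filter_erase, Finset.filter_erase, Finset.card_erase_of_mem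
          (Finset.mem_filter.2 ⟨hj, htj⟩), Finset.card_erase_of_mem
          (Finset.mem_filter.2 ⟨hi.1, htj.trans hi.2⟩)]
        exact Nat.sub_le_sub_right (h t ht) 1
      · rw [Finset.filter_false_of_mem]
        · simp
        · intro k hk
          exact not_le.2 ((hmax k (Finset.mem_of_mem_erase hk)).trans_lt htj)

omit [Fintype ι] in
/-- In a matroid, local optimality of an independent set implies global optimality. -/
theorem IsMatroid.sum_le_of_locally_optimal {I : Set (Finset ι)} (hI : IsMatroid I)
    {w : ι → ℝ} {B S : Finset ι} (hB : B ∈ I) (hS : S ∈ I) (hw : ∀ i ∈ B, 0 ≤ w i)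
    (hadd : ∀ j ∉ B, insert j B ∈ I → w j ≤ 0)
    (hswap : ∀ i ∈ B, ∀ j ∉ B, insert j (B.erase i) ∈ I → w j ≤ w i) :
    ∑ i ∈ S, w i ≤ ∑ i ∈ B, w i := by
  refine sum_le_sum_of_card_filter_le w S B hw fun t ht => ?_
  by_contra hlt
  rw [not_le] at hlt
  -- If the superlevel set of `B` at `t` is too small, exchange adds to it some `j ∈ S` of weight at
  -- least `t`. Completing the result by elements of `B` gives `B - i + j` for some `i` of weight
  -- below `t`, or just `B + j`; both contradict local optimality.
  have hBt := hI.subset_mem B hB _ (Finset.filter_subset (t ≤ w ·) B)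
  obtain ⟨j, hj, hjI⟩ := hI.exchange _ (hI.subset_mem S hS _ (Finset.filter_subset (t ≤ w ·) S)) _
    hBt hlt
  rw [Finset.mem_sdiff, Finset.mem_filter] at hj
  obtain ⟨⟨hjS, hjt⟩, hjB'⟩ := hj
  have hjB : j ∉ B := fun h => hjB' (Finset.mem_filter.2 ⟨h, hjt⟩)
  have hcard : (insert j (B.filter (t ≤ w ·))).card = (B.filter (t ≤ w ·)).card + 1 :=
    Finset.card_insert_of_notMem hjB'
  have hle := Finset.card_filter_le B (t ≤ w ·)
  rcases hle.eq_or_lt with heq | hlt'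
  · have : B.filter (t ≤ w ·) = B :=
      Finset.eq_of_subset_of_card_le (Finset.filter_subset _ _) heq.ge
    rw [this] at hjI
    linarith [hadd j hjB hjI]
  · obtain ⟨C, hC, h1, h2, h3⟩ := hI.exists_augment hB hjI (by omega)
    have hjC : j ∈ C := h1 (Finset.mem_insert_self _ _)
    have hCB : C.erase j ⊆ B := by
      intro k hk
      rw [Finset.mem_erase] at hk
      have := h2 hk.2
      simp only [Finset.mem_union, Finset.mem_insert, Finset.mem_filter] at this
      tauto
    have hCc : (C.erase j).card < B.card := by
      rw [Finset.card_erase_of_mem hjC, h3]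
      have : 0 < C.card := Finset.card_pos.2 ⟨j, hjC⟩
      omega
    obtain ⟨i, hi, hiC⟩ := Finset.exists_mem_notMem_of_card_lt_card hCc
    have hCe : insert j (B.erase i) = C := by
      symm
      refine Finset.eq_of_subset_of_card_le (fun k hk => ?_) ?_
      · by_cases hkj : k = j
        · subst hkj; exact Finset.mem_insert_self _ _
        · have hk' : k ∈ C.erase j := Finset.mem_erase.2 ⟨hkj, hk⟩
          exact Finset.mem_insert_of_mem (Finset.mem_erase.2
            ⟨fun h => hiC (h ▸ hk'), hCB hk'⟩)
      · rw [Finset.card_insert_of_notMem (fun h => hjB (Finset.mem_of_mem_erase h)),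
          Finset.card_erase_of_mem hi, h3]
        have : 0 < B.card := Finset.card_pos.2 ⟨i, hi⟩
        omega
    have hle' := hswap i hi j hjB (hCe ▸ hC)
    have hij : i ≠ j := fun h => hjB (h ▸ hi)
    have hit : i ∈ B.filter (t ≤ w ·) := Finset.mem_filter.2 ⟨hi, hjt.trans hle'⟩
    exact hiC (Finset.mem_erase.2 ⟨hij, h1 (Finset.mem_insert_of_mem hit)⟩)

/-- Key inequality for matroids: a maximum weight set for large weights, paid the maximum of
thresholds and small weights, collects at least the maximum small weight. -/
theorem IsMatroid.maxWeight_le_sum_max {I : Set (Finset ι)} (hI : IsMatroid I) {w c : ι → ℝ}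
    (hc : ∀ i, 0 ≤ c i) (hcw : ∀ i, c i ≤ w i) {B : Finset ι} (hB : B ∈ I)
    (hopt : ∑ i ∈ B, w i = maxWeight I w) :
    maxWeight I c ≤ ∑ i ∈ B, max (threshold I w i) (c i) := by
  -- These weights dominate `c`, so it suffices that `B` is optimal for `u`, and in a matroid this
  -- only has to be checked locally.
  set u : ι → ℝ := fun i => if i ∈ B then max (threshold I w i) (c i) else w i with hu
  have hub : ∑ i ∈ B, max (threshold I w i) (c i) = ∑ i ∈ B, u i :=
    Finset.sum_congr rfl fun i hi => by simp [hu, hi]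
  have hcu : ∀ i, c i ≤ u i := fun i => by
    by_cases hi : i ∈ B
    · simp [hu, hi]
    · simpa [hu, hi] using hcw i
  rw [hub]
  refine maxWeight_le ⟨B, hB⟩ fun S hS => ?_
  refine (Finset.sum_le_sum fun i _ => hcu i).trans ?_
  refine hI.sum_le_of_locally_optimal hB hS (fun i _ => (hc i).trans (hcu i)) ?_ ?_
  · intro j hj hjI
    have := sum_le_maxWeight w hjI
    rw [Finset.sum_insert hj, hopt] at this
    simp only [hu, hj, if_false]
    linarith
  · intro i hi j hj hjI
    simp only [hu, hj, hi, if_false, if_true]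
    refine le_trans ?_ (le_max_left _ _)
    have hij : i ≠ j := fun h => hj (h ▸ hi)
    -- The set `B - i + j` competes against `i`, so the threshold of `i` is at least `w j`.
    have h1 : w j + (∑ k ∈ B, w k - w i) ≤ maxWeight {S | S ∈ I ∧ i ∉ S} w := by
      have := sum_le_maxWeight (J := {S | S ∈ I ∧ i ∉ S}) w (S := insert j (B.erase i))
        ⟨hjI, by simp [hij]⟩
      rw [Finset.sum_insert (fun h => hj (Finset.mem_of_mem_erase h))] at this
      rw [← Finset.add_sum_erase _ _ hi]
      linarith
    have h2 : maxWeight {S | S ∈ I ∧ i ∈ S} (Function.update w i 0) ≤ ∑ k ∈ B, w k - w i := by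
      refine maxWeight_le (J := {S | S ∈ I ∧ i ∈ S}) ⟨B, hB, hi⟩ fun S hS => ?_
      rw [sum_update_zero w hS.2, hopt]
      linarith [sum_le_maxWeight w hS.1]
    unfold threshold
    linarith

end MaxWeight

/-! ### Myerson's auction as a maximum weight problem -/

section Myerson

variable {ι : Type*}

/-- The positive parts of the ironed virtual values of a value profile. -/
def virtualWeight (D : ι → Measure ℝ) (v : ι → ℝ) : ι → ℝ := fun i => posVirtual (D i) (v i)

theorem virtualWeight_update [DecidableEq ι] (D : ι → Measure ℝ) (v : ι → ℝ) (i : ι) (t : ℝ) :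
    virtualWeight D (Function.update v i t) =
      Function.update (virtualWeight D v) i (posVirtual (D i) t) := by
  funext j
  by_cases hj : j = i
  · subst hj; simp [virtualWeight]
  · simp [virtualWeight, hj]

theorem IsProductValueDist.measurable_virtualWeight {D : ι → Measure ℝ}
    (hD : IsProductValueDist D) (i : ι) : Measurable fun v => virtualWeight D v i :=
  (hD i).measurable_posVirtual.comp (measurable_pi_apply i)

theorem coe_sum_ereal (s : Finset ι) (f : ι → ℝ) :
    ((∑ i ∈ s, f i : ℝ) : EReal) = ∑ i ∈ s, (f i : EReal) :=
  map_sum (⟨⟨(↑), EReal.coe_zero⟩, EReal.coe_add⟩ : ℝ →+ EReal) f s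

variable [Fintype ι]

theorem virtualWelfare_le {D : ι → Measure ℝ} {v x c : ι → ℝ} (hx : ∀ i, 0 ≤ x i)
    (hc : ∀ i, ironedVirtualValue (D i) (v i) ≤ (c i : EReal)) :
    virtualWelfare D v x ≤ ((∑ i, x i * c i : ℝ) : EReal) := by
  rw [coe_sum_ereal]
  refine Finset.sum_le_sum fun i _ => ?_
  rw [EReal.coe_mul]
  exact mul_le_mul_of_nonneg_left (hc i) (EReal.coe_nonneg.2 (hx i))

omit [Fintype ι] in
theorem ironedVirtualValue_le_virtualWeight (D : ι → Measure ℝ) (v : ι → ℝ) (i : ι) :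
    ironedVirtualValue (D i) (v i) ≤ (virtualWeight D v i : EReal) := by
  rw [virtualWeight, coe_posVirtual]
  exact le_max_left _ _

variable [DecidableEq ι]

/-- Dropping members without positive virtual value, possibly `-∞`, realizes the truncated weight of
`S`. By downward closure the extended-real welfare problem thus becomes a real one. -/
theorem virtualWelfare_filter (D : ι → Measure ℝ) (v : ι → ℝ) (S : Finset ι) :
    virtualWelfare D v (indVec (S.filter (0 < virtualWeight D v ·))) =
      ((∑ i ∈ S, virtualWeight D v i : ℝ) : EReal) := by
  rw [coe_sum_ereal, ← Finset.sum_filter_of_ne (p := (0 < virtualWeight D v ·))]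
  · rw [virtualWelfare, ← Finset.sum_subset (Finset.subset_univ
      (S.filter (0 < virtualWeight D v ·)))]
    · refine Finset.sum_congr rfl fun i hi => ?_
      have hpos := (Finset.mem_filter.1 hi).2
      have h1 : ((indVec (S.filter (0 < virtualWeight D v ·)) i : ℝ) : EReal) = 1 := by
        rw [indVec, if_pos hi, EReal.coe_one]
      have h2 := coe_posVirtual (μ := D i) (v i)
      have h3 : (0 : EReal) < posVirtual (D i) (v i) := EReal.coe_pos.2 hpos
      rw [h1, one_mul, virtualWeight]
      rcases le_total (ironedVirtualValue (D i) (v i)) 0 with hle | hle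
      · rw [max_eq_right hle] at h2
        exact absurd h2 h3.ne'
      · rw [h2, max_eq_left hle]
    · intro i _ hi
      rw [indVec, if_neg hi, EReal.coe_zero, zero_mul]
  · intro i _ hi
    refine lt_of_le_of_ne (posVirtual_nonneg _) fun h => hi ?_
    rw [virtualWeight] at h ⊢
    rw [← h, EReal.coe_zero]

variable {I : Set (Finset ι)} {D : ι → Measure ℝ} {M : Mechanism ι}

theorem IsMyerson.coe_maxWeight_le (hI : IsDownwardClosed I)
    (hM : IsMyerson (feasibleAllocations I) D M) (v : ι → ℝ) :
    (maxWeight I (virtualWeight D v) : EReal) ≤ virtualWelfare D v (M.alloc v) := by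
  obtain ⟨S, hS, hSe⟩ := exists_sum_eq_maxWeight ⟨∅, hI.empty_mem⟩ (virtualWeight D v)
  rw [← hSe, ← virtualWelfare_filter]
  exact hM.maximizes v _ (indVec_mem (hI.subset_mem S hS _ (Finset.filter_subset _ _)))

/-- The bounds `c` may be negative; `alloc_eq_zero_of_neg` needs this to see that serving a bidder
with negative virtual value is a strict loss. -/
theorem IsMyerson.maxWeight_le_of_le (hI : IsDownwardClosed I)
    (hM : IsMyerson (feasibleAllocations I) D M) (v : ι → ℝ) {c : ι → ℝ}
    (hc : ∀ i, ironedVirtualValue (D i) (v i) ≤ (c i : EReal)) :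
    maxWeight I (virtualWeight D v) ≤ ∑ i, M.alloc v i * c i :=
  EReal.coe_le_coe_iff.1 ((hM.coe_maxWeight_le hI v).trans
    (virtualWelfare_le (fun i => (feasible_mem_unit (hM.feasible v) i).1) hc))

theorem IsMyerson.maxWeight_le (hI : IsDownwardClosed I)
    (hM : IsMyerson (feasibleAllocations I) D M) (v : ι → ℝ) :
    maxWeight I (virtualWeight D v) ≤ ∑ i, M.alloc v i * virtualWeight D v i :=
  hM.maxWeight_le_of_le hI v fun i => ironedVirtualValue_le_virtualWeight D v i

theorem IsMyerson.alloc_eq_zero_of_neg (hI : IsDownwardClosed I)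
    (hM : IsMyerson (feasibleAllocations I) D M) {v : ι → ℝ} {i : ι}
    (hneg : ironedVirtualValue (D i) (v i) < 0) : M.alloc v i = 0 := by
  obtain ⟨c, hc1, hc2⟩ := EReal.lt_iff_exists_real_btwn.1 hneg
  have hc0 : c < 0 := by exact_mod_cast hc2
  have h1 := hM.maxWeight_le_of_le hI v (c := Function.update (virtualWeight D v) i c) fun j => by
    by_cases hj : j = i
    · subst hj; simpa using hc1.le
    · simpa [hj] using ironedVirtualValue_le_virtualWeight D v j
  have h2 := feasible_sum_le (fun S hS => sum_le_maxWeight (virtualWeight D v) hS) (hM.feasible v)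
  have hwi : virtualWeight D v i = 0 := by
    have := coe_posVirtual (μ := D i) (v i)
    rw [max_eq_right hneg.le] at this
    exact_mod_cast this
  have h3 : ∑ j, M.alloc v j * Function.update (virtualWeight D v) i c j =
      ∑ j, M.alloc v j * virtualWeight D v j + M.alloc v i * c := by
    rw [← Finset.add_sum_erase _ _ (Finset.mem_univ i),
      ← Finset.add_sum_erase (a := i) _ (fun j => M.alloc v j * virtualWeight D v j)
        (Finset.mem_univ i), hwi, Function.update_self, mul_zero, zero_add, add_comm]
    congr 1
    exact Finset.sum_congr rfl fun j hj => by
      rw [Function.update_of_ne (Finset.ne_of_mem_erase hj)]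
  refine le_antisymm ?_ (feasible_mem_unit (hM.feasible v) i).1
  by_contra hpos
  nlinarith [mul_pos (not_le.1 hpos) (neg_pos.2 hc0)]

/-! Existence of Myerson's auction. -/

/-- Measurable tie-breaking: enumerate the subsets, take the first one of maximum weight, and drop
its members of weight `0`. The outcome depends on the virtual values only. -/
theorem exists_isMyerson (hI : IsDownwardClosed I) (hD : IsProductValueDist D) :
    ∃ M : Mechanism ι, IsMyerson (feasibleAllocations I) D M := by
  classical
  obtain ⟨f, hf⟩ := exists_surjective_nat (Finset ι)
  have hp : ∀ w : ι → ℝ, ∃ k, f k ∈ I ∧ ∑ i ∈ f k, w i = maxWeight I w := fun w => by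
    obtain ⟨S, hS, hSe⟩ := exists_sum_eq_maxWeight ⟨∅, hI.empty_mem⟩ w
    obtain ⟨k, rfl⟩ := hf S
    exact ⟨k, hS, hSe⟩
  have hfind : Measurable fun w : ι → ℝ => Nat.find (hp w) := by
    refine measurable_find hp fun k => ?_
    by_cases hk : f k ∈ I
    · simp only [hk, true_and]
      exact measurableSet_eq_fun (Finset.measurable_fun_sum _ fun i _ => measurable_pi_apply i)
        (measurable_maxWeight I fun i => measurable_pi_apply i)
    · simp [hk]
  set A : (ι → ℝ) → ι → ℝ := fun w => indVec ((f (Nat.find (hp w))).filter (0 < w ·)) with hA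
  have hAm : Measurable A := by
    refine measurable_pi_lambda _ fun i => ?_
    simp only [hA, indVec, Finset.mem_filter]
    refine Measurable.ite (MeasurableSet.inter ?_ ?_) measurable_const measurable_const
    · exact hfind (MeasurableSet.of_discrete (s := {k | i ∈ f k}))
    · exact measurableSet_lt measurable_const (measurable_pi_apply i)
  refine ⟨⟨fun v => A (virtualWeight D v), fun v i => v i * A (virtualWeight D v) i -
    ∫ t in (0 : ℝ)..(v i), A (virtualWeight D (Function.update v i t)) i⟩, ?_, ?_, ?_, ?_, ?_⟩
  · exact hAm.comp (measurable_pi_lambda _ hD.measurable_virtualWeight)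
  · exact fun v =>
      indVec_mem (hI.subset_mem _ (Nat.find_spec (hp _)).1 _ (Finset.filter_subset _ _))
  · intro v y hy
    change _ ≤ virtualWelfare D v (indVec _)
    rw [virtualWelfare_filter, (Nat.find_spec (hp (virtualWeight D v))).2]
    refine (virtualWelfare_le (fun i => (feasible_mem_unit hy i).1)
      (ironedVirtualValue_le_virtualWeight D v)).trans (EReal.coe_le_coe_iff.2 ?_)
    exact feasible_sum_le (fun S hS => sum_le_maxWeight _ hS) hy
  · intro v v' h
    have : virtualWeight D v = virtualWeight D v' := funext fun i => by
      simp only [virtualWeight, posVirtual, h i]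
    simp only [this]
  · intro v i
    rfl

/-! Payments. -/

theorem IsMyerson.measurable_pay {X : Set (ι → ℝ)} (hM : IsMyerson X D M) (i : ι) :
    Measurable fun v => M.pay v i := by
  have hx : Measurable fun v => M.alloc v i := (measurable_pi_apply i).comp hM.measurable_alloc
  have hup : Measurable fun z : (ι → ℝ) × ℝ => M.alloc (Function.update z.1 i z.2) i :=
    hx.comp (measurable_update_prod i)
  have hz : Measurable fun z : (ι → ℝ) × ℝ => z.1 i := (measurable_pi_apply i).comp measurable_fst
  -- An interval integral with a moving endpoint is rewritten as integrals over the line of jointly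
  -- measurable indicators, one for each orientation of the interval.
  have key : ∀ s : Set ((ι → ℝ) × ℝ), MeasurableSet s →
      Measurable fun v => ∫ t, s.indicator
        (fun z : (ι → ℝ) × ℝ => M.alloc (Function.update z.1 i z.2) i) (v, t) := fun s hs =>
    (StronglyMeasurable.integral_prod_right (ν := volume)
      (f := fun v t => s.indicator (fun z : (ι → ℝ) × ℝ => M.alloc (Function.update z.1 i z.2) i)
        (v, t)) (hup.indicator hs).stronglyMeasurable).measurable
  have h1 := key {z | 0 < z.2 ∧ z.2 ≤ z.1 i}
    ((measurableSet_lt measurable_const measurable_snd).inter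
    (measurableSet_le measurable_snd hz))
  have h2 := key {z | z.1 i < z.2 ∧ z.2 ≤ 0} ((measurableSet_lt hz measurable_snd).inter
    (measurableSet_le measurable_snd measurable_const))
  have : (fun v => M.pay v i) = fun v => v i * M.alloc v i -
      ((∫ t, {z : (ι → ℝ) × ℝ | 0 < z.2 ∧ z.2 ≤ z.1 i}.indicator
        (fun z : (ι → ℝ) × ℝ => M.alloc (Function.update z.1 i z.2) i) (v, t)) -
      ∫ t, {z : (ι → ℝ) × ℝ | z.1 i < z.2 ∧ z.2 ≤ 0}.indicator
        (fun z : (ι → ℝ) × ℝ => M.alloc (Function.update z.1 i z.2) i) (v, t)) := by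
    funext v
    rw [hM.payment, intervalIntegral, ← integral_indicator measurableSet_Ioc,
      ← integral_indicator measurableSet_Ioc]
    rfl
  rw [this]
  exact ((measurable_pi_apply i).mul hx).sub (h1.sub h2)

theorem IsMyerson.abs_pay_le (hM : IsMyerson (feasibleAllocations I) D M) {v : ι → ℝ} {i : ι}
    (hv : v i ∈ Icc (0 : ℝ) 1) : |M.pay v i| ≤ 2 := by
  rw [hM.payment]
  have h1 := feasible_mem_unit (hM.feasible v) i
  have h2 : |∫ t in (0 : ℝ)..(v i), M.alloc (Function.update v i t) i| ≤ 1 * |v i - 0| := by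
    rw [← Real.norm_eq_abs]
    refine intervalIntegral.norm_integral_le_of_norm_le_const fun t _ => ?_
    have := feasible_mem_unit (hM.feasible (Function.update v i t)) i
    rw [Real.norm_of_nonneg this.1]
    exact this.2
  rw [sub_zero, one_mul, abs_of_nonneg hv.1] at h2
  have h3 : |v i * M.alloc v i| ≤ 1 := by
    rw [abs_of_nonneg (mul_nonneg hv.1 h1.1)]
    exact mul_le_one₀ hv.2 h1.1 h1.2
  calc _ ≤ |v i * M.alloc v i| + |∫ t in (0 : ℝ)..(v i), M.alloc (Function.update v i t) i| :=
        abs_sub _ _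
    _ ≤ 2 := by linarith [hv.2]

end Myerson

/-! ### Closed and open level sets of the ironed virtual value -/

section LevelSets

variable {μ ν : Measure ℝ}

theorem IsValueDist.isLevelSet_ge (h : IsValueDist μ) {T : ℝ} (hT : 0 ≤ T) :
    IsLevelSet μ {t | (T : EReal) ≤ ironedVirtualValue μ t} where
  upper := fun _ _ hab ha => le_trans (α := EReal) ha (h.monotone_ironedVirtualValue hab)
  nonneg := fun _ hv => le_trans (α := EReal) (EReal.coe_nonneg.2 hT) hv
  congr := fun v w he hv => by
    rw [mem_ofPred_eq] at hv ⊢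
    rwa [← he]

theorem IsValueDist.isLevelSet_gt (h : IsValueDist μ) {T : ℝ} (hT : 0 ≤ T) :
    IsLevelSet μ {t | (T : EReal) < ironedVirtualValue μ t} where
  upper := fun _ _ hab ha => lt_of_lt_of_le (α := EReal) ha (h.monotone_ironedVirtualValue hab)
  nonneg := fun _ hv => (lt_of_le_of_lt (α := EReal) (EReal.coe_nonneg.2 hT) hv).le
  congr := fun v w he hv => by
    rw [mem_ofPred_eq] at hv ⊢
    rwa [← he]

theorem posVirtual_le_of_le {T v : ℝ} (hT : 0 ≤ T) (h : ironedVirtualValue μ v ≤ (T : EReal)) :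
    posVirtual μ v ≤ T := by
  rw [← EReal.coe_le_coe_iff, coe_posVirtual]
  exact max_le h (EReal.coe_nonneg.2 hT)

theorem IsLevelSet.integral_max_le_mul {U : Set ℝ} (hU : IsLevelSet μ U) (hμ : IsValueDist μ)
    (hν : IsValueDist ν) (hd : Dominates ν μ) {T : ℝ}
    (hT : ∀ v ∈ U, (T : EReal) ≤ ironedVirtualValue μ v)
    (hT' : ∀ v ∉ U, posVirtual μ v ≤ T) :
    ∫ s, U.indicator 1 (valueAt ν s) * max T (posVirtual μ (valueAt μ s)) ∂unif
      ≤ ∫ s, sInf U * U.indicator 1 (valueAt ν s) ∂unif := by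
  rcases U.eq_empty_or_nonempty with rfl | hne
  · simp
  · refine (hU.integral_max_le hμ hν hd hne hT hT').trans_eq ?_
    rw [integral_const_mul]
    have := hν.integral_indicator_valueAt hU.upper fun _ => (1 : ℝ)
    simp only [mul_one, intervalIntegral.integral_const, smul_eq_mul, sub_zero] at this
    rw [this]

end LevelSets

/-! ### Revenue from a dominating distribution, and the upper bound on the optimal revenue -/

section LowerBound

variable {ι : Type*} [Fintype ι] [DecidableEq ι] {I : Set (Finset ι)} {D D' : ι → Measure ℝ}
  {M : Mechanism ι}

/-- Given the other values, Myerson's allocation of a bidder is a mixture of the two threshold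
allocations at the same virtual threshold. -/
theorem IsMyerson.alloc_eq (hI : IsDownwardClosed I) (hM : IsMyerson (feasibleAllocations I) D M)
    (v : ι → ℝ) {i : ι} (hi : {i} ∈ I) :
    ∃ c ∈ Icc (0 : ℝ) 1, ∀ t, M.alloc (Function.update v i t) i =
      c * {t | (threshold I (virtualWeight D v) i : EReal) ≤
        ironedVirtualValue (D i) t}.indicator 1 t +
      (1 - c) * {t | (threshold I (virtualWeight D v) i : EReal) <
        ironedVirtualValue (D i) t}.indicator 1 t := by
  classical
  set T := threshold I (virtualWeight D v) i with hT
  have hT0 : 0 ≤ T := threshold_nonneg hI _ hi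
  have hthr : ∀ t, threshold I (virtualWeight D (Function.update v i t)) i = T := fun t => by
    rw [virtualWeight_update, threshold_update]
  have hw : ∀ t, virtualWeight D (Function.update v i t) i = posVirtual (D i) t := fun t => by
    simp [virtualWeight]
  have hgt : ∀ t, (T : EReal) < ironedVirtualValue (D i) t →
      M.alloc (Function.update v i t) i = 1 := fun t ht => by
    refine eq_one_of_threshold_lt hi (hM.feasible _) (hM.maxWeight_le hI _) ?_
    rw [hthr, hw, ← EReal.coe_lt_coe_iff, coe_posVirtual]
    exact ht.trans_le (le_max_left _ _)
  have hlt : ∀ t, ironedVirtualValue (D i) t < (T : EReal) →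
      M.alloc (Function.update v i t) i = 0 := fun t ht => by
    -- At threshold `0` truncated weights cannot tell a negative virtual value from a zero one, so
    -- the sign argument is used instead.
    rcases hT0.eq_or_lt with h0 | h0
    · refine hM.alloc_eq_zero_of_neg hI ?_
      rw [Function.update_self]
      rwa [← h0, EReal.coe_zero] at ht
    · refine eq_zero_of_lt_threshold hI.empty_mem (hM.feasible _) (hM.maxWeight_le hI _) ?_
      rw [hthr, hw, ← EReal.coe_lt_coe_iff, coe_posVirtual]
      exact max_lt ht (EReal.coe_pos.2 h0)
  -- All ties at the threshold are broken alike, because the allocation depends on virtual values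
  -- only; `c` is this common allocation, arbitrary if no tie exists.
  obtain ⟨c, hc, heq⟩ : ∃ c ∈ Icc (0 : ℝ) 1, ∀ t, ironedVirtualValue (D i) t = (T : EReal) →
      M.alloc (Function.update v i t) i = c := by
    by_cases hex : ∃ t₀, ironedVirtualValue (D i) t₀ = (T : EReal)
    · obtain ⟨t₀, ht₀⟩ := hex
      refine ⟨_, feasible_mem_unit (hM.feasible (Function.update v i t₀)) i, fun t ht => ?_⟩
      rw [hM.depends_on_virtual (Function.update v i t) (Function.update v i t₀)]
      intro j
      by_cases hj : j = i
      · subst hj; simp [ht, ht₀]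
      · simp [hj]
    · exact ⟨0, by simp, fun t ht => absurd ⟨t, ht⟩ hex⟩
  refine ⟨c, hc, fun t => ?_⟩
  rcases lt_trichotomy (ironedVirtualValue (D i) t) (T : EReal) with h | h | h
  · rw [hlt t h, indicator_of_notMem (show t ∉ {t | (T : EReal) ≤ _} from not_le.2 h),
      indicator_of_notMem (show t ∉ {t | (T : EReal) < _} from not_lt.2 h.le)]
    ring
  · rw [heq t h, indicator_of_mem (show t ∈ {t | (T : EReal) ≤ _} from h.ge),
      indicator_of_notMem (show t ∉ {t | (T : EReal) < _} from not_lt.2 h.le)]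
    simp
  · rw [hgt t h, indicator_of_mem (show t ∈ {t | (T : EReal) ≤ _} from h.le),
      indicator_of_mem (show t ∈ {t | (T : EReal) < _} from h)]
    simp

theorem IsMyerson.pay_update_of_alloc {X : Set (ι → ℝ)} (hM : IsMyerson X D M) (v : ι → ℝ) {i : ι}
    {c : ℝ} {U U' : Set ℝ} (hU : IsUpperSet U) (hU' : IsUpperSet U') (h0 : ∀ u ∈ U, 0 ≤ u)
    (h0' : ∀ u ∈ U', 0 ≤ u)
    (hx : ∀ t, M.alloc (Function.update v i t) i =
      c * U.indicator 1 t + (1 - c) * U'.indicator 1 t) {t : ℝ} (ht : 0 ≤ t) :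
    M.pay (Function.update v i t) i =
      c * (sInf U * U.indicator 1 t) + (1 - c) * (sInf U' * U'.indicator 1 t) := by
  have hInt : ∀ V : Set ℝ, IsUpperSet V →
      IntervalIntegrable (V.indicator (1 : ℝ → ℝ)) volume 0 t := fun V hV => by
    rw [intervalIntegrable_iff]
    refine Measure.integrableOn_of_bounded (M := 1) measure_Ioc_lt_top.ne
      (measurable_one.indicator hV.ordConnected.measurableSet).aestronglyMeasurable
      (Eventually.of_forall fun s => ?_)
    by_cases hs : s ∈ V <;> simp [hs]
  rw [hM.payment]
  simp only [Function.update_idem, Function.update_self, hx]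
  rw [intervalIntegral.integral_add ((hInt U hU).const_mul _) ((hInt U' hU').const_mul _),
    intervalIntegral.integral_const_mul, intervalIntegral.integral_const_mul,
    ← payment_indicator hU h0 ht, ← payment_indicator hU' h0' ht]
  ring

theorem integrable_unif_of_bound {F : ℝ → ℝ} (hF : Measurable F) {C : ℝ} (hC : ∀ s, |F s| ≤ C) :
    Integrable F unif :=
  Integrable.of_bound hF.aestronglyMeasurable C (Eventually.of_forall hC)

/-- Expected payment of one bidder in Myerson's auction with respect to `D'`, the other values
being fixed and its own value being drawn from the dominating distribution. -/
theorem IsMyerson.integral_alloc_le_integral_pay (hI : IsDownwardClosed I)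
    (hM : IsMyerson (feasibleAllocations I) D' M) (hD' : IsProductValueDist D')
    (hD : IsProductValueDist D) (hdom : ∀ i, Dominates (D i) (D' i)) (v : ι → ℝ) (i : ι) :
    ∫ s, M.alloc (Function.update v i (valueAt (D i) s)) i *
        max (threshold I (virtualWeight D' v) i) (posVirtual (D' i) (valueAt (D' i) s)) ∂unif ≤
      ∫ s, M.pay (Function.update v i (valueAt (D i) s)) i ∂unif := by
  by_cases hi : {i} ∈ I
  · obtain ⟨c, hc, hx⟩ := hM.alloc_eq hI v hi
    set T := threshold I (virtualWeight D' v) i with hT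
    have hT0 : 0 ≤ T := threshold_nonneg hI _ hi
    set U := {t | (T : EReal) ≤ ironedVirtualValue (D' i) t} with hU
    set U' := {t | (T : EReal) < ironedVirtualValue (D' i) t} with hU'
    have hL := (hD' i).isLevelSet_ge hT0
    have hL' := (hD' i).isLevelSet_gt hT0
    have h1 := hL.integral_max_le_mul (hD' i) (hD i) (hdom i) (T := T) (fun v hv => hv)
      fun v hv => posVirtual_le_of_le hT0 (not_le.1 hv).le
    have h2 := hL'.integral_max_le_mul (hD' i) (hD i) (hdom i) (T := T)
      (fun v hv => le_of_lt hv) fun v hv => posVirtual_le_of_le hT0 (not_lt.1 hv)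
    rw [← hU] at h1 hL
    rw [← hU'] at h2 hL'
    have hpay : ∀ s, M.pay (Function.update v i (valueAt (D i) s)) i =
        c * (sInf U * U.indicator 1 (valueAt (D i) s)) +
        (1 - c) * (sInf U' * U'.indicator 1 (valueAt (D i) s)) := fun s =>
      hM.pay_update_of_alloc v hL.upper hL'.upper (fun u hu => hL.nonneg_of_mem (hD' i) hu)
        (fun u hu => hL'.nonneg_of_mem (hD' i) hu) hx (valueAt_nonneg s)
    have hind : ∀ W : Set ℝ, IsUpperSet W →
        Integrable (fun s => W.indicator (1 : ℝ → ℝ) (valueAt (D i) s)) unif := fun W hW =>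
      integrable_unif_of_bound ((measurable_one.indicator hW.ordConnected.measurableSet).comp
        (hD i).measurable_valueAt) (C := 1) fun s => by
          by_cases hs : valueAt (D i) s ∈ W <;> simp [hs]
    have hmx : Measurable fun s => max T (posVirtual (D' i) (valueAt (D' i) s)) :=
      measurable_const.max ((hD' i).measurable_posVirtual.comp (hD' i).measurable_valueAt)
    have hindm : ∀ W : Set ℝ, IsUpperSet W → Integrable (fun s =>
        W.indicator (1 : ℝ → ℝ) (valueAt (D i) s) *
          max T (posVirtual (D' i) (valueAt (D' i) s))) unif := fun W hW =>
      integrable_unif_of_bound (((measurable_one.indicator hW.ordConnected.measurableSet).comp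
        (hD i).measurable_valueAt).mul hmx) (C := max T 1) fun s => by
          have hb : |max T (posVirtual (D' i) (valueAt (D' i) s))| ≤ max T 1 := by
            rw [abs_of_nonneg (hT0.trans (le_max_left _ _))]
            exact max_le_max_left _ ((hD' i).posVirtual_le_one _)
          by_cases hs : valueAt (D i) s ∈ W
          · simpa [hs] using hb
          · simp [hs, hT0]
    simp only [hpay, hx, add_mul, mul_assoc]
    rw [integral_add ((hindm U hL.upper).const_mul c) ((hindm U' hL'.upper).const_mul (1 - c)),
      integral_add (((hind U hL.upper).const_mul _).const_mul c)
        (((hind U' hL'.upper).const_mul _).const_mul (1 - c)),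
      integral_const_mul, integral_const_mul, integral_const_mul c, integral_const_mul (1 - c)]
    exact add_le_add (mul_le_mul_of_nonneg_left h1 hc.1)
      (mul_le_mul_of_nonneg_left h2 (by linarith [hc.2]))
  · have hx : ∀ t, M.alloc (Function.update v i t) i = 0 := fun t =>
      feasible_eq_zero hI (hM.feasible _) hi
    simp [hM.payment, hx]

/-- The value profile at given quantiles. -/
def profileAt (D : ι → Measure ℝ) (s : ι → ℝ) : ι → ℝ := fun i => valueAt (D i) (s i)

omit [Fintype ι] in
theorem profileAt_update (D : ι → Measure ℝ) (s : ι → ℝ) (i : ι) (t : ℝ) :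
    profileAt D (Function.update s i t) =
      Function.update (profileAt D s) i (valueAt (D i) t) := by
  funext j
  by_cases hj : j = i
  · subst hj; simp [profileAt]
  · simp [profileAt, hj]

omit [Fintype ι] [DecidableEq ι] in
theorem IsProductValueDist.measurable_profileAt (hD : IsProductValueDist D) :
    Measurable (profileAt D) :=
  measurable_pi_lambda _ fun i => (hD i).measurable_valueAt.comp (measurable_pi_apply i)

omit [DecidableEq ι] in
theorem IsProductValueDist.map_profileAt (hD : IsProductValueDist D) :
    (Measure.pi fun _ : ι => unif).map (profileAt D) = Measure.pi D := by
  have h : ∀ i, unif.map (valueAt (D i)) = D i := fun i => (hD i).map_valueAt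
  have hs : ∀ i, SigmaFinite (unif.map (valueAt (D i))) := fun i => by
    have := (hD i).isProb
    rw [h i]; infer_instance
  have := Measure.pi_map_pi (μ := fun _ : ι => unif) (f := fun i => valueAt (D i))
    fun i => (hD i).measurable_valueAt.aemeasurable
  simp only [h] at this
  exact this

omit [DecidableEq ι] in
theorem IsProductValueDist.integral_pi_eq (hD : IsProductValueDist D) {F : (ι → ℝ) → ℝ}
    (hF : Measurable F) :
    ∫ v, F v ∂(Measure.pi D) = ∫ s, F (profileAt D s) ∂(Measure.pi fun _ : ι => unif) := by
  conv_lhs => rw [← hD.map_profileAt]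
  exact integral_map hD.measurable_profileAt.aemeasurable hF.aestronglyMeasurable

omit [DecidableEq ι] in
theorem maxWeight_mem_Icc {w : ι → ℝ} (h0 : ∅ ∈ I) (hw : ∀ j, w j ≤ 1) :
    maxWeight I w ∈ Icc (0 : ℝ) (Fintype.card ι) := by
  refine ⟨maxWeight_nonneg h0 w, Auction.maxWeight_le ⟨∅, h0⟩ fun S _ => ?_⟩
  refine (Finset.sum_le_sum fun j _ => hw j).trans ?_
  rw [Finset.sum_const, nsmul_eq_mul, mul_one]
  exact_mod_cast Finset.card_le_univ S

/-- For matroids, Myerson's auction with respect to `D'` earns at least the expected maximum ironed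
virtual surplus with respect to `D'` from every dominating distribution. -/
theorem IsMyerson.integral_maxWeight_le_revenue (hI : IsMatroid I)
    (hM : IsMyerson (feasibleAllocations I) D' M) (hD' : IsProductValueDist D')
    (hD : IsProductValueDist D) (hdom : ∀ i, Dominates (D i) (D' i)) :
    ∫ v, maxWeight I (virtualWeight D' v) ∂(Measure.pi D') ≤ revenue M D := by
  have hdc := hI.toIsDownwardClosed
  have hwm : ∀ i, Measurable fun v => virtualWeight D' v i := hD'.measurable_virtualWeight
  have hpayi : ∀ i, Integrable (fun s => M.pay (profileAt D s) i)
      (Measure.pi fun _ : ι => unif) := fun i =>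
    Integrable.of_bound ((hM.measurable_pay i).comp
      hD.measurable_profileAt).aestronglyMeasurable 2
      (Eventually.of_forall fun s => hM.abs_pay_le ((hD i).valueAt_mem (s i)))
  -- The coupling: allocation and threshold are taken at the values from `D`, the last term at the
  -- values from `D'` with the same quantiles.
  set F : ι → (ι → ℝ) → ℝ := fun i s => M.alloc (profileAt D s) i *
    max (threshold I (virtualWeight D' (profileAt D s)) i) (virtualWeight D' (profileAt D' s) i)
    with hF
  have hFi : ∀ i, Integrable (F i) (Measure.pi fun _ : ι => unif) := fun i => by
    refine Integrable.of_bound (Measurable.aestronglyMeasurable ?_) (max (Fintype.card ι) 1)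
      (Eventually.of_forall fun s => ?_)
    · refine Measurable.mul ((measurable_pi_apply i).comp
        (hM.measurable_alloc.comp hD.measurable_profileAt)) (Measurable.max ?_ ?_)
      · exact (measurable_threshold I hwm i).comp hD.measurable_profileAt
      · exact (hwm i).comp hD'.measurable_profileAt
    · by_cases hi : {i} ∈ I
      · have h1 := feasible_mem_unit (hM.feasible (profileAt D s)) i
        have h2 := threshold_nonneg hdc (virtualWeight D' (profileAt D s)) hi
        have h3 := threshold_le_card hdc.empty_mem
          (w := virtualWeight D' (profileAt D s)) (fun j => (hD' j).posVirtual_le_one _) hi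
        have h4 : virtualWeight D' (profileAt D' s) i ≤ 1 := (hD' i).posVirtual_le_one _
        simp only [hF]
        rw [Real.norm_of_nonneg (mul_nonneg h1.1 (h2.trans (le_max_left _ _)))]
        refine (mul_le_of_le_one_left (h2.trans (le_max_left _ _)) h1.2).trans ?_
        exact max_le_max h3 h4
      · simp only [hF]
        rw [feasible_eq_zero hdc (hM.feasible _) hi]
        simp
  have hbid : ∀ i, ∫ s, F i s ∂(Measure.pi fun _ : ι => unif) ≤
      ∫ s, M.pay (profileAt D s) i ∂(Measure.pi fun _ : ι => unif) := fun i => by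
    refine integral_pi_le_of_resample _ i (hFi i) (hpayi i) (Eventually.of_forall fun s => ?_)
    have := hM.integral_alloc_le_integral_pay hdc hD' hD hdom (profileAt D s) i
    simp only [hF, profileAt_update, virtualWeight_update, threshold_update, Function.update_self]
    exact this
  have hsum : Measurable fun v => ∑ i, M.pay v i :=
    Finset.measurable_fun_sum _ fun i _ => hM.measurable_pay i
  rw [revenue, hD.integral_pi_eq hsum, integral_finsetSum _ fun i _ => hpayi i,
    hD'.integral_pi_eq (measurable_maxWeight I hwm)]
  refine le_trans ?_ (Finset.sum_le_sum fun i _ => hbid i)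
  rw [← integral_finsetSum _ fun i _ => hFi i]
  refine integral_mono_ae ?_ (integrable_finsetSum _ fun i _ => hFi i) ?_
  · refine Integrable.of_bound ((measurable_maxWeight I hwm).comp
      hD'.measurable_profileAt).aestronglyMeasurable (Fintype.card ι)
      (Eventually.of_forall fun s => ?_)
    have := maxWeight_mem_Icc (w := virtualWeight D' (profileAt D' s)) hdc.empty_mem
      fun j => (hD' j).posVirtual_le_one _
    rw [Real.norm_of_nonneg this.1]
    exact this.2
  · filter_upwards [ae_pi_of_ae (fun _ : ι => unif) fun _ => ae_unif_mem] with s hs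
    -- At each quantile profile the matroid inequality applies to every maximum weight set, and the
    -- fractional allocation is a mixture of these.
    refine le_sum_of_optimal (hM.feasible _) (hM.maxWeight_le hdc _) fun S hS hopt => ?_
    exact hI.maxWeight_le_sum_max (fun i => posVirtual_nonneg _)
      (fun i => (hD' i).monotone_posVirtual
        ((hdom i).valueAt_le (hD i) (hD' i) (hs i).1.le)) hS hopt

/-- The revenue of a truthful auction is at most the expected maximum ironed virtual surplus. -/
theorem IsTruthful.revenue_le_integral_maxWeight {A : Mechanism ι}
    (hA : IsTruthful (feasibleAllocations I) A) (hI : IsDownwardClosed I)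
    (hD : IsProductValueDist D) :
    revenue A D ≤ ∫ v, maxWeight I (virtualWeight D v) ∂(Measure.pi D) := by
  have hprob : ∀ i, IsProbabilityMeasure (D i) := fun i => (hD i).isProb
  have hwm : ∀ i, Measurable fun v => virtualWeight D v i := hD.measurable_virtualWeight
  have hcube : ∀ᵐ v ∂(Measure.pi D), v ∈ Icc (0 : ι → ℝ) 1 := by
    filter_upwards [ae_pi_of_ae D fun i => (hD i).mem_unit] with v hv
    exact ⟨fun i => (hv i).1, fun i => (hv i).2⟩
  have hpm : ∀ i, Measurable fun v => A.pay v i := fun i =>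
    (measurable_pi_apply i).comp hA.measurable_pay
  have hxm : ∀ i, Measurable fun v => A.alloc v i := fun i =>
    (measurable_pi_apply i).comp hA.measurable_alloc
  have hpi : ∀ i, Integrable (fun v => A.pay v i) (Measure.pi D) := fun i => by
    refine integrable_of_ae_mem_unit (hpm i).aestronglyMeasurable ?_
    filter_upwards [hcube] with v hv
    have h1 := feasible_mem_unit (hA.feasible v hv) i
    have h2 := hA.utility_nonneg v hv i
    have h3 : v i * A.alloc v i ≤ 1 := mul_le_one₀ (hv.2 i) h1.1 h1.2
    exact ⟨hA.pay_nonneg v hv i, by linarith⟩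
  have hxi : ∀ i, Integrable (fun v => A.alloc v i * virtualWeight D v i) (Measure.pi D) :=
    fun i => by
      refine integrable_of_ae_mem_unit ((hxm i).mul (hwm i)).aestronglyMeasurable ?_
      filter_upwards [hcube] with v hv
      have h1 := feasible_mem_unit (hA.feasible v hv) i
      have h2 : 0 ≤ virtualWeight D v i := posVirtual_nonneg _
      exact ⟨mul_nonneg h1.1 h2, mul_le_one₀ h1.2 h2 ((hD i).posVirtual_le_one _)⟩
  have hbid : ∀ i, ∫ v, A.pay v i ∂(Measure.pi D) ≤
      ∫ v, A.alloc v i * virtualWeight D v i ∂(Measure.pi D) := fun i => by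
    refine integral_pi_le_of_resample _ i (hpi i) (hxi i) ?_
    filter_upwards [hcube] with v hv
    have hup : ∀ t ∈ Icc (0 : ℝ) 1, Function.update v i t ∈ Icc (0 : ι → ℝ) 1 := fun t ht => by
      constructor <;> intro j <;> by_cases hj : j = i
      · subst hj; simpa using ht.1
      · simpa [hj] using hv.1 j
      · subst hj; simpa using ht.2
      · simpa [hj] using hv.2 j
    have hum : Measurable fun t : ℝ => Function.update v i t := measurable_update v
    have := (hD i).integral_pay_le (x := fun t => A.alloc (Function.update v i t) i)
      (p := fun t => A.pay (Function.update v i t) i) ((hxm i).comp hum) ((hpm i).comp hum)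
      (fun t ht => feasible_mem_unit (hA.feasible _ (hup t ht)) i)
      (fun t ht => hA.pay_nonneg _ (hup t ht) i)
      (fun t ht => by simpa using hA.utility_nonneg _ (hup t ht) i)
      (fun t ht b hb => by simpa using hA.incentive _ (hup t ht) i b hb)
    simpa [virtualWeight] using this
  rw [revenue, integral_finsetSum _ fun i _ => hpi i]
  refine (Finset.sum_le_sum fun i _ => hbid i).trans ?_
  rw [← integral_finsetSum _ fun i _ => hxi i]
  refine integral_mono_ae (integrable_finsetSum _ fun i _ => hxi i) ?_ ?_
  · refine Integrable.of_bound (measurable_maxWeight I hwm).aestronglyMeasurable (Fintype.card ι)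
      (Eventually.of_forall fun v => ?_)
    have := maxWeight_mem_Icc (w := virtualWeight D v) hI.empty_mem
      fun j => (hD j).posVirtual_le_one _
    rw [Real.norm_of_nonneg this.1]
    exact this.2
  · filter_upwards [hcube] with v hv
    exact feasible_sum_le (fun S hS => sum_le_maxWeight _ hS) (hA.feasible v hv)

theorem opt_le_integral_maxWeight (hI : IsDownwardClosed I) (hD : IsProductValueDist D) :
    opt (feasibleAllocations I) D ≤ ∫ v, maxWeight I (virtualWeight D v) ∂(Measure.pi D) := by
  refine Real.sSup_le ?_ (integral_nonneg fun v => maxWeight_nonneg hI.empty_mem _)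
  rintro _ ⟨A, hA, rfl⟩
  exact hA.revenue_le_integral_maxWeight hI hD

theorem IsTruthful.revenue_le_opt {A : Mechanism ι} (hA : IsTruthful (feasibleAllocations I) A)
    (hI : IsDownwardClosed I) (hD : IsProductValueDist D) :
    revenue A D ≤ opt (feasibleAllocations I) D :=
  le_csSup ⟨∫ v, maxWeight I (virtualWeight D v) ∂(Measure.pi D), by
    rintro _ ⟨B, hB, rfl⟩
    exact hB.revenue_le_integral_maxWeight hI hD⟩ ⟨A, hA, rfl⟩

theorem IsMatroid.strongRevenueMonotone (hI : IsMatroid I) :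
    StrongRevenueMonotone (feasibleAllocations I) := fun _ hD' _ hM _ hD hdom =>
  (opt_le_integral_maxWeight hI.toIsDownwardClosed hD').trans
    (hM.integral_maxWeight_le_revenue hI hD' hD hdom)

theorem StrongRevenueMonotone.forSomeTieBreaking (hI : IsDownwardClosed I)
    (h : StrongRevenueMonotone (feasibleAllocations I)) :
    StrongRevenueMonotoneForSomeTieBreaking (feasibleAllocations I) := fun D' hD' => by
  obtain ⟨M, hM⟩ := exists_isMyerson hI hD'
  exact ⟨M, hM, h D' hD' M hM⟩

end LowerBound

/-! ### Set systems that are not matroids -/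

section LocalExchange

variable {ι : Type*} [DecidableEq ι] {I : Set (Finset ι)}

/-- A downward-closed set system is a matroid if it satisfies the exchange property for pairs of
sets that differ in one and two elements. -/
theorem IsDownwardClosed.isMatroid_of_local (hI : IsDownwardClosed I)
    (hloc : ∀ (K : Finset ι) (a b c : ι), a ∉ K → b ∉ K → c ∉ K → a ≠ b → a ≠ c → b ≠ c →
      insert a K ∈ I → insert b (insert c K) ∈ I →
      insert b (insert a K) ∈ I ∨ insert c (insert a K) ∈ I) : IsMatroid I := by
  refine ⟨hI, fun S hS S' hS' hcard => ?_⟩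
  induction hn : (S' \ S).card generalizing S' with
  | zero =>
    rw [Finset.card_eq_zero, Finset.sdiff_eq_empty_iff_subset] at hn
    obtain ⟨i, hi, hi'⟩ := Finset.exists_mem_notMem_of_card_lt_card hcard
    exact ⟨i, Finset.mem_sdiff.2 ⟨hi, hi'⟩, hI.subset_mem S hS _ (Finset.insert_subset hi hn)⟩
  | succ n ih =>
    -- Without `a` the set is closer to `S`, and induction extends it twice, by `c` and by `b`. The
    -- local property with `K = S' - a` then puts `a` back beside one of the two.
    obtain ⟨a, ha⟩ := Finset.card_pos.1 (show 0 < (S' \ S).card by omega)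
    obtain ⟨haS', haS⟩ := Finset.mem_sdiff.1 ha
    have hKc : (S'.erase a).card + 1 = S'.card := Finset.card_erase_add_one haS'
    have hKd : (S'.erase a \ S).card = n := by
      rw [Finset.erase_sdiff_comm, Finset.card_erase_of_mem ha, hn, Nat.add_sub_cancel]
    obtain ⟨c, hc, hcI⟩ := ih (S'.erase a) (hI.subset_mem S' hS' _ (Finset.erase_subset a S'))
      (by omega) hKd
    obtain ⟨hcS, hcK⟩ := Finset.mem_sdiff.1 hc
    have hac : a ≠ c := fun h => haS (h ▸ hcS)
    have hcS' : c ∉ S' := fun h => hcK (Finset.mem_erase.2 ⟨hac.symm, h⟩)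
    obtain ⟨b, hb, hbI⟩ := ih (insert c (S'.erase a)) hcI
      (by rw [Finset.card_insert_of_notMem hcK]; omega)
      (by rw [Finset.insert_sdiff_of_mem _ hcS, hKd])
    obtain ⟨hbS, hbK⟩ := Finset.mem_sdiff.1 hb
    rw [Finset.mem_insert, not_or] at hbK
    have hab : a ≠ b := fun h => haS (h ▸ hbS)
    have hbS' : b ∉ S' := fun h => hbK.2 (Finset.mem_erase.2 ⟨hab.symm, h⟩)
    have := hloc (S'.erase a) a b c (Finset.notMem_erase a S') hbK.2 hcK hab hac hbK.1
      (by rwa [Finset.insert_erase haS']) hbI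
    rw [Finset.insert_erase haS'] at this
    rcases this with h | h
    · exact ⟨b, Finset.mem_sdiff.2 ⟨hbS, hbS'⟩, h⟩
    · exact ⟨c, Finset.mem_sdiff.2 ⟨hcS, hcS'⟩, h⟩

end LocalExchange

/-! ### Distributions for the counterexample -/

section Distributions

variable {μ : Measure ℝ}

theorem isValueDist_dirac {x : ℝ} (hx : x ∈ Icc (0 : ℝ) 1) : IsValueDist (Measure.dirac x) :=
  ⟨inferInstance, by rw [ae_dirac_eq]; exact hx⟩

/-- The ironed virtual value of the largest value, if it is an atom, is the value itself. -/
theorem IsValueDist.ironedVirtualValue_top (h : IsValueDist μ) {x : ℝ}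
    (hq : quantile μ x = 0) (hr : 0 < sellProb μ x) : ironedVirtualValue μ x = (x : EReal) := by
  refine le_antisymm (h.ironedVirtualValue_le x) ?_
  rw [ironedVirtualValue_of_lt (by rw [hq]; exact one_pos), hq]
  refine EReal.coe_le_coe_iff.2 ?_
  -- The cap keeps the quantile below `1`, also for a point mass.
  set y := min (sellProb μ x) (1 / 2) with hy
  have hy0 : 0 < y := lt_min hr (by norm_num)
  have hy1 : y ≤ 1 / 2 := min_le_right _ _
  have h1 := h.mul_le_ironed (q := y) ⟨hy0.le, by linarith⟩ (min_le_left _ _)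
  have h2 := h.ironed_le_tangent (q := 0) (y := y) (by simp) ⟨hy0.le, by linarith⟩
  rw [h.ironed_zero] at h2
  refine le_of_mul_le_mul_left (a := y) ?_ hy0
  linarith

theorem posVirtual_of_eq {v x : ℝ} (hx : 0 ≤ x) (h : ironedVirtualValue μ v = (x : EReal)) :
    posVirtual μ v = x := by
  rw [posVirtual, h, max_eq_left (EReal.coe_nonneg.2 hx), EReal.toReal_coe]

theorem posVirtual_dirac {x : ℝ} (hx : x ∈ Icc (0 : ℝ) 1) :
    posVirtual (Measure.dirac x) x = x := by
  refine posVirtual_of_eq hx.1 ((isValueDist_dirac hx).ironedVirtualValue_top ?_ ?_)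
  · simp [quantile, Measure.real]
  · simp [sellProb, Measure.real]

/-- The distribution with value `1` with probability `1 / 8` and value `1 / 4` otherwise. -/
def twoPoint : Measure ℝ :=
  ENNReal.ofReal (7 / 8) • Measure.dirac (1 / 4) + ENNReal.ofReal (1 / 8) • Measure.dirac 1

open Classical in
theorem twoPoint_real {s : Set ℝ} (hs : MeasurableSet s) : twoPoint.real s =
    7 / 8 * (if (1 / 4 : ℝ) ∈ s then 1 else 0) + 1 / 8 * (if (1 : ℝ) ∈ s then 1 else 0) := by
  rw [Measure.real, twoPoint, Measure.add_apply, Measure.smul_apply, Measure.smul_apply,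
    Measure.dirac_apply' _ hs, Measure.dirac_apply' _ hs, smul_eq_mul, smul_eq_mul,
    ENNReal.toReal_add, ENNReal.toReal_mul, ENNReal.toReal_mul,
    ENNReal.toReal_ofReal (by norm_num), ENNReal.toReal_ofReal (by norm_num)]
  · congr 2 <;> simp only [indicator, Pi.one_apply] <;> split_ifs <;> simp
  · refine ENNReal.mul_ne_top ENNReal.ofReal_ne_top ?_
    simp only [indicator, Pi.one_apply]; split_ifs <;> simp
  · refine ENNReal.mul_ne_top ENNReal.ofReal_ne_top ?_
    simp only [indicator, Pi.one_apply]; split_ifs <;> simp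

theorem isValueDist_twoPoint : IsValueDist twoPoint := by
  refine ⟨⟨?_⟩, ?_⟩
  · simp only [twoPoint, Measure.add_apply, Measure.smul_apply, measure_univ, smul_eq_mul, mul_one]
    rw [← ENNReal.ofReal_add (by norm_num) (by norm_num)]
    norm_num
  · rw [twoPoint, ae_add_measure_iff]
    constructor
    · refine Measure.ae_smul_measure ?_ _
      rw [ae_dirac_eq]
      exact ⟨by norm_num, by norm_num⟩
    · refine Measure.ae_smul_measure ?_ _
      rw [ae_dirac_eq]
      exact ⟨by norm_num, by norm_num⟩

theorem posVirtual_twoPoint_one : posVirtual twoPoint 1 = 1 := by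
  refine posVirtual_of_eq zero_le_one (isValueDist_twoPoint.ironedVirtualValue_top
    (isValueDist_twoPoint.quantile_eq_zero le_rfl) ?_)
  rw [sellProb, twoPoint_real measurableSet_Ici]
  norm_num

/-- The bound is a chord slope between quantiles `1/8` and `3/4`: the curve is at most `1/8` at the
first and at least `3/16` at the second. -/
theorem le_posVirtual_twoPoint {t : ℝ} (ht : 1 / 4 ≤ t) : 1 / 10 ≤ posVirtual twoPoint t := by
  have h := isValueDist_twoPoint
  refine le_trans ?_ (h.monotone_posVirtual ht)
  have hq : quantile twoPoint (1 / 4) = 1 / 8 := by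
    rw [quantile, twoPoint_real measurableSet_Ioi]; norm_num
  have hr : sellProb twoPoint (1 / 4) = 1 := by
    rw [sellProb, twoPoint_real measurableSet_Ici]; norm_num
  rw [posVirtual_of_lt (by rw [hq]; norm_num), hq]
  refine le_trans ?_ (le_max_left _ _)
  have h1 := h.mul_le_ironed (p := 1 / 4) (q := 3 / 4) ⟨by norm_num, by norm_num⟩
    (by rw [hr]; norm_num)
  have h2 := h.ironed_le_self (q := 1 / 8) ⟨by norm_num, by norm_num⟩
  have h3 := h.ironed_le_tangent (q := 1 / 8) (y := 3 / 4) ⟨by norm_num, by norm_num⟩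
    ⟨by norm_num, by norm_num⟩
  linarith

theorem IsValueDist.dirac_one_dominates (h : IsValueDist μ) : Dominates (Measure.dirac 1) μ := by
  intro v _
  have := h.isProb
  rcases lt_or_ge v 1 with hv | hv
  · have : (Measure.dirac (1 : ℝ)).real (Iic v) = 0 := by simp [Measure.real, hv]
    rw [this]; exact measureReal_nonneg
  · have hq := h.quantile_eq_zero hv
    rw [h.quantile_eq_one_sub_cdf, ProbabilityTheory.cdf_eq_real] at hq
    have : μ.real (Iic v) = 1 := by linarith
    rw [this]; exact measureReal_le_one

end Distributions

/-! ### Failure of monotonicity without the exchange property -/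

section Converse

variable {ι : Type*} [Fintype ι] [DecidableEq ι] {I : Set (Finset ι)} {D : ι → Measure ℝ}

/-- Posting prices to the members of a feasible set of bidders whose values are at least the prices
shows that the optimal revenue is at least the sum of the prices. -/
theorem sum_le_opt (hI : IsDownwardClosed I) (hD : IsProductValueDist D) {S : Finset ι}
    (hS : S ∈ I) {r : ι → ℝ} (hr : ∀ i, 0 ≤ r i) (hae : ∀ i ∈ S, ∀ᵐ t ∂(D i), r i ≤ t) :
    ∑ i ∈ S, r i ≤ opt (feasibleAllocations I) D := by
  classical
  have hprob : ∀ i, IsProbabilityMeasure (D i) := fun i => (hD i).isProb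
  set x : (ι → ℝ) → ι → ℝ := fun v i => if i ∈ S ∧ r i ≤ v i then 1 else 0 with hx
  have hxm : Measurable x := measurable_pi_lambda _ fun i => by
    by_cases hi : i ∈ S
    · simp only [hx, hi, true_and]
      exact Measurable.ite (measurableSet_le measurable_const (measurable_pi_apply i))
        measurable_const measurable_const
    · simp [hx, hi]
  have hA : IsTruthful (feasibleAllocations I) ⟨x, fun v i => r i * x v i⟩ := by
    refine ⟨hxm, measurable_pi_lambda _ fun i =>
      ((measurable_pi_apply i).comp hxm).const_mul (r i), fun v _ => ?_, fun v _ i => ?_,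
      fun v _ i => ?_, fun v _ i b _ => ?_⟩
    · have : x v = indVec (S.filter fun i => r i ≤ v i) := by
        funext i; simp [hx, indVec]
      simp only [this]
      exact indVec_mem (hI.subset_mem S hS _ (Finset.filter_subset _ _))
    · refine mul_nonneg (hr i) ?_
      simp only [hx]; split_ifs <;> norm_num
    · simp only [hx]
      split_ifs with h
      · linarith [h.2]
      · simp
    · simp only [hx, Function.update_self]
      split_ifs with h1 h2 h2
      · exact le_rfl
      · have : v i < r i := not_le.1 fun hh => h2 ⟨h1.1, hh⟩
        linarith
      · linarith [h2.2]
      · exact le_rfl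
  refine le_trans (le_of_eq ?_) (hA.revenue_le_opt hI hD)
  have hae' : ∀ᵐ v ∂(Measure.pi D), ∑ i, r i * x v i = ∑ i ∈ S, r i := by
    filter_upwards [ae_pi_of_ae D (p := fun i t => i ∈ S → r i ≤ t) fun i => by
      by_cases hi : i ∈ S
      · filter_upwards [hae i hi] with t ht _ using ht
      · exact Eventually.of_forall fun t h => absurd h hi] with v hv
    rw [← Finset.sum_subset (Finset.subset_univ S)]
    · exact Finset.sum_congr rfl fun i hi => by simp [hx, hi, hv i hi]
    · intro i _ hi
      simp [hx, hi]
  rw [revenue, integral_congr_ae hae']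
  simp

omit [DecidableEq ι] in
theorem pi_dirac (v : ι → ℝ) :
    Measure.pi (fun i => Measure.dirac (v i)) = Measure.dirac v := by
  classical
  refine Measure.pi_eq fun s hs => ?_
  rw [Measure.dirac_apply' _ (MeasurableSet.univ_pi hs)]
  by_cases h : ∀ i, v i ∈ s i
  · rw [indicator_of_mem (by simpa using h), Finset.prod_eq_one fun i _ => ?_, Pi.one_apply]
    rw [Measure.dirac_apply' _ (hs i), indicator_of_mem (h i), Pi.one_apply]
  · rw [indicator_of_notMem (by simpa using h)]
    push Not at h
    obtain ⟨i, hi⟩ := h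
    refine (Finset.prod_eq_zero (Finset.mem_univ i) ?_).symm
    rw [Measure.dirac_apply' _ (hs i), indicator_of_notMem hi]

omit [DecidableEq ι] in
theorem revenue_dirac (M : Mechanism ι) (v : ι → ℝ) :
    revenue M (fun i => Measure.dirac (v i)) = ∑ i, M.pay v i := by
  rw [revenue, pi_dirac, integral_dirac]

/-- Weights `1` on `K` and `α`, `β`, `γ` on the three further elements. -/
def forkWeight (K : Finset ι) (a b c : ι) (α β γ : ℝ) (i : ι) : ℝ :=
  (if i ∈ K then 1 else 0) + (if i = a then α else 0) + (if i = b then β else 0) +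
    (if i = c then γ else 0)

variable {K : Finset ι} {a b c : ι}

theorem sum_forkWeight (α β γ : ℝ) :
    ∑ i, forkWeight K a b c α β γ i = K.card + α + β + γ := by
  simp [forkWeight, Finset.sum_add_distrib]

omit [Fintype ι] in
theorem forkWeight_nonneg {α β γ : ℝ} (hα : 0 ≤ α) (hβ : 0 ≤ β) (hγ : 0 ≤ γ) (i : ι) :
    0 ≤ forkWeight K a b c α β γ i := by
  unfold forkWeight
  have h1 : (0 : ℝ) ≤ if i ∈ K then 1 else 0 := by split_ifs <;> norm_num
  have h2 : 0 ≤ if i = a then α else 0 := by split_ifs <;> simp [hα]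
  have h3 : 0 ≤ if i = b then β else 0 := by split_ifs <;> simp [hβ]
  have h4 : 0 ≤ if i = c then γ else 0 := by split_ifs <;> simp [hγ]
  linarith

/-- The set `K ∪ {b, c}` stays optimal when `a` gains `1/10` and `b`, `c` lose `1/10` each.
Comparing an optimal `x` under both weights gives `x b + x c - x a ≥ 2`, which forces all three
coordinates; this handles fractional allocations and ties at once. -/
theorem alloc_of_fork (hI : IsDownwardClosed I) (ha : a ∉ K) (hb : b ∉ K) (hc : c ∉ K)
    (hab : a ≠ b) (hac : a ≠ c) (hbc : b ≠ c) (hbcI : insert b (insert c K) ∈ I)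
    (hnb : insert b (insert a K) ∉ I) (hnc : insert c (insert a K) ∉ I) {β γ : ℝ}
    (hβ : 1 / 10 ≤ β) (hγ : 1 / 10 ≤ γ) (hsum : 11 / 10 ≤ β + γ) {x : ι → ℝ}
    (hx : x ∈ feasibleAllocations I)
    (hopt : maxWeight I (forkWeight K a b c (3 / 5) β γ) ≤
      ∑ i, x i * forkWeight K a b c (3 / 5) β γ i) : x b = 1 ∧ x c = 1 ∧ x a = 0 := by
  set w := forkWeight K a b c (7 / 10) (β - 1 / 10) (γ - 1 / 10) with hw
  have hw0 : ∀ i, 0 ≤ w i :=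
    forkWeight_nonneg (by norm_num) (by linarith) (by linarith)
  have htot : ∑ i, w i = K.card + 7 / 10 + (β - 1 / 10) + (γ - 1 / 10) := sum_forkWeight _ _ _
  have hdrop : ∀ (S T : Finset ι), Disjoint S T → ∑ i ∈ S, w i ≤ ∑ i, w i - ∑ i ∈ T, w i := by
    intro S T hST
    have : ∑ i ∈ S ∪ T, w i ≤ ∑ i, w i :=
      Finset.sum_le_sum_of_subset_of_nonneg (Finset.subset_univ _) fun i _ _ => hw0 i
    rw [Finset.sum_union hST] at this
    linarith
  have hwa : w a = 7 / 10 := by simp [hw, forkWeight, ha, hab, hac]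
  have hwb : w b = β - 1 / 10 := by simp [hw, forkWeight, hb, hab.symm, hbc]
  have hwc : w c = γ - 1 / 10 := by simp [hw, forkWeight, hc, hac.symm, hbc.symm]
  have hle : ∀ S ∈ I, ∑ i ∈ S, w i ≤ K.card + β + γ - 1 / 5 := by
    intro S hS
    by_cases hKS : K ⊆ S
    · by_cases haS : a ∈ S
      · have hbS : b ∉ S := fun h => hnb (hI.subset_mem S hS _
          (Finset.insert_subset h (Finset.insert_subset haS hKS)))
        have hcS : c ∉ S := fun h => hnc (hI.subset_mem S hS _
          (Finset.insert_subset h (Finset.insert_subset haS hKS)))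
        have := hdrop S {b, c} (by simp [hbS, hcS])
        rw [Finset.sum_pair hbc, hwb, hwc] at this
        linarith
      · have := hdrop S {a} (by simpa using haS)
        rw [Finset.sum_singleton, hwa] at this
        linarith
    · obtain ⟨k, hk, hkS⟩ := Finset.not_subset.1 hKS
      have := hdrop S {k} (by simpa using hkS)
      have hwk : 1 ≤ w k := by
        have hka : k ≠ a := fun h => ha (h ▸ hk)
        have hkb : k ≠ b := fun h => hb (h ▸ hk)
        have hkc : k ≠ c := fun h => hc (h ▸ hk)
        simp [hw, forkWeight, hk, hka, hkb, hkc]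
      rw [Finset.sum_singleton] at this
      linarith
  have h1 := feasible_sum_le hle hx
  have h2 : K.card + β + γ ≤ maxWeight I (forkWeight K a b c (3 / 5) β γ) := by
    refine le_trans (le_of_eq ?_) (sum_le_maxWeight _ hbcI)
    rw [Finset.sum_insert (by simp [hb, hbc]), Finset.sum_insert hc]
    have hK : ∑ i ∈ K, forkWeight K a b c (3 / 5) β γ i = K.card := by
      rw [Finset.card_eq_sum_ones, Nat.cast_sum]
      refine Finset.sum_congr rfl fun k hk => ?_
      have hka : k ≠ a := fun h => ha (h ▸ hk)
      have hkb : k ≠ b := fun h => hb (h ▸ hk)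
      have hkc : k ≠ c := fun h => hc (h ▸ hk)
      simp [forkWeight, hk, hka, hkb, hkc]
    rw [hK]
    simp [forkWeight, hb, hc, hab.symm, hac.symm, hbc, hbc.symm]
    ring
  have h3 : ∑ i, x i * w i = ∑ i, x i * forkWeight K a b c (3 / 5) β γ i +
      (1 / 10 * x a - 1 / 10 * x b - 1 / 10 * x c) := by
    have : ∀ i, x i * w i = x i * forkWeight K a b c (3 / 5) β γ i +
        ((if i = a then 1 / 10 * x i else 0) - (if i = b then 1 / 10 * x i else 0) -
          (if i = c then 1 / 10 * x i else 0)) := fun i => by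
      simp only [hw, forkWeight]
      split_ifs <;> ring
    simp only [this, Finset.sum_add_distrib, Finset.sum_sub_distrib, Finset.sum_ite_eq',
      Finset.mem_univ, if_true]
  have hxa := feasible_mem_unit hx a
  have hxb := feasible_mem_unit hx b
  have hxc := feasible_mem_unit hx c
  exact ⟨by linarith [hxa.1, hxb.2, hxc.2], by linarith [hxa.1, hxb.2, hxc.2],
    by linarith [hxa.1, hxb.2, hxc.2]⟩

/-- The distributions of the counterexample. -/
def forkDist (K : Finset ι) (a b c : ι) (i : ι) : Measure ℝ :=
  if i = b ∨ i = c then twoPoint else Measure.dirac (forkWeight K a b c (3 / 5) 1 1 i)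

omit [Fintype ι] in
theorem forkWeight_mem_unit (ha : a ∉ K) (hb : b ∉ K) (hc : c ∉ K) (hab : a ≠ b) (hac : a ≠ c)
    (hbc : b ≠ c) (i : ι) : forkWeight K a b c (3 / 5) 1 1 i ∈ Icc (0 : ℝ) 1 := by
  refine ⟨forkWeight_nonneg (by norm_num) zero_le_one zero_le_one i, ?_⟩
  unfold forkWeight
  by_cases h1 : i = a
  · subst h1; simp [ha, hab, hac]; norm_num
  by_cases h2 : i = b
  · subst h2; simp [hb, hab.symm, hbc]
  by_cases h3 : i = c
  · subst h3; simp [hc, hac.symm, hbc.symm]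
  · simp only [h1, h2, h3, if_false, add_zero]
    split_ifs <;> norm_num

theorem isMatroid_of_forSomeTieBreaking (hI : IsDownwardClosed I)
    (h : StrongRevenueMonotoneForSomeTieBreaking (feasibleAllocations I)) : IsMatroid I := by
  refine hI.isMatroid_of_local fun K a b c ha hb hc hab hac hbc haI hbcI => ?_
  by_contra hn
  rw [not_or] at hn
  obtain ⟨hnb, hnc⟩ := hn
  set z : ι → ℝ := forkWeight K a b c (3 / 5) 1 1 with hz
  have hzu : ∀ i, z i ∈ Icc (0 : ℝ) 1 := forkWeight_mem_unit ha hb hc hab hac hbc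
  have hza : z a = 3 / 5 := by simp [hz, forkWeight, ha, hab, hac]
  have hzb : z b = 1 := by simp [hz, forkWeight, hb, hab.symm, hbc]
  have hzc : z c = 1 := by simp [hz, forkWeight, hc, hac.symm, hbc.symm]
  have hzK : ∀ k ∈ K, z k = 1 := fun k hk => by
    have hka : k ≠ a := fun h => ha (h ▸ hk)
    have hkb : k ≠ b := fun h => hb (h ▸ hk)
    have hkc : k ≠ c := fun h => hc (h ▸ hk)
    simp [hz, forkWeight, hk, hka, hkb, hkc]
  set D' := forkDist K a b c with hD'def
  have hD' : IsProductValueDist D' := fun i => by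
    simp only [hD'def, forkDist]
    split_ifs
    · exact isValueDist_twoPoint
    · exact isValueDist_dirac (hzu i)
  have hD : IsProductValueDist fun i => Measure.dirac (z i) := fun i => isValueDist_dirac (hzu i)
  have hdom : ∀ i, Dominates (Measure.dirac (z i)) (D' i) := fun i => by
    by_cases hi : i = b ∨ i = c
    · have : z i = 1 := by rcases hi with rfl | rfl <;> assumption
      rw [this]
      exact (hD' i).dirac_one_dominates
    · simp only [hD'def, forkDist, hi, if_false]
      exact fun v _ => le_rfl
  obtain ⟨M, hM, hrev⟩ := h D' hD'
  have hle := hrev _ hD hdom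
  rw [revenue_dirac] at hle
  -- the optimal revenue
  have hopt : (K.card : ℝ) + 3 / 5 ≤ opt (feasibleAllocations I) D' := by
    refine le_trans (le_of_eq ?_) (sum_le_opt hI hD' haI (r := z) (fun i => (hzu i).1)
      fun i hi => ?_)
    · rw [Finset.sum_insert ha, hza, Finset.sum_congr rfl hzK]
      simp
      ring
    · have hi' : ¬ (i = b ∨ i = c) := by
        rw [Finset.mem_insert] at hi
        rintro (rfl | rfl)
        · exact hi.elim hab.symm hb
        · exact hi.elim hac.symm hc
      simp only [hD'def, forkDist, hi', if_false]
      rw [ae_dirac_eq]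
      exact le_refl (z i)
  -- the weights, when one of the two values drops
  have hwt : virtualWeight D' z = z := funext fun i => by
    by_cases hi : i = b ∨ i = c
    · have hz1 : z i = 1 := by rcases hi with rfl | rfl <;> assumption
      simp only [virtualWeight, hD'def, forkDist, hi, if_true, hz1, posVirtual_twoPoint_one]
    · simp only [virtualWeight, hD'def, forkDist, hi, if_false]
      exact posVirtual_dirac (hzu i)
  have halloc : ∀ β γ : ℝ, 1 / 10 ≤ β → 1 / 10 ≤ γ → 11 / 10 ≤ β + γ → ∀ v : ι → ℝ,
      virtualWeight D' v = forkWeight K a b c (3 / 5) β γ →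
      M.alloc v b = 1 ∧ M.alloc v c = 1 ∧ M.alloc v a = 0 := by
    intro β γ hβ hγ hs v hv
    refine alloc_of_fork hI ha hb hc hab hac hbc hbcI hnb hnc hβ hγ hs (hM.feasible v) ?_
    rw [← hv]
    exact hM.maxWeight_le hI v
  -- With the other one at value `1`, the joint weight of `b` and `c` is at least `1 + 1/10`, so `b`
  -- still wins at value `1/4`.
  have hpb : ∀ t, 1 / 4 ≤ t → M.alloc (Function.update z b t) b = 1 := fun t ht => by
    have hDb : D' b = twoPoint := by simp [hD'def, forkDist]
    have h1 := le_posVirtual_twoPoint ht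
    refine (halloc (posVirtual twoPoint t) 1 h1 (by norm_num) (by linarith) _ ?_).1
    rw [virtualWeight_update, hwt, hDb]
    funext i
    by_cases hi : i = b
    · subst hi; simp [forkWeight, hb, hab.symm, hbc]
    · simp [hz, forkWeight, hi]
  have hpc : ∀ t, 1 / 4 ≤ t → M.alloc (Function.update z c t) c = 1 := fun t ht => by
    have hDc : D' c = twoPoint := by simp [hD'def, forkDist]
    have h1 := le_posVirtual_twoPoint ht
    refine (halloc 1 (posVirtual twoPoint t) (by norm_num) h1 (by linarith) _ ?_).2.1
    rw [virtualWeight_update, hwt, hDc]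
    funext i
    by_cases hi : i = c
    · subst hi; simp [forkWeight, hc, hac.symm, hbc.symm]
    · simp [hz, forkWeight, hi]
  have hxa : M.alloc z a = 0 :=
    (halloc 1 1 (by norm_num) (by norm_num) (by norm_num) z hwt).2.2
  -- the payments
  have hIntNonneg : ∀ i, 0 ≤ ∫ t in (0 : ℝ)..(z i), M.alloc (Function.update z i t) i := fun i =>
    intervalIntegral.integral_nonneg (hzu i).1 fun t _ => (feasible_mem_unit (hM.feasible _) i).1
  have hpay : ∀ i, M.pay z i ≤ z i * M.alloc z i := fun i => by
    rw [hM.payment]; linarith [hIntNonneg i]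
  have hquarter : ∀ i, z i = 1 → (∀ t, 1 / 4 ≤ t → M.alloc (Function.update z i t) i = 1) →
      M.pay z i ≤ 1 / 4 := by
    intro i hzi hi
    have hm : Measurable fun t : ℝ => M.alloc (Function.update z i t) i :=
      (measurable_pi_apply i).comp (hM.measurable_alloc.comp (measurable_update z))
    have hii : ∀ p q, IntervalIntegrable (fun t : ℝ => M.alloc (Function.update z i t) i)
        volume p q := fun p q => by
      rw [intervalIntegrable_iff]
      refine Measure.integrableOn_of_bounded (M := 1) measure_Ioc_lt_top.ne
        hm.aestronglyMeasurable (Eventually.of_forall fun t => ?_)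
      have := feasible_mem_unit (hM.feasible (Function.update z i t)) i
      rw [Real.norm_of_nonneg this.1]
      exact this.2
    rw [hM.payment, hzi, ← intervalIntegral.integral_add_adjacent_intervals (hii 0 (1 / 4))
      (hii (1 / 4) 1)]
    have e1 : 0 ≤ ∫ t in (0 : ℝ)..(1 / 4), M.alloc (Function.update z i t) i :=
      intervalIntegral.integral_nonneg (by norm_num) fun t _ =>
        (feasible_mem_unit (hM.feasible _) i).1
    -- Winning at every bid from `1/4` on makes the rebate in Myerson's formula at least `3/4`.
    have e2 : ∫ t in (1 / 4 : ℝ)..1, M.alloc (Function.update z i t) i = 3 / 4 := by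
      rw [intervalIntegral.integral_congr (g := fun _ => (1 : ℝ)) fun t ht => ?_]
      · rw [intervalIntegral.integral_const]; norm_num
      · rw [uIcc_of_le (by norm_num)] at ht
        exact hi t ht.1
    have e3 := (feasible_mem_unit (hM.feasible z) i).2
    linarith
  have hbound : ∀ i, M.pay z i ≤ forkWeight K a b c 0 (1 / 4) (1 / 4) i := by
    intro i
    by_cases hib : i = b
    · subst hib
      refine (hquarter i hzb hpb).trans ?_
      simp [forkWeight, hb, hbc]
    by_cases hic : i = c
    · subst hic
      refine (hquarter i hzc hpc).trans ?_
      simp [forkWeight, hc, hbc.symm]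
    by_cases hia : i = a
    · subst hia
      refine (hpay i).trans ?_
      rw [hxa, mul_zero]
      exact forkWeight_nonneg le_rfl (by norm_num) (by norm_num) i
    by_cases hiK : i ∈ K
    · refine (hpay i).trans ?_
      rw [hzK i hiK, one_mul]
      refine (feasible_mem_unit (hM.feasible z) i).2.trans ?_
      simp [forkWeight, hiK, hib, hic]
    · refine (hpay i).trans ?_
      have : z i = 0 := by simp [hz, forkWeight, hiK, hia, hib, hic]
      rw [this, zero_mul]
      exact forkWeight_nonneg le_rfl (by norm_num) (by norm_num) i
  -- Payments sum to at most `|K| + 1/4 + 1/4`, short of the `|K| + 3/5` required.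
  have htotal := Finset.sum_le_sum fun i (_ : i ∈ Finset.univ) => hbound i
  rw [sum_forkWeight] at htotal
  linarith

end Converse

end Auction

end

theorem mainTheorem1 {ι : Type*} [Fintype ι] [DecidableEq ι] (I : Set (Finset ι))
    (hI : Auction.IsDownwardClosed I) :
    (Auction.StrongRevenueMonotone (Auction.feasibleAllocations I) ↔ Auction.IsMatroid I) ∧
    (Auction.StrongRevenueMonotoneForSomeTieBreaking (Auction.feasibleAllocations I) ↔
      Auction.IsMatroid I) :=
  ⟨⟨fun h => Auction.isMatroid_of_forSomeTieBreaking hI (h.forSomeTieBreaking hI),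
      fun h => h.strongRevenueMonotone⟩,
    ⟨fun h => Auction.isMatroid_of_forSomeTieBreaking hI h,
      fun h => h.strongRevenueMonotone.forSomeTieBreaking hI⟩⟩
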